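/- Let $d\ge 0$ be an integer and let $Q:\mathbb R^d\times\mathbb R^d\to\mathbb R^d$ be a bilinear map such that the trilinear form $(u,v,w)\mapsto Q(u,v)\cdot w$ is symmetric under all permutations of $(u,v,w)$. Let $s>3/2$ be real and let $A_0\in H^s(\mathbb R;\mathbb R^d)$. Then there is $T>0$ such that for every $\delta\in\mathbb R$ the Cauchy problem $$\partial_t u-\delta\,\partial_{xxx}u+\partial_x\,Q(u,u)=0\quad\text{on }[0,T]\times\mathbb R,\qquad u(0)=A_0,$$ has a unique solution $u\in C([0,T],H^s(\mathbb R;\mathbb R^d))\cap C^1([0,T],H^{s-3}(\mathbb R;\mathbb R^d))$. In particular $T$ does not depend on $\delta$. If $\delta=0$, there is moreover a unique solution in $C([0,T],H^s(\mathbb R;\mathbb R^d))\cap C^1([0,T],H^{s-1}(\mathbb R;\mathbb R^d))$, so that in this case the above solution belongs to $C^1([0,T],H^{s-1}(\mathbb R;\mathbb R^d))$. Here, for real $\sigma$, $H^\sigma(\mathbb R;\mathbb R^d)$ is the space of real ($\mathbb R^d$-valued) tempered distributions $f$ on $\mathbb R$ with $\|f\|_{H^\sigma}=\|\langle D\rangle^\sigma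 f\|_{L^2}<\infty$, derivatives in $t$ at $t=0$ and $t=T$ are one-sided, and the equation is understood in the sense of distributions in $x$ at every time $t\in[0,T]$. -/

import Mathlib

open MeasureTheory
open scoped SchwartzMap

noncomputable section

namespace VectorKdV

/-- The target space `ℝ^d` with its Euclidean structure. -/
abbrev RVec (d : ℕ) : Type := EuclideanSpace ℝ (Fin d)

/-- The complexification `ℂ^d` of the target space (tempered distributions act on
complex-valued Schwartz functions). -/
abbrev CVec (d : ℕ) : Type := EuclideanSpace ℂ (Fin d)

/-- The trilinear form `(u, v, w) ↦ Q(u, v) · w` is invariant under all permutations of its three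
arguments. -/
def IsFullySymmetric {d : ℕ} (Q : RVec d →ₗ[ℝ] RVec d →ₗ[ℝ] RVec d) : Prop :=
  ∀ (σ : Equiv.Perm (Fin 3)) (x : Fin 3 → RVec d),
    inner ℝ (Q (x (σ 0)) (x (σ 1))) (x (σ 2)) = inner ℝ (Q (x 0) (x 1)) (x 2)

/-- The inclusion `ℝ^d ⊆ ℂ^d`. -/
def complexify (d : ℕ) (v : RVec d) : CVec d := WithLp.toLp 2 fun i => (v i : ℂ)

theorem norm_complexify {d : ℕ} (v : RVec d) : ‖complexify d v‖ = ‖v‖ := by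
  simp [complexify, EuclideanSpace.norm_eq]

theorem continuous_complexify (d : ℕ) : Continuous (complexify d) := by
  unfold complexify
  fun_prop

theorem memLp_complexify {d : ℕ} {p : ENNReal} {g : ℝ → RVec d} (hg : MemLp g p volume) :
    MemLp (fun x => complexify d (g x)) p volume :=
  hg.of_le ((continuous_complexify d).comp_aestronglyMeasurable hg.1)
    (Filter.Eventually.of_forall fun x => (norm_complexify (g x)).le)

/-- The tempered distribution `φ ↦ ∫ φ(x) g(x) dx` of an `ℝ^d`-valued `L^p` function `g`. -/
def distOf {d : ℕ} (p : ENNReal) [Fact (1 ≤ p)] (g : ℝ → RVec d) (hg : MemLp g p volume) :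
    𝓢'(ℝ, CVec d) :=
  ((memLp_complexify hg).toLp (fun x => complexify d (g x)) : Lp (CVec d) p volume)

/-- The spatial derivative `∂_x` of tempered distributions. -/
abbrev dx {d : ℕ} : 𝓢'(ℝ, CVec d) →L[ℂ] 𝓢'(ℝ, CVec d) := TemperedDistribution.derivCLM (CVec d)

/-- A tempered distribution is real (that is, `ℝ^d`-valued) if it takes values in `ℝ^d` on
real-valued test functions. -/
def IsReal {d : ℕ} (f : 𝓢'(ℝ, CVec d)) : Prop :=
  ∀ φ : 𝓢(ℝ, ℂ), (∀ x, (φ x).im = 0) → ∀ i, (f φ i).im = 0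

/-- The real tempered distributions `f` with `⟨D⟩^s f ∈ L²`. -/
def sobolevSubmodule (d : ℕ) (s : ℝ) : Submodule ℝ 𝓢'(ℝ, CVec d) where
  carrier := {f | TemperedDistribution.MemSobolev s 2 f ∧ IsReal f}
  add_mem' := by
    rintro f g ⟨hf, hf'⟩ ⟨hg, hg'⟩
    refine ⟨hf.add hg, fun φ hφ i => ?_⟩
    have h1 := hf' φ hφ i
    have h2 := hg' φ hφ i
    change (f φ i + g φ i).im = 0
    simp [h1, h2]
  zero_mem' := ⟨TemperedDistribution.memSobolev_fun_zero ℝ (CVec d) s 2, fun φ hφ i => by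
    change ((0 : CVec d) i).im = 0
    simp⟩
  smul_mem' := by
    rintro c f ⟨hf, hf'⟩
    refine ⟨?_, fun φ hφ i => ?_⟩
    · have h := hf.smul (c : ℂ)
      have e : (c : ℂ) • f = c • f := by
        ext φ i
        change (c : ℂ) * f φ i = (c • f φ) i
        simp
      rwa [e] at h
    · have h1 := hf' φ hφ i
      change ((c • f φ) i).im = 0
      simp [h1]

/-- The Sobolev space `H^s(ℝ; ℝ^d)`, for any real `s`. Its norm, defined below, is
`‖f‖ = ‖⟨D⟩^s f‖_{L²}`. -/
def Sob (d : ℕ) (s : ℝ) : Type := ↥(sobolevSubmodule d s)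

instance instAddCommGroupSob (d : ℕ) (s : ℝ) : AddCommGroup (Sob d s) :=
  inferInstanceAs (AddCommGroup (sobolevSubmodule d s))

instance instModuleSob (d : ℕ) (s : ℝ) : Module ℝ (Sob d s) :=
  inferInstanceAs (Module ℝ (sobolevSubmodule d s))

/-- The tempered distribution underlying an element of `H^s`. -/
def Sob.dist {d : ℕ} {s : ℝ} (f : Sob d s) : 𝓢'(ℝ, CVec d) := Subtype.val f

theorem toTemperedDistribution_injective (d : ℕ) :
    Function.Injective (Lp.toTemperedDistributionCLM (CVec d) (volume : Measure ℝ) 2) :=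
  LinearMap.ker_eq_bot.mp
    (Lp.ker_toTemperedDistributionCLM_eq_bot (F := CVec d) (μ := (volume : Measure ℝ)) (p := 2))

/-- The `L²` function `⟨D⟩^s f`, for `f ∈ H^s`. -/
def besselFun {d : ℕ} {s : ℝ} (f : Sob d s) : Lp (CVec d) 2 (volume : Measure ℝ) :=
  Classical.choose f.2.1

theorem besselFun_spec {d : ℕ} {s : ℝ} (f : Sob d s) :
    TemperedDistribution.besselPotential ℝ (CVec d) s f.dist =
      Lp.toTemperedDistributionCLM (CVec d) (volume : Measure ℝ) 2 (besselFun f) :=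
  Classical.choose_spec f.2.1

/-- The linear map `f ↦ ⟨D⟩^s f` from `H^s` to `L²`. -/
def besselL2 (d : ℕ) (s : ℝ) : Sob d s →ₗ[ℝ] Lp (CVec d) 2 (volume : Measure ℝ) where
  toFun := besselFun
  map_add' f g := by
    apply toTemperedDistribution_injective d
    rw [map_add, ← besselFun_spec, ← besselFun_spec, ← besselFun_spec, ← map_add]
    rfl
  map_smul' c f := by
    apply toTemperedDistribution_injective d
    rw [RingHom.id_apply, ContinuousLinearMap.map_smul_of_tower, ← besselFun_spec,
      ← besselFun_spec, ← ContinuousLinearMap.map_smul_of_tower]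
    rfl

theorem besselL2_injective (d : ℕ) (s : ℝ) : Function.Injective (besselL2 d s) := by
  intro f g h
  have h1 : TemperedDistribution.besselPotential ℝ (CVec d) s f.dist =
      TemperedDistribution.besselPotential ℝ (CVec d) s g.dist := by
    rw [besselFun_spec, besselFun_spec]
    exact congrArg _ h
  have h2 := congrArg (TemperedDistribution.besselPotential ℝ (CVec d) (-s)) h1
  simp only [TemperedDistribution.besselPotential_besselPotential_apply, add_neg_cancel,
    TemperedDistribution.besselPotential_zero] at h2
  exact Subtype.ext h2

instance instNormedAddCommGroupSob (d : ℕ) (s : ℝ) : NormedAddCommGroup (Sob d s) :=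
  NormedAddCommGroup.induced (Sob d s) (Lp (CVec d) 2 (volume : Measure ℝ)) (besselL2 d s)
    (besselL2_injective d s)

instance instNormedSpaceSob (d : ℕ) (s : ℝ) : NormedSpace ℝ (Sob d s) :=
  NormedSpace.induced ℝ (Sob d s) (Lp (CVec d) 2 (volume : Measure ℝ)) (besselL2 d s)

theorem norm_sob_eq {d : ℕ} {s : ℝ} (f : Sob d s) : ‖f‖ = ‖besselFun f‖ := rfl

theorem memLp_quadratic {d : ℕ} (Q : RVec d →ₗ[ℝ] RVec d →ₗ[ℝ] RVec d) {g : ℝ → RVec d}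
    (hg : MemLp g 2 volume) : MemLp (fun x => Q (g x) (g x)) 1 volume := by
  let B : RVec d →L[ℝ] RVec d →L[ℝ] RVec d :=
    LinearMap.toContinuousLinearMap ((LinearMap.toContinuousLinearMap (𝕜 := ℝ)).toLinearMap ∘ₗ Q)
  have hB : ∀ x y, Q x y = B x y := fun _ _ => rfl
  simp only [hB]
  exact MemLp.of_bilin (fun a b => B a b) ‖B‖₊ hg hg
    (B.aestronglyMeasurable_comp₂ hg.1 hg.1)
    (Filter.Eventually.of_forall fun x => by
      exact_mod_cast B.le_opNorm₂ (g x) (g x))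

/-- `q = Q(f, f)`: the distribution `f` is an `ℝ^d`-valued function `g ∈ L²`, and `q` is the
distribution of the integrable function `x ↦ Q(g(x), g(x))`. -/
def IsQuadratic {d : ℕ} (Q : RVec d →ₗ[ℝ] RVec d →ₗ[ℝ] RVec d) (f q : 𝓢'(ℝ, CVec d)) : Prop :=
  ∃ (g : ℝ → RVec d) (hg : MemLp g 2 volume),
    f = distOf 2 g hg ∧ q = distOf 1 (fun x => Q (g x) (g x)) (memLp_quadratic Q hg)

/-- `u ∈ C([0,T], H^s) ∩ C¹([0,T], H^r)` solves
`∂_t u - δ ∂_{xxx} u + ∂_x Q(u, u) = 0` on `[0,T]` with `u(0) = A₀`.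
The function `w` is `u` regarded as a function of time with values in `H^r` (its values outside
`[0,T]` are irrelevant), and the equation holds in the sense of distributions in `x`
at every time `t ∈ [0,T]`. -/
def IsSolution {d : ℕ} (Q : RVec d →ₗ[ℝ] RVec d →ₗ[ℝ] RVec d) (δ s r T : ℝ) (A₀ : Sob d s)
    (u : C(Set.Icc (0 : ℝ) T, Sob d s)) : Prop :=
  (∀ t : Set.Icc (0 : ℝ) T, (t : ℝ) = 0 → u t = A₀) ∧
  ∃ w : ℝ → Sob d r,
    (∀ t : Set.Icc (0 : ℝ) T, (w t).dist = (u t).dist) ∧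
    ContDiffOn ℝ 1 w (Set.Icc 0 T) ∧
    ∀ t : Set.Icc (0 : ℝ) T, ∃ q : 𝓢'(ℝ, CVec d), IsQuadratic Q (u t).dist q ∧
      (derivWithin w (Set.Icc 0 T) t).dist - δ • dx (dx (dx (u t).dist)) + dx q = 0

end VectorKdV

end

/-!
A solution `u` is represented by the function `F = ⟨ξ⟩^s û` of `L²(ℝ; ℂ^d)`, so that `‖u‖_{H^s}` is
`‖F‖`; that `u` is real means that `F(-ξ)` is the conjugate of `F(ξ)` (`IsHerm`). In these terms
`∂_x Q(u, u)` is a bilinear operator with an explicit frequency kernel (`kern`, `bil`), and the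
dispersive term is the multiplier with the purely imaginary symbol `δ (2πiξ)³`.

The time of existence comes from an energy estimate. The derivative of `‖F‖²` is a trilinear
integral over the plane `ξ₁ + ξ₂ + ξ₃ = 0`. Since `Q` is fully symmetric, its symbol may be replaced
by its symmetrization, a multiple of `∑ ξ_j ⟨ξ_j⟩^(2s)`, which is bounded by a multiple of the lowest
frequency times the weights `⟨·⟩^s` of the two others (`abs_symbol_le`). Such an integral
is at most a multiple of `‖F‖³`, because `⟨ξ⟩^(1-s)` is square integrable for `s > 3/2`. The
dispersion contributes the real part of an imaginary number, that is nothing, so that the estimate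
`abs_re_inner_galerkin_le` is uniform in `δ`. It is also uniform in a sharp frequency cutoff
`|ξ| ≤ n`, and it holds just as well for the truncated weights `min(⟨ξ⟩, k)^s`.

With the cutoff the equation is an ordinary differential equation in `L²`. By the energy estimate
its solutions exist, with a uniform bound in `H^s`, on an interval `[0,T]` which depends only on the
norm of the data (`exists_galerkin_solution`). The difference `v` of two such solutions satisfies an
`L²` estimate, which rests on the same cancellation: symmetrized in the two arguments `v`, the symbol
is `ξ₂ + ξ₃ = -ξ₁`, so that the derivative falls on the sum of the two solutions; the cutoff only
leaves an error that vanishes as `n → ∞` (`norm_low_sub_sq_le`). Hence the Galerkin solutions converge in `L²` uniformly in time, to a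
function which is bounded in `H^s` and solves the equation in every frequency band
(`ApproxSol`, `exists_approxSol`), and such a function is unique (`eq_of_approxSol`). It is
continuous in `H^s` because it is so in every frequency band and because its `H^s` norm is
continuous: the energy estimate for `min(⟨ξ⟩, k)^s` bounds the rate of change of the truncated norms
uniformly in `k`, and passes to the limit, first in `n` and then in `k` (`continuousOn_of_norm_sq`).

The right-hand side of the equation is a continuous function of `u ∈ H^s` with values in `H^r` if
`r ≤ s - 1` and moreover `r ≤ s - 3` or `δ = 0`. For these `r`, solving the equation in every
frequency band is therefore equivalent to solving it in `C¹([0,T], H^r)`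
(`hasDerivWithinAt_of_approxSol`, `approxSol_of_hasDerivWithinAt`). The return to distributions is
`isSolution_iff`, which rests on the computation of the Fourier transform of `∂_x Q(u, u)` from the
pointwise product (`fourier_dx_quadratic`, `freq_bil`).
-/

noncomputable section

namespace VectorKdV

open Filter Topology

/-! ### Weights -/

/-- The weight `⟨ξ⟩^σ = (1 + ξ²)^(σ/2)` on the frequency line. -/
def jb (σ ξ : ℝ) : ℝ := (1 + ‖ξ‖ ^ 2) ^ (σ / 2)

theorem jb_pos (σ ξ : ℝ) : 0 < jb σ ξ := by unfold jb; positivity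

theorem jb_mul (a b ξ : ℝ) : jb a ξ * jb b ξ = jb (a + b) ξ := by
  unfold jb
  rw [← Real.rpow_add (by positivity)]
  ring_nf

theorem jb_zero (ξ : ℝ) : jb 0 ξ = 1 := by simp [jb]

theorem jb_neg_mul (a ξ : ℝ) : jb (-a) ξ * jb a ξ = 1 := by
  rw [jb_mul, neg_add_cancel, jb_zero]

theorem jb_mul_neg (a ξ : ℝ) : jb a ξ * jb (-a) ξ = 1 := by
  rw [jb_mul, add_neg_cancel, jb_zero]

theorem jb_even (σ ξ : ℝ) : jb σ (-ξ) = jb σ ξ := by simp [jb]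

theorem jb_mono {a b : ℝ} (h : a ≤ b) (ξ : ℝ) : jb a ξ ≤ jb b ξ :=
  Real.rpow_le_rpow_of_exponent_le (by simp; positivity) (by linarith)

theorem jb_le_one {a : ℝ} (h : a ≤ 0) (ξ : ℝ) : jb a ξ ≤ 1 := by
  simpa [jb_zero] using jb_mono h ξ

theorem one_le_jb {a : ℝ} (h : 0 ≤ a) (ξ : ℝ) : 1 ≤ jb a ξ := by
  simpa [jb_zero] using jb_mono h ξ

theorem jb_eq_rpow (σ ξ : ℝ) : jb σ ξ = jb 1 ξ ^ σ := by
  unfold jb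
  rw [← Real.rpow_mul (by positivity)]
  ring_nf

theorem jb_one_eq_sqrt (ξ : ℝ) : jb 1 ξ = √(1 + ξ ^ 2) := by
  simp [jb, Real.sqrt_eq_rpow]

theorem abs_le_jb_one (ξ : ℝ) : |ξ| ≤ jb 1 ξ := by
  rw [jb_one_eq_sqrt]
  exact Real.abs_le_sqrt (by linarith)

theorem jb_one_le_of_abs_le {ξ η : ℝ} (h : |ξ| ≤ |η|) : jb 1 ξ ≤ jb 1 η := by
  rw [jb_one_eq_sqrt, jb_one_eq_sqrt]
  exact Real.sqrt_le_sqrt (by linarith [sq_le_sq.2 h])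

/-- The function `⟨·⟩` is `1`-Lipschitz. -/
theorem abs_jb_one_sub_le (ξ η : ℝ) : |jb 1 ξ - jb 1 η| ≤ |ξ - η| := by
  have h1 := jb_pos 1 ξ
  have h2 := jb_pos 1 η
  have e : (jb 1 ξ - jb 1 η) * (jb 1 ξ + jb 1 η) = (ξ - η) * (ξ + η) := by
    have a1 : jb 1 ξ * jb 1 ξ = 1 + ξ ^ 2 := by
      rw [jb_one_eq_sqrt, Real.mul_self_sqrt (by positivity)]
    have a2 : jb 1 η * jb 1 η = 1 + η ^ 2 := by
      rw [jb_one_eq_sqrt, Real.mul_self_sqrt (by positivity)]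
    linear_combination a1 - a2
  have e' := congrArg abs e
  rw [abs_mul, abs_mul, abs_of_pos (add_pos h1 h2)] at e'
  have h3 : |ξ + η| ≤ jb 1 ξ + jb 1 η :=
    (abs_add_le _ _).trans (add_le_add (abs_le_jb_one _) (abs_le_jb_one _))
  have h4 : |jb 1 ξ - jb 1 η| * (jb 1 ξ + jb 1 η) ≤ |ξ - η| * (jb 1 ξ + jb 1 η) := by
    rw [e']; gcongr
  exact le_of_mul_le_mul_right h4 (add_pos h1 h2)

theorem jb_one_add_le (ξ η : ℝ) : jb 1 (ξ + η) ≤ jb 1 ξ + jb 1 η := by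
  have h := (abs_le.1 (abs_jb_one_sub_le (ξ + η) ξ)).2
  have h' := abs_le_jb_one η
  simp only [add_sub_cancel_left] at h
  linarith

/-- The quasi-triangle inequality for `⟨·⟩^s`, the source of the algebra property of `H^s`. -/
theorem jb_add_le {s : ℝ} (hs : 0 ≤ s) (ξ η : ℝ) :
    jb s (ξ + η) ≤ 2 ^ s * (jb s ξ + jb s η) := by
  wlog h : jb 1 η ≤ jb 1 ξ generalizing ξ η
  · rw [add_comm ξ η, add_comm (jb s ξ)]
    exact this η ξ (le_of_not_ge h)
  have h1 : jb 1 (ξ + η) ≤ 2 * jb 1 ξ := by linarith [jb_one_add_le ξ η]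
  calc jb s (ξ + η) = jb 1 (ξ + η) ^ s := jb_eq_rpow _ _
    _ ≤ (2 * jb 1 ξ) ^ s := Real.rpow_le_rpow (jb_pos _ _).le h1 hs
    _ = 2 ^ s * jb s ξ := by rw [Real.mul_rpow (by norm_num) (jb_pos _ _).le, ← jb_eq_rpow]
    _ ≤ _ := by
      have := jb_pos s η
      gcongr
      linarith

theorem continuous_jb (σ : ℝ) : Continuous (jb σ) := by
  unfold jb
  refine Continuous.rpow_const (by fun_prop) fun x => Or.inl (by positivity)

theorem measurable_jb (σ : ℝ) : Measurable (jb σ) := (continuous_jb σ).measurable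

/-- Beyond the critical exponent `1/2` the weight `⟨·⟩^(-r)` is square integrable. -/
theorem memLp_jb {r : ℝ} (hr : 1 / 2 < r) : MemLp (jb (-r)) 2 (volume : Measure ℝ) := by
  rw [memLp_two_iff_integrable_sq (measurable_jb _).aestronglyMeasurable]
  have h := integrable_rpow_neg_one_add_norm_sq (E := ℝ) (μ := volume) (r := 2 * r)
    (by simp; linarith)
  refine h.congr (Filter.Eventually.of_forall fun ξ => ?_)
  simp only [jb]
  rw [← Real.rpow_natCast ((1 + ‖ξ‖ ^ 2) ^ (-r / 2)), ← Real.rpow_mul (by positivity)]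
  congr 1
  push_cast
  ring

/-! ### Bounded multipliers on `L²` -/

/-- The space `L²(ℝ; ℂ^d)`, in which Fourier transforms live. -/
abbrev L2 (d : ℕ) : Type := Lp (CVec d) 2 (volume : Measure ℝ)

/-- Bounded measurable symbols. -/
def BddMeas (m : ℝ → ℂ) : Prop := Measurable m ∧ ∃ C : ℝ, ∀ ξ, ‖m ξ‖ ≤ C

theorem BddMeas.memLp {m : ℝ → ℂ} (hm : BddMeas m) : MemLp m ⊤ (volume : Measure ℝ) :=
  memLp_top_of_bound hm.1.aestronglyMeasurable _ (Filter.Eventually.of_forall hm.2.choose_spec)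

theorem BddMeas.mul {m m' : ℝ → ℂ} (h : BddMeas m) (h' : BddMeas m') :
    BddMeas (fun ξ => m ξ * m' ξ) := by
  obtain ⟨C, hC⟩ := h.2
  obtain ⟨C', hC'⟩ := h'.2
  refine ⟨h.1.mul h'.1, C * C', fun ξ => ?_⟩
  rw [norm_mul]
  exact mul_le_mul (hC ξ) (hC' ξ) (norm_nonneg _) ((norm_nonneg _).trans (hC ξ))

theorem BddMeas.conj {m : ℝ → ℂ} (h : BddMeas m) : BddMeas (fun ξ => (starRingEnd ℂ) (m ξ)) := by
  obtain ⟨C, hC⟩ := h.2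
  exact ⟨Complex.continuous_conj.measurable.comp h.1, C, fun ξ => by simpa using hC ξ⟩

open Classical in
/-- Multiplication by a bounded measurable symbol, as an operator on `L²` (and zero for other
symbols). -/
def mulL {d : ℕ} (m : ℝ → ℂ) : L2 d →L[ℂ] L2 d :=
  if hm : BddMeas m then
    (ContinuousLinearMap.lsmul ℂ ℂ).holderL volume ⊤ 2 2 (hm.memLp.toLp m)
  else 0

theorem coeFn_mulL {d : ℕ} {m : ℝ → ℂ} (hm : BddMeas m) (F : L2 d) :
    mulL m F =ᵐ[volume] fun ξ => m ξ • F ξ := by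
  rw [mulL, dif_pos hm]
  change ((ContinuousLinearMap.lsmul ℂ ℂ).holder 2 (hm.memLp.toLp m) F : L2 d) =ᵐ[volume] _
  filter_upwards [ContinuousLinearMap.coeFn_holder (r := 2)
    (ContinuousLinearMap.lsmul ℂ ℂ : ℂ →L[ℂ] CVec d →L[ℂ] CVec d) (hm.memLp.toLp m) F,
    hm.memLp.coeFn_toLp] with ξ h1 h2
  rw [h1, h2]
  rfl

theorem mulL_mulL {d : ℕ} {m m' : ℝ → ℂ} (hm : BddMeas m) (hm' : BddMeas m') (F : L2 d) :
    mulL m (mulL m' F) = mulL (fun ξ => m ξ * m' ξ) F := by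
  apply Lp.ext
  filter_upwards [coeFn_mulL hm (mulL m' F), coeFn_mulL hm' F, coeFn_mulL (hm.mul hm') F]
    with ξ h1 h2 h3
  rw [h1, h2, h3, mul_smul]

theorem mulL_congr {d : ℕ} {m m' : ℝ → ℂ} (h : ∀ ξ, m ξ = m' ξ) (F : L2 d) :
    mulL m F = mulL m' F := by
  rw [funext h]

theorem norm_mulL_le {d : ℕ} {m : ℝ → ℂ} (hm : BddMeas m) {C : ℝ} (hC : ∀ ξ, ‖m ξ‖ ≤ C)
    (F : L2 d) : ‖mulL m F‖ ≤ C * ‖F‖ := by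
  apply Lp.norm_le_mul_norm_of_ae_le_mul
  filter_upwards [coeFn_mulL hm F] with ξ h1
  rw [h1, norm_smul]
  exact mul_le_mul_of_nonneg_right (hC ξ) (norm_nonneg _)

theorem norm_mulL_le_of_le {d : ℕ} {m m' : ℝ → ℂ} (hm : BddMeas m) (hm' : BddMeas m')
    (h : ∀ ξ, ‖m ξ‖ ≤ ‖m' ξ‖) (F : L2 d) : ‖mulL m F‖ ≤ ‖mulL m' F‖ := by
  apply Lp.norm_le_norm_of_ae_le
  filter_upwards [coeFn_mulL hm F, coeFn_mulL hm' F] with ξ h1 h2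
  rw [h1, h2, norm_smul, norm_smul]
  exact mul_le_mul_of_nonneg_right (h ξ) (norm_nonneg _)

theorem inner_mulL {d : ℕ} {m : ℝ → ℂ} (hm : BddMeas m) (F G : L2 d) :
    inner ℂ (mulL m F) G = inner ℂ F (mulL (fun ξ => (starRingEnd ℂ) (m ξ)) G) := by
  rw [L2.inner_def, L2.inner_def]
  apply integral_congr_ae
  filter_upwards [coeFn_mulL hm F, coeFn_mulL hm.conj G] with ξ h1 h2
  rw [h1, h2, inner_smul_left, inner_smul_right]

/-- The indicator function of the frequency band `|ξ| ≤ n`. -/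
def ind (n ξ : ℝ) : ℝ := if |ξ| ≤ n then 1 else 0

theorem ind_nonneg (n ξ : ℝ) : 0 ≤ ind n ξ := by unfold ind; split_ifs <;> norm_num

theorem ind_le_one (n ξ : ℝ) : ind n ξ ≤ 1 := by unfold ind; split_ifs <;> norm_num

theorem ind_even (n ξ : ℝ) : ind n (-ξ) = ind n ξ := by simp [ind]

theorem ind_mul_ind {n m : ℝ} (h : n ≤ m) (ξ : ℝ) : ind n ξ * ind m ξ = ind n ξ := by
  unfold ind
  split_ifs <;> linarith

theorem ind_mul_self (n ξ : ℝ) : ind n ξ * ind n ξ = ind n ξ := ind_mul_ind le_rfl ξ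

theorem ind_mono {n m : ℝ} (h : n ≤ m) (ξ : ℝ) : ind n ξ ≤ ind m ξ := by
  unfold ind
  split_ifs <;> linarith

theorem measurable_ind (n : ℝ) : Measurable (ind n) :=
  Measurable.ite (measurableSet_le (by fun_prop) measurable_const) measurable_const
    measurable_const

/-- A band-limited continuous symbol is bounded. -/
theorem bddMeas_ind_mul (n : ℝ) {m : ℝ → ℂ} (hm : Continuous m) :
    BddMeas (fun ξ => (ind n ξ : ℂ) * m ξ) := by
  refine ⟨(Complex.measurable_ofReal.comp (measurable_ind n)).mul hm.measurable, ?_⟩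
  obtain ⟨C, hC⟩ := (isCompact_Icc (a := -n) (b := n)).exists_bound_of_continuousOn hm.continuousOn
  refine ⟨max C 0, fun ξ => ?_⟩
  by_cases h : |ξ| ≤ n
  · simpa [ind, h] using Or.inl (hC ξ (abs_le.1 h))
  · simp [ind, h]

theorem bddMeas_ind (n : ℝ) : BddMeas (fun ξ => (ind n ξ : ℂ)) := by
  simpa using bddMeas_ind_mul n (m := fun _ => 1) continuous_const

theorem bddMeas_one_sub_ind (n : ℝ) : BddMeas (fun ξ => ((1 - ind n ξ : ℝ) : ℂ)) := by
  refine ⟨Complex.measurable_ofReal.comp (measurable_const.sub (measurable_ind n)), 1, fun ξ => ?_⟩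
  rw [Complex.norm_real, Real.norm_eq_abs, abs_le]
  constructor <;> linarith [ind_nonneg n ξ, ind_le_one n ξ]

theorem bddMeas_jb {a : ℝ} (h : a ≤ 0) : BddMeas (fun ξ => (jb a ξ : ℂ)) := by
  refine ⟨Complex.measurable_ofReal.comp (measurable_jb a), 1, fun ξ => ?_⟩
  rw [Complex.norm_real, Real.norm_of_nonneg (jb_pos _ _).le]
  exact jb_le_one h ξ

/-- An `L²` function is determined by its frequency truncations. -/
theorem eq_of_forall_ind {d : ℕ} {F G : L2 d}
    (h : ∀ n : ℕ, mulL (fun ξ => (ind n ξ : ℂ)) F = mulL (fun ξ => (ind n ξ : ℂ)) G) : F = G := by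
  apply Lp.ext
  have h1 : ∀ᵐ ξ, ∀ n : ℕ, (ind n ξ : ℂ) • F ξ = (ind n ξ : ℂ) • G ξ := by
    rw [ae_all_iff]
    intro n
    filter_upwards [coeFn_mulL (bddMeas_ind n) F, coeFn_mulL (bddMeas_ind n) G] with ξ h1 h2
    rw [← h1, ← h2, h n]
  filter_upwards [h1] with ξ h1
  obtain ⟨n, hn⟩ := exists_nat_ge |ξ|
  simpa [ind, hn] using h1 n

/-! ### The reality condition -/

/-- Coordinatewise complex conjugation on `ℂ^d`. -/
def conjV {d : ℕ} (v : CVec d) : CVec d := WithLp.toLp 2 fun i => (starRingEnd ℂ) (v i)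

@[simp] theorem conjV_apply {d : ℕ} (v : CVec d) (i : Fin d) :
    conjV v i = (starRingEnd ℂ) (v i) := rfl

theorem norm_conjV {d : ℕ} (v : CVec d) : ‖conjV v‖ = ‖v‖ := by
  simp [EuclideanSpace.norm_eq]

theorem conjV_conjV {d : ℕ} (v : CVec d) : conjV (conjV v) = v := by
  ext i; simp

theorem conjV_smul {d : ℕ} (c : ℂ) (v : CVec d) :
    conjV (c • v) = (starRingEnd ℂ) c • conjV v := by
  ext i; simp

/-- Coordinatewise conjugation as a real-linear map. -/
def conjL (d : ℕ) : CVec d →L[ℝ] CVec d :=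
  LinearMap.mkContinuous
    { toFun := conjV
      map_add' := fun u v => by ext i; simp
      map_smul' := fun c v => by ext i; simp } 1 fun v => by
    simp [norm_conjV]

theorem conjL_apply {d : ℕ} (v : CVec d) : conjL d v = conjV v := rfl

theorem measurePreserving_neg_real :
    MeasurePreserving (fun ξ : ℝ => -ξ) volume volume := Measure.measurePreserving_neg volume

/-- The involution `F ↦ conj F(-·)`, which fixes exactly the Fourier transforms of real functions. -/
def refl (d : ℕ) : L2 d →L[ℝ] L2 d :=
  (conjL d).compLpL 2 volume ∘L
    (Lp.compMeasurePreservingₗᵢ ℝ (fun ξ : ℝ => -ξ)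
      measurePreserving_neg_real).toContinuousLinearMap

theorem coeFn_refl {d : ℕ} (F : L2 d) : refl d F =ᵐ[volume] fun ξ => conjV (F (-ξ)) := by
  have h1 := (conjL d).coeFn_compLpL (p := 2) (μ := volume)
    (Lp.compMeasurePreserving (fun ξ : ℝ => -ξ) measurePreserving_neg_real F)
  have h2 := Lp.coeFn_compMeasurePreserving F measurePreserving_neg_real
  filter_upwards [h1, h2] with ξ h1 h2
  change ((conjL d).compLpL 2 volume
    (Lp.compMeasurePreserving (fun ξ : ℝ => -ξ) measurePreserving_neg_real F)) ξ = _
  rw [h1, h2]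
  rfl

/-- `F` is the Fourier transform of an `ℝ^d`-valued function: `F(-ξ) = conj F(ξ)`. -/
def IsHerm {d : ℕ} (F : L2 d) : Prop := refl d F = F

theorem isHerm_iff {d : ℕ} {F : L2 d} : IsHerm F ↔ ∀ᵐ ξ, conjV (F (-ξ)) = F ξ := by
  constructor
  · intro h
    have := coeFn_refl F
    rw [h] at this
    filter_upwards [this] with ξ h
    exact h.symm
  · intro h
    apply Lp.ext
    filter_upwards [h, coeFn_refl F] with ξ h1 h2
    rw [h2, h1]

theorem refl_mulL {d : ℕ} {m : ℝ → ℂ} (hm : BddMeas m)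
    (h : ∀ ξ, m (-ξ) = (starRingEnd ℂ) (m ξ)) (F : L2 d) :
    refl d (mulL m F) = mulL m (refl d F) := by
  apply Lp.ext
  have e := measurePreserving_neg_real.quasiMeasurePreserving.ae (coeFn_mulL hm F)
  filter_upwards [coeFn_refl (mulL m F), coeFn_mulL hm (refl d F), e, coeFn_refl F]
    with ξ h1 h2 h3 h4
  rw [h1, h2, h3, h4, conjV_smul, h, Complex.conj_conj]

theorem IsHerm.mulL {d : ℕ} {m : ℝ → ℂ} (hm : BddMeas m)
    (h : ∀ ξ, m (-ξ) = (starRingEnd ℂ) (m ξ)) {F : L2 d} (hF : IsHerm F) :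
    IsHerm (mulL m F) := by
  unfold IsHerm
  rw [refl_mulL hm h, hF]

theorem refl_refl {d : ℕ} (F : L2 d) : refl d (refl d F) = F := by
  apply Lp.ext
  have e := measurePreserving_neg_real.quasiMeasurePreserving.ae (coeFn_refl F)
  filter_upwards [coeFn_refl (refl d F), e] with ξ h1 h2
  rw [h1, h2, neg_neg, conjV_conjV]

theorem IsHerm.sub {d : ℕ} {F G : L2 d} (hF : IsHerm F) (hG : IsHerm G) : IsHerm (F - G) := by
  unfold IsHerm
  rw [map_sub, hF, hG]

/-- The projection `(1 + refl)/2` onto the Fourier transforms of real functions. -/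
def hermProj (d : ℕ) : L2 d →L[ℝ] L2 d := (1 / 2 : ℝ) • (ContinuousLinearMap.id ℝ _ + refl d)

theorem isHerm_hermProj {d : ℕ} (F : L2 d) : IsHerm (hermProj d F) := by
  unfold IsHerm hermProj
  simp [refl_refl, add_comm]

theorem hermProj_of_isHerm {d : ℕ} {F : L2 d} (hF : IsHerm F) : hermProj d F = F := by
  change (1 / 2 : ℝ) • (F + refl d F) = F
  rw [hF, ← two_smul ℝ F, smul_smul]
  norm_num

/-! ### The complexified nonlinearity -/

section Nonlinearity

variable {d : ℕ} (Q : RVec d →ₗ[ℝ] RVec d →ₗ[ℝ] RVec d)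

/-- The structure constants `Q(e_i, e_j) · e_k`. -/
def coef (i j k : Fin d) : ℝ := Q (EuclideanSpace.single i 1) (EuclideanSpace.single j 1) k

/-- The `ℂ`-bilinear extension of `Q` to `ℂ^d`. -/
def QC : CVec d →L[ℂ] CVec d →L[ℂ] CVec d :=
  LinearMap.toContinuousBilinearMap <|
    LinearMap.mk₂ ℂ
      (fun u v => WithLp.toLp 2 fun k => ∑ i, ∑ j, u i * v j * (coef Q i j k : ℂ))
      (fun u u' v => by
        ext k
        simp [add_mul, Finset.sum_add_distrib])
      (fun c u v => by
        ext k
        simp [Finset.mul_sum, mul_assoc])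
      (fun u v v' => by
        ext k
        simp [mul_add, add_mul, Finset.sum_add_distrib])
      (fun c u v => by
        ext k
        simp only [PiLp.smul_apply, smul_eq_mul, Finset.mul_sum]
        refine Finset.sum_congr rfl fun i _ => Finset.sum_congr rfl fun j _ => ?_
        ring)

theorem QC_apply (u v : CVec d) (k : Fin d) :
    QC Q u v k = ∑ i, ∑ j, u i * v j * (coef Q i j k : ℂ) := rfl

theorem QC_complexify (u v : RVec d) :
    QC Q (complexify d u) (complexify d v) = complexify d (Q u v) := by
  have h : ∀ w : RVec d, w = ∑ i, w i • EuclideanSpace.single i (1 : ℝ) := fun w => by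
    ext j
    simp [Finset.sum_apply, Pi.single_apply]
  ext k
  rw [QC_apply]
  have e : Q u v k = ∑ i, ∑ j, u i * v j * coef Q i j k := by
    conv_lhs => rw [h u, h v]
    simp only [map_sum, map_smul, LinearMap.sum_apply, LinearMap.smul_apply, WithLp.ofLp_sum,
      Finset.sum_apply, PiLp.smul_apply, smul_eq_mul, Finset.mul_sum, coef]
    rw [Finset.sum_comm]
    refine Finset.sum_congr rfl fun i _ => Finset.sum_congr rfl fun j _ => ?_
    ring
  change _ = ((Q u v k : ℝ) : ℂ)
  rw [e]
  push_cast
  rfl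

theorem conjV_QC (u v : CVec d) : conjV (QC Q u v) = QC Q (conjV u) (conjV v) := by
  ext k
  simp [QC_apply, map_sum]

/-- The trilinear form `(u, v, w) ↦ Q(u, v) · w` on `ℂ^d`. -/
def tri (u v w : CVec d) : ℂ := inner ℂ (conjV w) (QC Q u v)

theorem tri_eq (u v w : CVec d) :
    tri Q u v w = ∑ k, ∑ i, ∑ j, u i * v j * w k * (coef Q i j k : ℂ) := by
  simp only [tri, PiLp.inner_apply, QC_apply, RCLike.inner_apply, conjV_apply, Complex.conj_conj,
    Finset.sum_mul]
  refine Finset.sum_congr rfl fun k _ => Finset.sum_congr rfl fun i _ =>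
    Finset.sum_congr rfl fun j _ => ?_
  ring

theorem inner_QC_eq (u v w : CVec d) : inner ℂ w (QC Q u v) = tri Q u v (conjV w) := by
  rw [tri, conjV_conjV]

variable {Q}

theorem coef_eq_inner (i j k : Fin d) : coef Q i j k =
    inner ℝ (Q (EuclideanSpace.single i 1) (EuclideanSpace.single j 1))
      (EuclideanSpace.single k 1) := by
  rw [EuclideanSpace.inner_single_right]
  simp [coef]

theorem coef_swap_left (hQ : IsFullySymmetric Q) (i j k : Fin d) :
    coef Q i j k = coef Q j i k := by
  have h := hQ (Equiv.swap 0 1) ![EuclideanSpace.single j 1, EuclideanSpace.single i 1,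
    EuclideanSpace.single k 1]
  rw [coef_eq_inner, coef_eq_inner]
  simpa [Equiv.swap_apply_of_ne_of_ne] using h

theorem coef_swap_right (hQ : IsFullySymmetric Q) (i j k : Fin d) :
    coef Q i j k = coef Q i k j := by
  have h := hQ (Equiv.swap 1 2) ![EuclideanSpace.single i 1, EuclideanSpace.single k 1,
    EuclideanSpace.single j 1]
  rw [coef_eq_inner, coef_eq_inner]
  simpa [Equiv.swap_apply_of_ne_of_ne] using h

theorem QC_comm (hQ : IsFullySymmetric Q) (u v : CVec d) : QC Q u v = QC Q v u := by
  ext k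
  rw [QC_apply, QC_apply, Finset.sum_comm]
  refine Finset.sum_congr rfl fun i _ => Finset.sum_congr rfl fun j _ => ?_
  rw [coef_swap_left hQ]
  ring

theorem tri_swap_left (hQ : IsFullySymmetric Q) (u v w : CVec d) : tri Q u v w = tri Q v u w := by
  rw [tri, tri, QC_comm hQ]

theorem tri_swap_right (hQ : IsFullySymmetric Q) (u v w : CVec d) :
    tri Q u v w = tri Q u w v := by
  have e : ∀ v w : CVec d, tri Q u v w = ∑ i, ∑ j, ∑ k, u i * v j * w k * (coef Q i j k : ℂ) :=
    fun v w => by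
      rw [tri_eq, Finset.sum_comm]
      exact Finset.sum_congr rfl fun i _ => Finset.sum_comm
  rw [e, e]
  refine Finset.sum_congr rfl fun i _ => ?_
  rw [Finset.sum_comm]
  refine Finset.sum_congr rfl fun j _ => Finset.sum_congr rfl fun k _ => ?_
  rw [coef_swap_right hQ]
  ring

end Nonlinearity

/-! ### Young-type bounds for trilinear convolution integrals -/

theorem measurePreserving_add_prod_real :
    MeasurePreserving (fun p : ℝ × ℝ => (p.1 + p.2, p.2)) volume volume :=
  measurePreserving_add_prod volume volume

theorem quasiMeasurePreserving_add_real :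
    Measure.QuasiMeasurePreserving (fun p : ℝ × ℝ => p.1 + p.2) volume volume :=
  Measure.quasiMeasurePreserving_fst.comp measurePreserving_add_prod_real.quasiMeasurePreserving

theorem quasiMeasurePreserving_fst_real :
    Measure.QuasiMeasurePreserving (fun p : ℝ × ℝ => p.1) volume volume :=
  Measure.quasiMeasurePreserving_fst

theorem quasiMeasurePreserving_snd_real :
    Measure.QuasiMeasurePreserving (fun p : ℝ × ℝ => p.2) volume volume :=
  Measure.quasiMeasurePreserving_snd

/-- On the plane `ξ₁ + ξ₂ + ξ₃ = 0`, parametrized by `(ξ₁, ξ₂)`, the exchange of `ξ₁` and `ξ₃`. -/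
def exch : ℝ × ℝ ≃ᵐ ℝ × ℝ where
  toFun p := (-(p.1 + p.2), p.2)
  invFun p := (-(p.1 + p.2), p.2)
  left_inv p := by ext <;> simp
  right_inv p := by ext <;> simp
  measurable_toFun := (by fun_prop : Measurable fun p : ℝ × ℝ => (-(p.1 + p.2), p.2))
  measurable_invFun := (by fun_prop : Measurable fun p : ℝ × ℝ => (-(p.1 + p.2), p.2))

theorem exch_apply (p : ℝ × ℝ) : exch p = (-(p.1 + p.2), p.2) := rfl

theorem measurePreserving_exch : MeasurePreserving exch volume volume := by
  have h1 : MeasurePreserving (fun p : ℝ × ℝ => (-p.1, p.2)) volume volume :=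
    measurePreserving_neg_real.prod (MeasurePreserving.id volume)
  exact h1.comp measurePreserving_add_prod_real

/-- The `L²` norm of an `[0, ∞]`-valued function. -/
def nrm (f : ℝ → ENNReal) : ENNReal := (∫⁻ x, f x ^ (2 : ℝ)) ^ (1 / 2 : ℝ)

theorem nrm_enorm {E : Type*} [NormedAddCommGroup E] (f : ℝ → E) :
    nrm (fun x => ‖f x‖ₑ) = eLpNorm f 2 volume := by
  rw [eLpNorm_eq_lintegral_rpow_enorm_toReal (by norm_num) (by norm_num)]
  simp [nrm]

theorem nrm_comp_neg (f : ℝ → ENNReal) : nrm (fun x => f (-x)) = nrm f := by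
  unfold nrm
  rw [lintegral_neg_eq_self (μ := volume) (fun x => f x ^ (2 : ℝ))]

theorem nrm_comp_add (f : ℝ → ENNReal) (a : ℝ) : nrm (fun x => f (a + x)) = nrm f := by
  unfold nrm
  rw [lintegral_add_left_eq_self (μ := volume) (fun x => f x ^ (2 : ℝ)) a]

theorem lintegral_mul_le_nrm {f g : ℝ → ENNReal} (hf : AEMeasurable f) (hg : AEMeasurable g) :
    ∫⁻ x, f x * g x ≤ nrm f * nrm g :=
  ENNReal.lintegral_mul_le_Lp_mul_Lq volume (p := 2) (q := 2)
    (by constructor <;> norm_num) hf hg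

theorem aemeasurable_triple {u v w : ℝ → ENNReal} (hu : AEMeasurable u) (hv : AEMeasurable v)
    (hw : AEMeasurable w) :
    AEMeasurable (fun p : ℝ × ℝ => u p.1 * v p.2 * w (p.1 + p.2)) volume :=
  ((hu.comp_quasiMeasurePreserving quasiMeasurePreserving_fst_real).mul
    (hv.comp_quasiMeasurePreserving quasiMeasurePreserving_snd_real)).mul
    (hw.comp_quasiMeasurePreserving quasiMeasurePreserving_add_real)

/-- Young's inequality `L¹ × L² × L²`, with the integrable factor in the first variable. -/
theorem lintegral_triple_le {u v w : ℝ → ENNReal} (hu : AEMeasurable u) (hv : AEMeasurable v)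
    (hw : AEMeasurable w) :
    ∫⁻ p : ℝ × ℝ, u p.1 * v p.2 * w (p.1 + p.2) ≤ (∫⁻ x, u x) * nrm v * nrm w := by
  have hm := aemeasurable_triple hu hv hw
  rw [Measure.volume_eq_prod] at hm ⊢
  rw [lintegral_prod _ hm]
  calc ∫⁻ x, ∫⁻ y, u x * v y * w (x + y)
      ≤ ∫⁻ x, u x * (nrm v * nrm w) := by
        refine lintegral_mono fun x => ?_
        have hw' : AEMeasurable (fun y => w (x + y)) :=
          AEMeasurable.comp_quasiMeasurePreserving hw
            (measurePreserving_add_left volume x).quasiMeasurePreserving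
        simp only [mul_assoc]
        refine (lintegral_const_mul'' (u x) (hv.mul hw')).le.trans ?_
        gcongr
        refine (lintegral_mul_le_nrm hv hw').trans ?_
        rw [nrm_comp_add]
    _ = _ := by rw [lintegral_mul_const'' _ hu, mul_assoc]

theorem lintegral_weight_fst_le {a u v w : ℝ → ENNReal} (ha : AEMeasurable a)
    (hu : AEMeasurable u) (hv : AEMeasurable v) (hw : AEMeasurable w) :
    ∫⁻ p : ℝ × ℝ, a p.1 * (u p.1 * v p.2 * w (p.1 + p.2)) ≤ nrm a * nrm u * nrm v * nrm w := by
  simp only [← mul_assoc]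
  refine (lintegral_triple_le (ha.mul hu) hv hw).trans ?_
  gcongr
  exact lintegral_mul_le_nrm ha hu

theorem lintegral_weight_snd_le {a u v w : ℝ → ENNReal} (ha : AEMeasurable a)
    (hu : AEMeasurable u) (hv : AEMeasurable v) (hw : AEMeasurable w) :
    ∫⁻ p : ℝ × ℝ, a p.2 * (u p.1 * v p.2 * w (p.1 + p.2)) ≤ nrm a * nrm u * nrm v * nrm w := by
  have e := (Measure.measurePreserving_swap (μ := (volume : Measure ℝ))
    (ν := (volume : Measure ℝ))).lintegral_comp_emb MeasurableEquiv.prodComm.measurableEmbedding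
    (fun p : ℝ × ℝ => a p.2 * (u p.1 * v p.2 * w (p.1 + p.2)))
  rw [Measure.volume_eq_prod, ← e]
  have h := lintegral_weight_fst_le ha hv hu hw
  rw [Measure.volume_eq_prod] at h
  calc _ = _ := lintegral_congr fun p => by
        simp only [Prod.fst_swap, Prod.snd_swap, add_comm p.2 p.1, mul_comm (u p.2)]
    _ ≤ _ := h
    _ = _ := by ring

theorem lintegral_weight_add_le {a u v w : ℝ → ENNReal} (ha : AEMeasurable a)
    (hu : AEMeasurable u) (hv : AEMeasurable v) (hw : AEMeasurable w) :
    ∫⁻ p : ℝ × ℝ, a (p.1 + p.2) * (u p.1 * v p.2 * w (p.1 + p.2)) ≤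
      nrm a * nrm u * nrm v * nrm w := by
  have neg : ∀ {f : ℝ → ENNReal}, AEMeasurable f → AEMeasurable fun x => f (-x) := fun hf =>
    AEMeasurable.comp_quasiMeasurePreserving hf
      measurePreserving_neg_real.quasiMeasurePreserving
  have e := measurePreserving_exch.lintegral_comp_emb exch.measurableEmbedding
    (fun p : ℝ × ℝ => a (p.1 + p.2) * (u p.1 * v p.2 * w (p.1 + p.2)))
  rw [← e]
  have h := lintegral_weight_fst_le (neg ha) (neg hw) hv (neg hu)
  rw [nrm_comp_neg, nrm_comp_neg, nrm_comp_neg] at h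
  calc _ = _ := lintegral_congr fun p => by
        have : -(p.1 + p.2) + p.2 = -p.1 := by ring
        simp only [exch_apply, this]
        ring
    _ ≤ _ := h
    _ = _ := by ring

/-! ### Bilinear operators given by frequency kernels -/

/-- Kernels dominated by `⟨ξ₁⟩^(-r) + ⟨ξ₂⟩^(-r) + ⟨ξ₁+ξ₂⟩^(-r)`. For `r > 1/2` they act
boundedly on `L² × L²`. -/
def IsKer (r C : ℝ) (k : ℝ → ℝ → ℂ) : Prop :=
  Measurable (Function.uncurry k) ∧ 0 ≤ C ∧
    ∀ x y, ‖k x y‖ ≤ C * (jb (-r) x + jb (-r) y + jb (-r) (x + y))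

section Form

variable {d : ℕ} (Q : RVec d →ₗ[ℝ] RVec d →ₗ[ℝ] RVec d)

/-- The integrand of the trilinear form with kernel `k`. -/
def integrand (k : ℝ → ℝ → ℂ) (F G H : ℝ → CVec d) (p : ℝ × ℝ) : ℂ :=
  inner ℂ (k p.1 p.2 • QC Q (F p.1) (G p.2)) (H (p.1 + p.2))

/-- The constant in the bound of the trilinear form. -/
def formConst (r : ℝ) : ℝ := 3 * ‖QC Q‖ * (eLpNorm (jb (-r)) 2 volume).toReal

theorem formConst_nonneg (r : ℝ) : 0 ≤ formConst Q r := by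
  unfold formConst
  positivity

theorem aestronglyMeasurable_integrand {k : ℝ → ℝ → ℂ} (hk : Measurable (Function.uncurry k))
    (F G H : L2 d) : AEStronglyMeasurable (integrand Q k F G H) volume := by
  have hF := (Lp.aestronglyMeasurable F).comp_quasiMeasurePreserving
    quasiMeasurePreserving_fst_real
  have hG := (Lp.aestronglyMeasurable G).comp_quasiMeasurePreserving
    quasiMeasurePreserving_snd_real
  have hH := (Lp.aestronglyMeasurable H).comp_quasiMeasurePreserving
    quasiMeasurePreserving_add_real
  have hk' : AEStronglyMeasurable (fun p : ℝ × ℝ => k p.1 p.2) volume :=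
    hk.aestronglyMeasurable
  exact (hk'.smul ((QC Q).aestronglyMeasurable_comp₂ hF hG)).inner hH

theorem enorm_integrand_le {r C : ℝ} {k : ℝ → ℝ → ℂ} (hk : IsKer r C k) (F G H : L2 d)
    (p : ℝ × ℝ) :
    ‖integrand Q k F G H p‖ₑ ≤ ENNReal.ofReal (C * ‖QC Q‖) *
      (‖jb (-r) p.1‖ₑ * (‖F p.1‖ₑ * ‖G p.2‖ₑ * ‖H (p.1 + p.2)‖ₑ) +
        ‖jb (-r) p.2‖ₑ * (‖F p.1‖ₑ * ‖G p.2‖ₑ * ‖H (p.1 + p.2)‖ₑ) +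
        ‖jb (-r) (p.1 + p.2)‖ₑ * (‖F p.1‖ₑ * ‖G p.2‖ₑ * ‖H (p.1 + p.2)‖ₑ)) := by
  have e : ∀ x, ‖jb (-r) x‖ₑ = ENNReal.ofReal (jb (-r) x) := fun x =>
    Real.enorm_of_nonneg (jb_pos _ _).le
  have p1 := fun x => (jb_pos (-r) x).le
  have hC := hk.2.1
  simp only [← add_mul, e, ← ofReal_norm (E := CVec d), ← ofReal_norm (E := ℂ)]
  rw [← ENNReal.ofReal_add (p1 _) (p1 _), ← ENNReal.ofReal_add (add_nonneg (p1 _) (p1 _)) (p1 _),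
    ← ENNReal.ofReal_mul (by positivity), ← ENNReal.ofReal_mul (by positivity),
    ← ENNReal.ofReal_mul (add_nonneg (add_nonneg (p1 _) (p1 _)) (p1 _)),
    ← ENNReal.ofReal_mul (by positivity)]
  apply ENNReal.ofReal_le_ofReal
  calc ‖integrand Q k F G H p‖ ≤ ‖k p.1 p.2 • QC Q (F p.1) (G p.2)‖ * ‖H (p.1 + p.2)‖ :=
        norm_inner_le_norm _ _
    _ ≤ (C * (jb (-r) p.1 + jb (-r) p.2 + jb (-r) (p.1 + p.2)) *
        (‖QC Q‖ * ‖F p.1‖ * ‖G p.2‖)) * ‖H (p.1 + p.2)‖ := by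
      rw [norm_smul]
      have := (norm_nonneg _).trans (hk.2.2 p.1 p.2)
      gcongr
      · exact hk.2.2 _ _
      · exact (QC Q).le_opNorm₂ _ _
    _ = _ := by ring

theorem lintegral_integrand_le {r C : ℝ} {k : ℝ → ℝ → ℂ} (hk : IsKer r C k)
    (F G H : L2 d) :
    ∫⁻ p, ‖integrand Q k F G H p‖ₑ ≤ ENNReal.ofReal (C * ‖QC Q‖) *
      (3 * (eLpNorm (jb (-r)) 2 volume * eLpNorm F 2 volume * eLpNorm G 2 volume *
        eLpNorm H 2 volume)) := by
  have ha : AEMeasurable (fun x => ‖jb (-r) x‖ₑ) := (measurable_jb _).enorm.aemeasurable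
  have hF : AEMeasurable (fun x => ‖F x‖ₑ) := (Lp.aestronglyMeasurable F).enorm
  have hG : AEMeasurable (fun x => ‖G x‖ₑ) := (Lp.aestronglyMeasurable G).enorm
  have hH : AEMeasurable (fun x => ‖H x‖ₑ) := (Lp.aestronglyMeasurable H).enorm
  have hm := aemeasurable_triple hF hG hH
  have m1 := (ha.comp_quasiMeasurePreserving quasiMeasurePreserving_fst_real).mul hm
  have m2 := (ha.comp_quasiMeasurePreserving quasiMeasurePreserving_snd_real).mul hm
  have m3 := (ha.comp_quasiMeasurePreserving quasiMeasurePreserving_add_real).mul hm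
  refine (lintegral_mono (enorm_integrand_le Q hk F G H)).trans ?_
  rw [lintegral_const_mul' _ _ (by finiteness)]
  gcongr
  refine (lintegral_add_left' (m1.add m2) _).le.trans ?_
  refine (add_le_add_left (lintegral_add_left' m1 _).le _).trans ?_
  have h1 := lintegral_weight_fst_le ha hF hG hH
  have h2 := lintegral_weight_snd_le ha hF hG hH
  have h3 := lintegral_weight_add_le ha hF hG hH
  simp only [nrm_enorm] at h1 h2 h3
  calc _ ≤ _ := add_le_add (add_le_add h1 h2) h3
    _ = _ := by ring

theorem integrable_integrand {r C : ℝ} (hr : 1 / 2 < r) {k : ℝ → ℝ → ℂ} (hk : IsKer r C k)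
    (F G H : L2 d) : Integrable (integrand Q k F G H) volume := by
  refine ⟨aestronglyMeasurable_integrand Q hk.1 F G H, ?_⟩
  refine (lintegral_integrand_le Q hk F G H).trans_lt ?_
  have h1 := (memLp_jb hr).2
  have h2 := (Lp.memLp F).2
  have h3 := (Lp.memLp G).2
  have h4 := (Lp.memLp H).2
  finiteness

/-- The trilinear form `∫∫ ⟨k(x, y) Q(F(x), G(y)), H(x + y)⟩ dx dy`. -/
def form (k : ℝ → ℝ → ℂ) (F G H : ℝ → CVec d) : ℂ := ∫ p, integrand Q k F G H p

theorem norm_form_le {r C : ℝ} (hr : 1 / 2 < r) {k : ℝ → ℝ → ℂ} (hk : IsKer r C k)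
    (F G H : L2 d) : ‖form Q k F G H‖ ≤ C * formConst Q r * ‖F‖ * ‖G‖ * ‖H‖ := by
  have h := lintegral_integrand_le Q hk F G H
  have hC := hk.2.1
  have h0 := (memLp_jb hr).2
  have h2 := (Lp.memLp F).2
  have h3 := (Lp.memLp G).2
  have h4 := (Lp.memLp H).2
  calc ‖form Q k F G H‖ ≤ (∫⁻ p, ‖integrand Q k F G H p‖ₑ).toReal := by
        rw [form]
        refine (norm_integral_le_lintegral_norm _).trans (le_of_eq ?_)
        simp only [ofReal_norm]
    _ ≤ _ := ENNReal.toReal_mono (by finiteness) h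
    _ = _ := by
      simp only [ENNReal.toReal_mul, ← Lp.norm_def]
      rw [ENNReal.toReal_ofReal (by positivity), formConst]
      simp only [ENNReal.toReal_ofNat]
      ring

end Form

theorem IsKer.of_le {r C B : ℝ} {k k' : ℝ → ℝ → ℂ} (hk : IsKer r C k) (hB : 0 ≤ B)
    (hm : Measurable (Function.uncurry k')) (h : ∀ x y, ‖k' x y‖ ≤ B * ‖k x y‖) :
    IsKer r (B * C) k' := by
  refine ⟨hm, mul_nonneg hB hk.2.1, fun x y => (h x y).trans ?_⟩
  rw [mul_assoc]
  exact mul_le_mul_of_nonneg_left (hk.2.2 x y) hB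

theorem IsKer.swap {r C : ℝ} {k : ℝ → ℝ → ℂ} (hk : IsKer r C k) :
    IsKer r C fun x y => k y x := by
  refine ⟨hk.1.comp measurable_swap, hk.2.1, fun x y => (hk.2.2 y x).trans (le_of_eq ?_)⟩
  rw [add_comm y x]
  ring

theorem IsKer.exch {r C : ℝ} {k : ℝ → ℝ → ℂ} (hk : IsKer r C k) :
    IsKer r C fun x y => k (-(x + y)) y := by
  refine ⟨hk.1.comp VectorKdV.exch.measurable, hk.2.1,
    fun x y => (hk.2.2 _ y).trans (le_of_eq ?_)⟩
  have e : -(x + y) + y = -x := by ring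
  rw [e, jb_even, jb_even]
  ring

theorem IsKer.exch_right {r C : ℝ} {k : ℝ → ℝ → ℂ} (hk : IsKer r C k) :
    IsKer r C fun x y => k x (-(x + y)) := by
  have h := hk.swap.exch.swap
  simpa only [add_comm] using h

/-- Multiplying a kernel by bounded symbols in the three frequencies. -/
theorem IsKer.mul_bdd {r C : ℝ} {k : ℝ → ℝ → ℂ} (hk : IsKer r C k) {m a b : ℝ → ℂ}
    (hm : BddMeas m) (ha : BddMeas a) (hb : BddMeas b) :
    ∃ C', IsKer r C' fun x y => m (x + y) * a x * b y * k x y := by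
  obtain ⟨Cm, hCm⟩ := hm.2
  obtain ⟨Ca, hCa⟩ := ha.2
  obtain ⟨Cb, hCb⟩ := hb.2
  have p1 := (norm_nonneg _).trans (hCm 0)
  have p2 := (norm_nonneg _).trans (hCa 0)
  have p3 := (norm_nonneg _).trans (hCb 0)
  refine ⟨_, hk.of_le (B := Cm * Ca * Cb) (by positivity) ?_ fun x y => ?_⟩
  · exact (((hm.1.comp (measurable_fst.add measurable_snd)).mul (ha.1.comp measurable_fst)).mul
      (hb.1.comp measurable_snd)).mul hk.1
  · rw [norm_mul, norm_mul, norm_mul]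
    have h1 := hCm (x + y)
    have h2 := hCa x
    have h3 := hCb y
    gcongr

theorem bddMeas_one : BddMeas fun _ => 1 := ⟨measurable_const, 1, fun ξ => by simp⟩

theorem IsKer.mul_add {r C : ℝ} {k : ℝ → ℝ → ℂ} (hk : IsKer r C k) {m : ℝ → ℂ}
    (hm : BddMeas m) : ∃ C', IsKer r C' fun x y => m (x + y) * k x y := by
  simpa using hk.mul_bdd hm bddMeas_one bddMeas_one

theorem IsKer.mul_snd {r C : ℝ} {k : ℝ → ℝ → ℂ} (hk : IsKer r C k) {m : ℝ → ℂ}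
    (hm : BddMeas m) : ∃ C', IsKer r C' fun x y => m y * k x y := by
  simpa using hk.mul_bdd bddMeas_one bddMeas_one hm

/-- Kernels which are admissible for some exponent. -/
def Adm (k : ℝ → ℝ → ℂ) : Prop := ∃ r C : ℝ, 1 / 2 < r ∧ IsKer r C k

section Op

variable {d : ℕ} (Q : RVec d →ₗ[ℝ] RVec d →ₗ[ℝ] RVec d)

theorem Adm.integrable {k : ℝ → ℝ → ℂ} (hk : Adm k) (F G H : L2 d) :
    Integrable (integrand Q k F G H) volume := by
  obtain ⟨r, C, hr, h⟩ := hk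
  exact integrable_integrand Q hr h F G H

theorem integrand_ae_congr {k k' : ℝ → ℝ → ℂ} {F F' G G' H H' : ℝ → CVec d}
    (h : ∀ᵐ p : ℝ × ℝ, k p.1 p.2 • QC Q (F p.1) (G p.2) = k' p.1 p.2 • QC Q (F' p.1) (G' p.2))
    (hH : H =ᵐ[volume] H') : form Q k F G H = form Q k' F' G' H' := by
  apply integral_congr_ae
  filter_upwards [h, quasiMeasurePreserving_add_real.ae hH] with p h1 h2
  simp only [integrand, h1, h2]

theorem form_congr_ae {k : ℝ → ℝ → ℂ} {F F' G G' H H' : ℝ → CVec d}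
    (hF : F =ᵐ[volume] F') (hG : G =ᵐ[volume] G')
    (hH : H =ᵐ[volume] H') : form Q k F G H = form Q k F' G' H' := by
  apply integrand_ae_congr Q _ hH
  filter_upwards [quasiMeasurePreserving_fst_real.ae hF, quasiMeasurePreserving_snd_real.ae hG]
    with p h1 h2
  rw [h1, h2]

theorem form_add_left {k : ℝ → ℝ → ℂ} (hk : Adm k) (F F' G H : L2 d) :
    form Q k (F + F' : L2 d) G H = form Q k F G H + form Q k F' G H := by
  rw [form_congr_ae Q (Lp.coeFn_add F F') .rfl .rfl, form, form, form,
    ← integral_add (hk.integrable Q F G H) (hk.integrable Q F' G H)]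
  exact integral_congr_ae (.of_forall fun p => by simp [integrand, smul_add])

theorem form_smul_left {k : ℝ → ℝ → ℂ} (c : ℂ) (F G H : L2 d) :
    form Q k (c • F : L2 d) G H = (starRingEnd ℂ) c * form Q k F G H := by
  rw [form_congr_ae Q (Lp.coeFn_smul c F) .rfl .rfl, form, form, ← integral_const_mul]
  exact integral_congr_ae (.of_forall fun p => by
    simp only [integrand, inner_smul_left, Pi.smul_apply, map_smul,
      smul_apply]
    ring)

theorem form_add_mid {k : ℝ → ℝ → ℂ} (hk : Adm k) (F G G' H : L2 d) :
    form Q k F (G + G' : L2 d) H = form Q k F G H + form Q k F G' H := by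
  rw [form_congr_ae Q .rfl (Lp.coeFn_add G G') .rfl, form, form, form,
    ← integral_add (hk.integrable Q F G H) (hk.integrable Q F G' H)]
  exact integral_congr_ae (.of_forall fun p => by simp [integrand, smul_add])

theorem form_smul_mid {k : ℝ → ℝ → ℂ} (c : ℂ) (F G H : L2 d) :
    form Q k F (c • G : L2 d) H = (starRingEnd ℂ) c * form Q k F G H := by
  rw [form_congr_ae Q .rfl (Lp.coeFn_smul c G) .rfl, form, form, ← integral_const_mul]
  exact integral_congr_ae (.of_forall fun p => by
    simp only [integrand, inner_smul_left, Pi.smul_apply, map_smul]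
    ring)

theorem form_add_right {k : ℝ → ℝ → ℂ} (hk : Adm k) (F G H H' : L2 d) :
    form Q k F G (H + H' : L2 d) = form Q k F G H + form Q k F G H' := by
  rw [form_congr_ae Q .rfl .rfl (Lp.coeFn_add H H'), form, form, form,
    ← integral_add (hk.integrable Q F G H) (hk.integrable Q F G H')]
  exact integral_congr_ae (.of_forall fun p => by simp [integrand])

theorem form_smul_right {k : ℝ → ℝ → ℂ} (c : ℂ) (F G H : L2 d) :
    form Q k F G (c • H : L2 d) = c * form Q k F G H := by
  rw [form_congr_ae Q .rfl .rfl (Lp.coeFn_smul c H), form, form, ← integral_const_mul]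
  exact integral_congr_ae (.of_forall fun p => by
    simp only [integrand, inner_smul_right, Pi.smul_apply])

theorem Adm.norm_form_le {k : ℝ → ℝ → ℂ} (hk : Adm k) :
    ∃ B : ℝ, 0 ≤ B ∧ ∀ F G H : L2 d, ‖form Q k F G H‖ ≤ B * ‖F‖ * ‖G‖ * ‖H‖ := by
  obtain ⟨r, C, hr, h⟩ := hk
  exact ⟨C * formConst Q r, mul_nonneg h.2.1 (formConst_nonneg Q r),
    VectorKdV.norm_form_le Q hr h⟩

/-- The functional `H ↦ form Q k F G H`. -/
def formFunctional {k : ℝ → ℝ → ℂ} (hk : Adm k) (F G : L2 d) : L2 d →L[ℂ] ℂ :=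
  LinearMap.mkContinuous
    { toFun := fun H => form Q k F G H
      map_add' := form_add_right Q hk F G
      map_smul' := fun c H => form_smul_right Q c F G H }
    ((hk.norm_form_le Q).choose * ‖F‖ * ‖G‖)
    fun H => (hk.norm_form_le Q).choose_spec.2 F G H

open Classical in
/-- The bounded bilinear operator on `L²` with frequency kernel `k`, that is
`(F, G) ↦ ∫ k(η, ξ - η) Q(F(η), G(ξ - η)) dη`, obtained from the trilinear form by the Riesz
representation theorem (and zero if `k` is not admissible). -/
def bil (k : ℝ → ℝ → ℂ) : L2 d →L[ℂ] L2 d →L[ℂ] L2 d :=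
  if hk : Adm k then
    LinearMap.mkContinuous₂
      (LinearMap.mk₂ ℂ
        (fun F G => (InnerProductSpace.toDual ℂ (L2 d)).symm (formFunctional Q hk F G))
        (fun F F' G => by
          refine ext_inner_right ℂ fun H => ?_
          rw [inner_add_left]
          simp only [InnerProductSpace.toDual_symm_apply]
          exact form_add_left Q hk F F' G H)
        (fun c F G => by
          refine ext_inner_right ℂ fun H => ?_
          rw [inner_smul_left]
          simp only [InnerProductSpace.toDual_symm_apply]
          exact form_smul_left Q c F G H)
        (fun F G G' => by
          refine ext_inner_right ℂ fun H => ?_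
          rw [inner_add_left]
          simp only [InnerProductSpace.toDual_symm_apply]
          exact form_add_mid Q hk F G G' H)
        (fun c F G => by
          refine ext_inner_right ℂ fun H => ?_
          rw [inner_smul_left]
          simp only [InnerProductSpace.toDual_symm_apply]
          exact form_smul_mid Q c F G H))
      (hk.norm_form_le Q).choose (fun F G => by
        rw [LinearMap.mk₂_apply, LinearIsometryEquiv.norm_map]
        have h := (hk.norm_form_le Q).choose_spec
        exact LinearMap.mkContinuous_norm_le _ (by have := h.1; positivity) _)
  else 0

theorem inner_bil {k : ℝ → ℝ → ℂ} (hk : Adm k) (F G H : L2 d) :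
    inner ℂ (bil Q k F G) H = form Q k F G H := by
  rw [bil, dif_pos hk]
  change inner ℂ ((InnerProductSpace.toDual ℂ (L2 d)).symm (formFunctional Q hk F G)) H = _
  rw [InnerProductSpace.toDual_symm_apply]
  rfl

theorem norm_bil_le {r C : ℝ} (hr : 1 / 2 < r) {k : ℝ → ℝ → ℂ} (hk : IsKer r C k) (F G : L2 d) :
    ‖bil Q k F G‖ ≤ C * formConst Q r * ‖F‖ * ‖G‖ := by
  have h := norm_form_le Q hr hk F G (bil Q k F G)
  have e : ‖inner ℂ (bil Q k F G) (bil Q k F G)‖ = ‖bil Q k F G‖ * ‖bil Q k F G‖ := by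
    rw [inner_self_eq_norm_sq_to_K]
    simp [sq]
  rw [← inner_bil Q ⟨r, C, hr, hk⟩, e] at h
  rcases (norm_nonneg (bil Q k F G)).eq_or_lt with h0 | h0
  · rw [← h0]
    have := formConst_nonneg Q r
    have := hk.2.1
    positivity
  · exact le_of_mul_le_mul_right h h0

theorem bil_congr {k k' : ℝ → ℝ → ℂ} (h : ∀ x y, k x y = k' x y) (F G : L2 d) :
    bil Q k F G = bil Q k' F G := by
  rw [show k = k' from funext fun x => funext (h x)]

theorem mulL_bil {k : ℝ → ℝ → ℂ} (hk : Adm k) {m : ℝ → ℂ} (hm : BddMeas m) (F G : L2 d) :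
    mulL m (bil Q k F G) = bil Q (fun x y => m (x + y) * k x y) F G := by
  refine ext_inner_right ℂ fun H => ?_
  have hk' : Adm (fun x y => m (x + y) * k x y) := by
    obtain ⟨r, C, hr, h⟩ := hk
    obtain ⟨C', h'⟩ := h.mul_add hm
    exact ⟨r, C', hr, h'⟩
  rw [inner_mulL hm, inner_bil Q hk, inner_bil Q hk']
  apply integral_congr_ae
  filter_upwards [quasiMeasurePreserving_add_real.ae (coeFn_mulL hm.conj H)] with p h
  simp only [integrand, h, inner_smul_right, inner_smul_left, map_mul]
  ring

theorem bil_mulL_right {k : ℝ → ℝ → ℂ} (hk : Adm k) {m : ℝ → ℂ} (hm : BddMeas m) (F G : L2 d) :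
    bil Q k F (mulL m G) = bil Q (fun x y => m y * k x y) F G := by
  refine ext_inner_right ℂ fun H => ?_
  have hk' : Adm (fun x y => m y * k x y) := by
    obtain ⟨r, C, hr, h⟩ := hk
    obtain ⟨C', h'⟩ := h.mul_snd hm
    exact ⟨r, C', hr, h'⟩
  rw [inner_bil Q hk, inner_bil Q hk']
  refine integrand_ae_congr Q ?_ .rfl
  filter_upwards [quasiMeasurePreserving_snd_real.ae (coeFn_mulL hm G)] with p h
  rw [h, map_smul, smul_smul, mul_comm]

variable {Q}

theorem form_swap (hQ : IsFullySymmetric Q) (k : ℝ → ℝ → ℂ) (F G H : ℝ → CVec d) :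
    form Q k F G H = form Q (fun x y => k y x) G F H := by
  have e := (Measure.measurePreserving_swap (μ := (volume : Measure ℝ))
    (ν := (volume : Measure ℝ))).integral_comp MeasurableEquiv.prodComm.measurableEmbedding
    (integrand Q k F G H)
  rw [form, form, Measure.volume_eq_prod, ← e]
  refine integral_congr_ae (.of_forall fun p => ?_)
  simp only [integrand, Prod.fst_swap, Prod.snd_swap, add_comm p.2 p.1,
    QC_comm hQ (F p.2) (G p.1)]

theorem bil_comm (hQ : IsFullySymmetric Q) {k : ℝ → ℝ → ℂ} (hk : Adm k)
    (hs : ∀ x y, k x y = k y x) (F G : L2 d) : bil Q k F G = bil Q k G F := by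
  refine ext_inner_right ℂ fun H => ?_
  rw [inner_bil Q hk, inner_bil Q hk, form_swap hQ]
  congr 1
  funext x y
  exact hs y x

theorem bil_sub_bil (hQ : IsFullySymmetric Q) {k : ℝ → ℝ → ℂ} (hk : Adm k)
    (hs : ∀ x y, k x y = k y x) (F G : L2 d) :
    bil Q k F F - bil Q k G G = bil Q k (F + G) (F - G) := by
  rw [map_sub, map_add, add_apply, add_apply,
    bil_comm hQ hk hs F G]
  abel

/-- Exchanging the frequencies `ξ₁` and `ξ₃ = -(ξ₁ + ξ₂)`. -/
theorem form_exch (hQ : IsFullySymmetric Q) (k : ℝ → ℝ → ℂ) {F G H : L2 d}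
    (hF : IsHerm F) (hH : IsHerm H) :
    form Q k F G H = form Q (fun x y => k (-(x + y)) y) H G F := by
  have e := measurePreserving_exch.integral_comp exch.measurableEmbedding (integrand Q k F G H)
  rw [form, form, ← e]
  have h1 := isHerm_iff.1 hF
  have h2 := quasiMeasurePreserving_fst_real.ae (isHerm_iff.1 hH)
  have h3 := quasiMeasurePreserving_add_real.ae h1
  refine integral_congr_ae ?_
  filter_upwards [h2, h3] with p h2 h3
  have e : -(p.1 + p.2) + p.2 = -p.1 := by ring
  simp only [integrand, exch_apply, e, inner_smul_left]
  congr 1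
  rw [← inner_conj_symm, inner_QC_eq, h2, ← inner_conj_symm (QC Q _ _) (F _), inner_QC_eq, ← h3,
    conjV_conjV, tri_swap_left hQ, tri_swap_right hQ, tri_swap_left hQ]

theorem form_exch_right (hQ : IsFullySymmetric Q) (k : ℝ → ℝ → ℂ) {F G H : L2 d}
    (hG : IsHerm G) (hH : IsHerm H) :
    form Q k F G H = form Q (fun x y => k x (-(x + y))) F H G := by
  rw [form_swap hQ, form_exch hQ _ hG hH, form_swap hQ]
  simp only [add_comm]

/-- Symmetrization over the two last arguments. -/
theorem norm_form_le_of_symm_two (hQ : IsFullySymmetric Q) {r C C' : ℝ} (hr : 1 / 2 < r)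
    {k : ℝ → ℝ → ℂ} (hk : IsKer r C' k) (hs : IsKer r C fun x y => k x y + k x (-(x + y)))
    (A : L2 d) {Z : L2 d} (hZ : IsHerm Z) :
    2 * ‖form Q k A Z Z‖ ≤ C * formConst Q r * ‖A‖ * ‖Z‖ * ‖Z‖ := by
  have h := norm_form_le Q hr hs A Z Z
  have e : form Q (fun x y => k x y + k x (-(x + y))) A Z Z = 2 * form Q k A Z Z := by
    rw [two_mul]
    nth_rewrite 2 [form_exch_right hQ k hZ hZ]
    rw [form, form, form, ← integral_add (integrable_integrand Q hr hk A Z Z)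
      (integrable_integrand Q hr hk.exch_right A Z Z)]
    refine integral_congr_ae (.of_forall fun p => ?_)
    simp only [integrand, add_smul, inner_add_left]
  rw [e, norm_mul] at h
  simpa using h

/-- Symmetrization over all three arguments. -/
theorem norm_form_le_of_symm_three (hQ : IsFullySymmetric Q) {r C C' : ℝ} (hr : 1 / 2 < r)
    {k : ℝ → ℝ → ℂ} (hk : IsKer r C' k)
    (hs : IsKer r C fun x y => k x y + k (-(x + y)) y + k (-(x + y)) x)
    {Z : L2 d} (hZ : IsHerm Z) :
    3 * ‖form Q k Z Z Z‖ ≤ C * formConst Q r * ‖Z‖ * ‖Z‖ * ‖Z‖ := by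
  have h := norm_form_le Q hr hs Z Z Z
  have e1 : form Q (fun x y => k (-(x + y)) y) Z Z Z = form Q k Z Z Z :=
    (form_exch hQ k hZ hZ).symm
  have e2 : form Q (fun x y => k (-(x + y)) x) Z Z Z = form Q k Z Z Z := by
    rw [← e1, form_swap hQ]
    simp only [add_comm]
  have e : form Q (fun x y => k x y + k (-(x + y)) y + k (-(x + y)) x) Z Z Z =
      3 * form Q k Z Z Z := by
    have : 3 * form Q k Z Z Z = form Q k Z Z Z + form Q (fun x y => k (-(x + y)) y) Z Z Z +
        form Q (fun x y => k (-(x + y)) x) Z Z Z := by rw [e1, e2]; ring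
    rw [this, form, form, form, form, ← integral_add, ← integral_add]
    · refine integral_congr_ae (.of_forall fun p => ?_)
      simp only [integrand, add_smul, inner_add_left]
    · exact (integrable_integrand Q hr hk Z Z Z).add (integrable_integrand Q hr hk.exch Z Z Z)
    · have := hk.exch.swap
      simp only [add_comm] at this
      simpa only [add_comm] using integrable_integrand Q hr this Z Z Z
    · exact integrable_integrand Q hr hk Z Z Z
    · exact integrable_integrand Q hr hk.exch Z Z Z
  rw [e, norm_mul] at h
  simpa using h

variable (Q)

theorem inner_refl (F G : L2 d) :
    inner ℂ (refl d F) G = (starRingEnd ℂ) (inner ℂ F (refl d G)) := by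
  rw [L2.inner_def, L2.inner_def, ← integral_conj,
    ← integral_neg_eq_self (μ := volume) (fun ξ => (starRingEnd ℂ) (inner ℂ (F ξ) (refl d G ξ)))]
  apply integral_congr_ae
  have e := measurePreserving_neg_real.quasiMeasurePreserving.ae (coeFn_refl G)
  filter_upwards [coeFn_refl F, e] with ξ h1 h2
  rw [h1, h2]
  simp [PiLp.inner_apply, mul_comm]

theorem IsHerm.bil {k : ℝ → ℝ → ℂ} (hk : Adm k)
    (h : ∀ x y, k (-x) (-y) = (starRingEnd ℂ) (k x y)) {F G : L2 d} (hF : IsHerm F)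
    (hG : IsHerm G) : IsHerm (bil Q k F G) := by
  refine ext_inner_right ℂ fun H => ?_
  rw [inner_refl, inner_bil Q hk, inner_bil Q hk, form, form, ← integral_conj]
  have hneg : MeasurePreserving (fun p : ℝ × ℝ => -p) volume volume :=
    Measure.measurePreserving_neg volume
  rw [← integral_neg_eq_self (μ := (volume : Measure (ℝ × ℝ)))]
  apply integral_congr_ae
  have e := hneg.quasiMeasurePreserving.ae
    (quasiMeasurePreserving_add_real.ae (coeFn_refl H))
  filter_upwards [e, quasiMeasurePreserving_fst_real.ae (isHerm_iff.1 hF),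
    quasiMeasurePreserving_snd_real.ae (isHerm_iff.1 hG)] with p h1 h2 h3
  have e2 : ∀ u v : CVec d, inner ℂ (conjV u) (conjV v) = (starRingEnd ℂ) (inner ℂ u v) :=
    fun u v => by simp [PiLp.inner_apply, mul_comm]
  have e3 : -(-p.1 + -p.2) = p.1 + p.2 := by ring
  simp only [integrand, Prod.fst_neg, Prod.snd_neg] at h1 ⊢
  rw [h1, ← e2, conjV_smul, conjV_QC, h2, h3, h, Complex.conj_conj, conjV_conjV, e3]

end Op

/-! ### Symbol estimates -/

theorem rpow_sub_rpow_le {p x y : ℝ} (hp : 1 ≤ p) (hx : 0 ≤ x) (hy : 0 < y) :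
    y ^ p - x ^ p ≤ p * y ^ (p - 1) * (y - x) := by
  have hB := one_add_mul_self_le_rpow_one_add (s := (x - y) / y)
    (by rw [le_div_iff₀ hy]; linarith) hp
  have e : 1 + (x - y) / y = x / y := by field_simp; ring
  rw [e, Real.div_rpow hx hy.le, le_div_iff₀ (by positivity)] at hB
  have e2 : y ^ p = y ^ (p - 1) * y := by
    rw [← Real.rpow_add_one hy.ne']
    ring_nf
  have e3 : (1 + p * ((x - y) / y)) * y ^ p = y ^ p + p * y ^ (p - 1) * (x - y) := by
    rw [add_mul, one_mul, e2]
    field_simp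
  rw [e3] at hB
  linarith

/-- The truncated weight `min(⟨ξ⟩, k)`. -/
def lam (k ξ : ℝ) : ℝ := min (jb 1 ξ) k

theorem lam_pos {k : ℝ} (hk : 1 ≤ k) (ξ : ℝ) : 0 < lam k ξ :=
  lt_min (jb_pos _ _) (by linarith)

theorem lam_le (k ξ : ℝ) : lam k ξ ≤ jb 1 ξ := min_le_left _ _

theorem lam_even (k ξ : ℝ) : lam k (-ξ) = lam k ξ := by simp [lam, jb_even]

theorem continuous_lam (k : ℝ) : Continuous (lam k) := (continuous_jb 1).min continuous_const

/-- The cancellation in the symmetrized symbol: on the plane `ξ₁ + ξ₂ + ξ₃ = 0` the sum of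
`ξ_j λ(ξ_j)^(2s)` only costs the lowest of the three frequencies, uniformly in the truncation. -/
theorem abs_symbol_le_of_le {s k : ℝ} (hs : 1 ≤ s) (hk : 1 ≤ k) {a b c : ℝ} (h : a + b + c = 0)
    (hab : |a| ≤ |b|) (hbc : |b| ≤ |c|) :
    |a * lam k a ^ (2 * s) + b * lam k b ^ (2 * s) + c * lam k c ^ (2 * s)| ≤
      (2 * s + 1) * 2 ^ s * (|a| * (jb s b * jb s c)) := by
  have la := lam_pos hk a
  have lb := lam_pos hk b
  have lc := lam_pos hk c
  have l1 : lam k a ≤ lam k c := min_le_min (jb_one_le_of_abs_le (hab.trans hbc)) le_rfl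
  have l2 : lam k b ≤ lam k c := min_le_min (jb_one_le_of_abs_le hbc) le_rfl
  have hc2 : lam k c ^ (2 * s) ≤ jb s c * jb s c := by
    rw [jb_mul, jb_eq_rpow, ← two_mul]
    exact Real.rpow_le_rpow lc.le (lam_le _ _) (by linarith)
  have hcb : jb s c ≤ 2 ^ s * jb s b := by
    have e : c = -(a + b) := by linarith
    have h1 : jb 1 c ≤ 2 * jb 1 b := by
      rw [e, jb_even]
      linarith [jb_one_add_le a b, jb_one_le_of_abs_le hab]
    rw [jb_eq_rpow s c, jb_eq_rpow s b, ← Real.mul_rpow (by norm_num) (jb_pos _ _).le]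
    exact Real.rpow_le_rpow (jb_pos _ _).le h1 (by linarith)
  have p1 : |lam k a ^ (2 * s) - lam k c ^ (2 * s)| ≤ jb s c * jb s c := by
    have : lam k a ^ (2 * s) ≤ lam k c ^ (2 * s) :=
      Real.rpow_le_rpow la.le l1 (by linarith)
    have : 0 ≤ lam k a ^ (2 * s) := by positivity
    rw [abs_sub_comm, abs_of_nonneg (by linarith)]
    linarith
  have p2 : |b| * |lam k b ^ (2 * s) - lam k c ^ (2 * s)| ≤ 2 * s * |a| * (jb s c * jb s c) := by
    have h0 : lam k b ^ (2 * s) ≤ lam k c ^ (2 * s) :=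
      Real.rpow_le_rpow lb.le l2 (by linarith)
    have h1 := rpow_sub_rpow_le (p := 2 * s) (by linarith) lb.le lc
    have h2 : lam k c - lam k b ≤ |a| := by
      have h3 : jb 1 c - jb 1 b ≤ |a| := by
        have := (abs_le.1 (abs_jb_one_sub_le (-c) b)).2
        rw [jb_even] at this
        have e : -c - b = a := by linarith
        rwa [e] at this
      have h4 : 0 ≤ |a| := abs_nonneg a
      simp only [lam]
      rcases le_total (jb 1 b) k with h5 | h5
      · rw [min_eq_left h5]
        linarith [min_le_left (jb 1 c) k]
      · rw [min_eq_right h5]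
        linarith [min_le_right (jb 1 c) k]
    have h3 : lam k c ^ (2 * s - 1) ≤ jb (2 * s - 1) c := by
      rw [jb_eq_rpow]
      exact Real.rpow_le_rpow lc.le (lam_le _ _) (by linarith)
    have h4 : |b| ≤ jb 1 c := hbc.trans (abs_le_jb_one c)
    have h5 : 0 ≤ lam k c - lam k b := by linarith
    have h6 : 0 ≤ lam k c ^ (2 * s - 1) := by positivity
    rw [abs_sub_comm, abs_of_nonneg (sub_nonneg.2 h0)]
    have := jb_pos 1 c
    have := jb_pos (2 * s - 1) c
    calc |b| * (lam k c ^ (2 * s) - lam k b ^ (2 * s))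
        ≤ jb 1 c * (2 * s * jb (2 * s - 1) c * |a|) := by
          refine mul_le_mul h4 (h1.trans ?_) (by linarith) (by positivity)
          gcongr
      _ = 2 * s * |a| * (jb 1 c * jb (2 * s - 1) c) := by ring
      _ = 2 * s * |a| * (jb s c * jb s c) := by
        rw [jb_mul, jb_mul]
        ring_nf
  have e : a * lam k a ^ (2 * s) + b * lam k b ^ (2 * s) + c * lam k c ^ (2 * s) =
      a * (lam k a ^ (2 * s) - lam k c ^ (2 * s)) +
        b * (lam k b ^ (2 * s) - lam k c ^ (2 * s)) := by
    have : c = -a - b := by linarith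
    linear_combination (lam k c ^ (2 * s)) * this
  have := jb_pos s c
  have := jb_pos s b
  rw [e]
  calc _ ≤ |a| * |lam k a ^ (2 * s) - lam k c ^ (2 * s)| +
        |b| * |lam k b ^ (2 * s) - lam k c ^ (2 * s)| := by
        rw [← abs_mul, ← abs_mul]
        exact abs_add_le _ _
    _ ≤ |a| * (jb s c * jb s c) + 2 * s * |a| * (jb s c * jb s c) := by gcongr
    _ = (2 * s + 1) * (|a| * (jb s c * jb s c)) := by ring
    _ ≤ (2 * s + 1) * (|a| * ((2 ^ s * jb s b) * jb s c)) := by gcongr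
    _ = _ := by ring

theorem abs_symbol_le {s k : ℝ} (hs : 1 ≤ s) (hk : 1 ≤ k) {a b c : ℝ} (h : a + b + c = 0) :
    |a * lam k a ^ (2 * s) + b * lam k b ^ (2 * s) + c * lam k c ^ (2 * s)| ≤
      (2 * s + 1) * 2 ^ s *
        (|a| * (jb s b * jb s c) + |b| * (jb s a * jb s c) + |c| * (jb s a * jb s b)) := by
  have pa := jb_pos s a
  have pb := jb_pos s b
  have pc := jb_pos s c
  have ha : 0 ≤ |a| * (jb s b * jb s c) := by positivity
  have hb : 0 ≤ |b| * (jb s a * jb s c) := by positivity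
  have hc : 0 ≤ |c| * (jb s a * jb s b) := by positivity
  have hC : 0 ≤ (2 * s + 1) * (2 : ℝ) ^ s := by positivity
  have key : ∀ {x y z : ℝ}, x + y + z = 0 → |x| ≤ |y| → |y| ≤ |z| →
      a * lam k a ^ (2 * s) + b * lam k b ^ (2 * s) + c * lam k c ^ (2 * s) =
        x * lam k x ^ (2 * s) + y * lam k y ^ (2 * s) + z * lam k z ^ (2 * s) →
      |x| * (jb s y * jb s z) ≤
        |a| * (jb s b * jb s c) + |b| * (jb s a * jb s c) + |c| * (jb s a * jb s b) →
      |a * lam k a ^ (2 * s) + b * lam k b ^ (2 * s) + c * lam k c ^ (2 * s)| ≤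
      (2 * s + 1) * 2 ^ s *
        (|a| * (jb s b * jb s c) + |b| * (jb s a * jb s c) + |c| * (jb s a * jb s b)) :=
    fun h0 h1 h2 e h3 => by
      rw [e]
      exact (abs_symbol_le_of_le hs hk h0 h1 h2).trans (mul_le_mul_of_nonneg_left h3 hC)
  rcases le_total |a| |b| with h1 | h1 <;> rcases le_total |b| |c| with h2 | h2 <;>
    rcases le_total |a| |c| with h3 | h3
  · exact key h h1 h2 rfl (by linarith)
  · exact key h h1 h2 rfl (by linarith)
  · exact key (x := a) (y := c) (z := b) (by linarith) h3 h2 (by ring) (by linarith)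
  · exact key (x := c) (y := a) (z := b) (by linarith) h3 h1 (by ring) (by linarith)
  · exact key (x := b) (y := a) (z := c) (by linarith) h1 h3 (by ring) (by linarith)
  · exact key (x := b) (y := c) (z := a) (by linarith) h2 h3 (by ring) (by linarith)
  · exact key (x := c) (y := b) (z := a) (by linarith) h2 h1 (by ring) (by linarith)
  · exact key (x := c) (y := b) (z := a) (by linarith) h2 h1 (by ring) (by linarith)

/-! ### The nonlinearity and the dispersion on the Fourier side -/

/-- The kernel of `∂_x Q(u, u)`, where `u` is represented by `⟨ξ⟩^s û(ξ)`. -/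
def kern (s : ℝ) (x y : ℝ) : ℂ :=
  2 * Real.pi * Complex.I * (x + y : ℝ) * (jb (-s) x * jb (-s) y : ℝ)

theorem measurable_kern (s : ℝ) : Measurable (Function.uncurry (kern s)) := by
  have := continuous_jb (-s)
  refine Continuous.measurable ?_
  unfold Function.uncurry kern
  fun_prop

theorem norm_two_pi_I : ‖(2 * Real.pi * Complex.I : ℂ)‖ = 2 * Real.pi := by
  simp [abs_of_pos Real.pi_pos]

theorem norm_kern_le (s x y : ℝ) : ‖kern s x y‖ ≤
    2 * Real.pi * (jb (1 - s) x * jb (-s) y + jb (-s) x * jb (1 - s) y) := by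
  have h1 := jb_pos (-s) x
  have h2 := jb_pos (-s) y
  rw [kern, norm_mul, norm_mul, norm_two_pi_I, Complex.norm_real, Complex.norm_real,
    Real.norm_eq_abs, Real.norm_of_nonneg (by positivity), mul_assoc]
  gcongr
  calc |x + y| * (jb (-s) x * jb (-s) y) ≤ (jb 1 x + jb 1 y) * (jb (-s) x * jb (-s) y) := by
        gcongr
        exact (abs_add_le _ _).trans (add_le_add (abs_le_jb_one _) (abs_le_jb_one _))
    _ = (jb 1 x * jb (-s) x) * jb (-s) y + jb (-s) x * (jb 1 y * jb (-s) y) := by ring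
    _ = _ := by simp only [jb_mul, sub_eq_add_neg]

theorem isKer_kern {s : ℝ} (hs : 0 ≤ s) : IsKer (s - 1) (2 * Real.pi) (kern s) := by
  refine ⟨measurable_kern s, by positivity, fun x y => (norm_kern_le s x y).trans ?_⟩
  have h1 := jb_pos (1 - s) x
  have h2 := jb_pos (1 - s) y
  have h3 := jb_pos (1 - s) (x + y)
  rw [neg_sub]
  refine mul_le_mul_of_nonneg_left ?_ (by positivity)
  have h4 : jb (1 - s) x * jb (-s) y ≤ jb (1 - s) x * 1 := by
    gcongr
    exact jb_le_one (by linarith) y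
  have h5 : jb (-s) x * jb (1 - s) y ≤ 1 * jb (1 - s) y := by
    gcongr
    exact jb_le_one (by linarith) x
  linarith

theorem adm_kern {s : ℝ} (hs : 3 / 2 < s) : Adm (kern s) :=
  ⟨s - 1, _, by linarith, isKer_kern (by linarith)⟩

theorem kern_comm (s x y : ℝ) : kern s x y = kern s y x := by
  simp only [kern, add_comm x y, mul_comm (jb (-s) x)]

theorem kern_neg (s x y : ℝ) : kern s (-x) (-y) = (starRingEnd ℂ) (kern s x y) := by
  simp only [kern, jb_even, map_mul, Complex.conj_ofReal, Complex.conj_I, map_ofNat]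
  push_cast
  ring

/-- The Fourier symbol of `δ ∂_x³`. -/
def disp (δ ξ : ℝ) : ℂ := δ * (2 * Real.pi * Complex.I * ξ) ^ 3

theorem continuous_disp (δ : ℝ) : Continuous (disp δ) := by unfold disp; fun_prop

theorem disp_neg (δ ξ : ℝ) : disp δ (-ξ) = (starRingEnd ℂ) (disp δ ξ) := by
  simp only [disp, map_mul, map_pow, Complex.conj_ofReal, Complex.conj_I, map_ofNat]
  push_cast
  ring

theorem disp_re (δ ξ : ℝ) : (disp δ ξ).re = 0 := by
  have : disp δ ξ = ((-(δ * (2 * Real.pi * ξ) ^ 3) : ℝ) : ℂ) * Complex.I := by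
    have h3 : Complex.I ^ 3 = -Complex.I := by rw [pow_succ, Complex.I_sq]; ring
    simp only [disp, mul_pow, h3]
    push_cast
    ring
  rw [this, Complex.mul_I_re, Complex.ofReal_im, neg_zero]

/-- A real symbol against an imaginary one: dispersion does not contribute to energies. -/
theorem re_inner_mulL_eq_zero {d : ℕ} {m p : ℝ → ℂ} (hm : BddMeas m) (hp : BddMeas p)
    (h : ∀ ξ, ((starRingEnd ℂ) (m ξ) * p ξ).re = 0) (F : L2 d) :
    (inner ℂ (mulL m F) (mulL p F)).re = 0 := by
  rw [inner_mulL hm, mulL_mulL hm.conj hp, L2.inner_def]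
  have : ∀ᵐ ξ, inner ℂ (F ξ) (mulL (fun ξ => (starRingEnd ℂ) (m ξ) * p ξ) F ξ) =
      Complex.I * ((((starRingEnd ℂ) (m ξ) * p ξ).im * ‖F ξ‖ ^ 2 : ℝ) : ℂ) := by
    filter_upwards [coeFn_mulL (hm.conj.mul hp) F] with ξ h1
    rw [h1, inner_smul_right, inner_self_eq_norm_sq_to_K]
    apply Complex.ext <;> simp [h ξ, ← Complex.ofReal_pow]
  rw [integral_congr_ae this, integral_const_mul, integral_complex_ofReal, Complex.I_mul_re,
    Complex.ofReal_im, neg_zero]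

theorem bddMeas_lam {s k : ℝ} (hs : 0 ≤ s) (hk : 1 ≤ k) (j : ℝ) (hj : 0 ≤ j) :
    BddMeas fun ξ => ((lam k ξ ^ j * jb (-s) ξ : ℝ) : ℂ) := by
  refine ⟨Complex.measurable_ofReal.comp
    (((continuous_lam k).measurable.pow_const _).mul (measurable_jb _)), k ^ j, fun ξ => ?_⟩
  have h1 := lam_pos hk ξ
  have h2 := jb_pos (-s) ξ
  rw [Complex.norm_real, Real.norm_of_nonneg (by positivity)]
  calc lam k ξ ^ j * jb (-s) ξ ≤ k ^ j * 1 := by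
        gcongr
        · exact min_le_right _ _
        · exact jb_le_one (by linarith) ξ
    _ = _ := mul_one _

section Estimates

variable {d : ℕ} {Q : RVec d →ₗ[ℝ] RVec d →ₗ[ℝ] RVec d} {s : ℝ}

/-- The constant in the energy estimate. -/
def energyConst (Q : RVec d →ₗ[ℝ] RVec d →ₗ[ℝ] RVec d) (s : ℝ) : ℝ :=
  2 * Real.pi * ((2 * s + 1) * 2 ^ s) * formConst Q (s - 1)

theorem energyConst_nonneg (hs : 0 ≤ s) : 0 ≤ energyConst Q s := by
  have := formConst_nonneg Q (s - 1)
  unfold energyConst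
  positivity

/-- The nonlinear part of the energy estimate, uniform in the truncation parameter `k`. -/
theorem norm_inner_bil_le (hQ : IsFullySymmetric Q) (hs : 3 / 2 < s) {k : ℝ} (hk : 1 ≤ k)
    {F : L2 d} (hF : IsHerm F) :
    3 * ‖inner ℂ (bil Q (kern s) F F)
      (mulL (fun ξ => ((lam k ξ ^ (2 * s) * jb (-s) ξ : ℝ) : ℂ)) F)‖ ≤
      energyConst Q s * ‖F‖ ^ 3 := by
  have hb := bddMeas_lam (s := s) (by linarith) hk (2 * s) (by linarith)
  have hker := isKer_kern (s := s) (by linarith)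
  obtain ⟨C', hk'⟩ := hker.mul_add hb
  have e1 : inner ℂ (bil Q (kern s) F F)
      (mulL (fun ξ => ((lam k ξ ^ (2 * s) * jb (-s) ξ : ℝ) : ℂ)) F) =
      form Q (fun x y => ((lam k (x + y) ^ (2 * s) * jb (-s) (x + y) : ℝ) : ℂ) * kern s x y)
        F F F := by
    rw [← inner_bil Q ⟨s - 1, C', by linarith, hk'⟩, ← mulL_bil Q (adm_kern hs) hb,
      inner_mulL hb]
    simp only [Complex.conj_ofReal]
  rw [e1]
  refine (norm_form_le_of_symm_three hQ (r := s - 1) (by linarith) hk'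
    (C := 2 * Real.pi * ((2 * s + 1) * 2 ^ s)) ?_ hF).trans (le_of_eq ?_)
  · refine ⟨?_, by positivity, fun x y => ?_⟩
    · have h3 := hk'.exch.swap.1
      simp only [add_comm] at h3
      have h4 := (hk'.1.add hk'.exch.1).add h3
      convert h4 using 1
      funext p
      simp [Function.uncurry, add_comm]
    · have px := jb_pos (-s) x
      have py := jb_pos (-s) y
      have pz := jb_pos (-s) (x + y)
      have hsym := abs_symbol_le (s := s) (k := k) (by linarith) hk
        (a := x) (b := y) (c := -(x + y)) (by ring)
      rw [jb_even, lam_even, abs_neg] at hsym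
      have e : ((lam k (x + y) ^ (2 * s) * jb (-s) (x + y) : ℝ) : ℂ) * kern s x y +
          ((lam k (-(x + y) + y) ^ (2 * s) * jb (-s) (-(x + y) + y) : ℝ) : ℂ) *
            kern s (-(x + y)) y +
          ((lam k (-(x + y) + x) ^ (2 * s) * jb (-s) (-(x + y) + x) : ℝ) : ℂ) *
            kern s (-(x + y)) x =
          2 * Real.pi * Complex.I * ((-(x * lam k x ^ (2 * s) + y * lam k y ^ (2 * s) +
            -(x + y) * lam k (x + y) ^ (2 * s)) *
              (jb (-s) x * jb (-s) y * jb (-s) (x + y)) : ℝ) : ℂ) := by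
        have e1 : -(x + y) + y = -x := by ring
        have e2 : -(x + y) + x = -y := by ring
        simp only [kern, e1, e2, lam_even, jb_even]
        push_cast
        ring
      beta_reduce
      rw [e, norm_mul, norm_two_pi_I, Complex.norm_real, Real.norm_eq_abs, abs_mul, abs_neg,
        abs_of_pos (mul_pos (mul_pos px py) pz),
        mul_assoc (2 * Real.pi) ((2 * s + 1) * 2 ^ s)]
      refine mul_le_mul_of_nonneg_left ?_ (by positivity)
      refine (mul_le_mul_of_nonneg_right hsym (mul_pos (mul_pos px py) pz).le).trans ?_
      rw [mul_assoc]
      refine mul_le_mul_of_nonneg_left ?_ (by positivity)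
      have a1 := jb_neg_mul s x
      have a2 := jb_neg_mul s y
      have a3 := jb_neg_mul s (x + y)
      have b : ∀ ξ, |ξ| * jb (-s) ξ ≤ jb (-(s - 1)) ξ := fun ξ => by
        have := jb_pos (-s) ξ
        calc |ξ| * jb (-s) ξ ≤ jb 1 ξ * jb (-s) ξ := by gcongr; exact abs_le_jb_one ξ
          _ = _ := by rw [jb_mul]; ring_nf
      calc _ = |x| * jb (-s) x * (jb (-s) y * jb s y) * (jb (-s) (x + y) * jb s (x + y)) +
            |y| * jb (-s) y * (jb (-s) x * jb s x) * (jb (-s) (x + y) * jb s (x + y)) +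
            |x + y| * jb (-s) (x + y) * (jb (-s) x * jb s x) * (jb (-s) y * jb s y) := by ring
        _ ≤ _ := by
          rw [a1, a2, a3]
          linarith [b x, b y, b (x + y)]
  · rw [energyConst]
    ring

/-- The symbol by which `⟨ξ⟩^s` is truncated to `min(⟨ξ⟩, k)^s`. -/
def rho (s k ξ : ℝ) : ℂ := ((lam k ξ ^ s * jb (-s) ξ : ℝ) : ℂ)

theorem bddMeas_rho (hs : 0 ≤ s) {k : ℝ} (hk : 1 ≤ k) : BddMeas (rho s k) :=
  bddMeas_lam hs hk s hs

theorem rho_eq_one {k ξ : ℝ} (h : jb 1 ξ ≤ k) : rho s k ξ = 1 := by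
  rw [rho, lam, min_eq_left h, ← jb_eq_rpow, jb_mul_neg, Complex.ofReal_one]

theorem norm_rho_le (hs : 0 ≤ s) {k : ℝ} (hk : 1 ≤ k) (ξ : ℝ) : ‖rho s k ξ‖ ≤ 1 := by
  have h1 := lam_pos hk ξ
  have h2 := jb_pos (-s) ξ
  rw [rho, Complex.norm_real, Real.norm_of_nonneg (by positivity)]
  calc lam k ξ ^ s * jb (-s) ξ ≤ jb s ξ * jb (-s) ξ := by
        rw [jb_eq_rpow s]
        gcongr
        exact lam_le k ξ
    _ = 1 := jb_mul_neg s ξ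

/-- The right-hand side of the Galerkin system on the band `|ξ| ≤ n`, in the unknown
`⟨ξ⟩^s û(ξ)`. -/
def galerkin (Q : RVec d →ₗ[ℝ] RVec d →ₗ[ℝ] RVec d) (δ s n : ℝ) (F : L2 d) : L2 d :=
  mulL (fun ξ => (ind n ξ : ℂ) * disp δ ξ) F -
    mulL (fun ξ => (ind n ξ : ℂ) * jb s ξ) (bil Q (kern s) F F)

theorem bddMeas_ind_disp (n δ : ℝ) : BddMeas fun ξ => (ind n ξ : ℂ) * disp δ ξ :=
  bddMeas_ind_mul n (continuous_disp δ)

theorem bddMeas_ind_jb (n a : ℝ) : BddMeas fun ξ => (ind n ξ : ℂ) * jb a ξ :=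
  bddMeas_ind_mul n (Complex.continuous_ofReal.comp (continuous_jb a))

/-- The energy estimate for the Galerkin system. The bound is independent of the band `n`, of the
dispersion `δ` and of the truncation `k`. -/
theorem abs_re_inner_galerkin_le (hQ : IsFullySymmetric Q) (hs : 3 / 2 < s) (δ n : ℝ) {k : ℝ}
    (hk : 1 ≤ k) {F : L2 d} (hF : IsHerm F) (hn : mulL (fun ξ => (ind n ξ : ℂ)) F = F) :
    |2 * (inner ℂ (mulL (rho s k) F) (mulL (rho s k) (galerkin Q δ s n F))).re| ≤
      energyConst Q s * ‖F‖ ^ 3 := by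
  have hr := bddMeas_rho (s := s) (by linarith) hk
  have h1 := bddMeas_ind_disp n δ
  have h2 := bddMeas_ind_jb n s
  have hb := bddMeas_lam (s := s) (by linarith) hk (2 * s) (by linarith)
  have e1 : (inner ℂ (mulL (rho s k) F)
      (mulL (rho s k) (mulL (fun ξ => (ind n ξ : ℂ) * disp δ ξ) F))).re = 0 := by
    rw [mulL_mulL hr h1]
    refine re_inner_mulL_eq_zero hr (hr.mul h1) (fun ξ => ?_) F
    have : (starRingEnd ℂ) (rho s k ξ) * (rho s k ξ * (ind n ξ * disp δ ξ)) =
        ((lam k ξ ^ s * jb (-s) ξ * (lam k ξ ^ s * jb (-s) ξ) * ind n ξ : ℝ) : ℂ) * disp δ ξ := by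
      rw [rho, Complex.conj_ofReal]
      push_cast
      ring
    rw [this, Complex.re_ofReal_mul, disp_re, mul_zero]
  have e2 : inner ℂ (mulL (rho s k) F) (mulL (rho s k)
      (mulL (fun ξ => (ind n ξ : ℂ) * jb s ξ) (bil Q (kern s) F F))) =
      (starRingEnd ℂ) (inner ℂ (bil Q (kern s) F F)
        (mulL (fun ξ => ((lam k ξ ^ (2 * s) * jb (-s) ξ : ℝ) : ℂ)) F)) := by
    rw [← inner_conj_symm]
    congr 1
    rw [mulL_mulL hr h2, inner_mulL (hr.mul h2), mulL_mulL (hr.mul h2).conj hr]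
    congr 1
    rw [← hn, mulL_mulL ((hr.mul h2).conj.mul hr) (bddMeas_ind n), mulL_mulL hb (bddMeas_ind n)]
    refine mulL_congr (fun ξ => ?_) F
    have hl := lam_pos hk ξ
    have e3 : lam k ξ ^ (2 * s) = lam k ξ ^ s * lam k ξ ^ s := by
      rw [← Real.rpow_add hl]
      ring_nf
    have e4 := jb_neg_mul s ξ
    have e5 := ind_mul_self n ξ
    simp only [rho, Complex.conj_ofReal, ← Complex.ofReal_mul]
    congr 1
    rw [e3]
    linear_combination (lam k ξ ^ s * lam k ξ ^ s * jb (-s) ξ * ind n ξ * ind n ξ) * e4 +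
      (lam k ξ ^ s * lam k ξ ^ s * jb (-s) ξ) * e5
  have h3 := norm_inner_bil_le hQ hs hk hF
  set X := inner ℂ (bil Q (kern s) F F)
        (mulL (fun ξ => ((lam k ξ ^ (2 * s) * jb (-s) ξ : ℝ) : ℂ)) F) with hX
  rw [galerkin, map_sub, inner_sub_right, Complex.sub_re, e1, e2, Complex.conj_re, zero_sub,
    abs_mul, abs_neg, abs_two]
  have h4 := Complex.abs_re_le_norm X
  have h5 := norm_nonneg X
  linarith

/-! ### Stability in `L²` -/

/-- The contribution of high frequencies is small. -/
theorem norm_bil_high_le (hs : 3 / 2 < s) {n : ℝ} (hn : 0 ≤ n) (A V : L2 d) :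
    ‖bil Q (kern s) A (mulL (fun ξ => ((1 - ind n ξ : ℝ) : ℂ)) V)‖ ≤
      4 * Real.pi * jb (1 - s) n * formConst Q (s - 1) * ‖A‖ * ‖V‖ := by
  have hb := bddMeas_one_sub_ind n
  rw [bil_mulL_right Q (adm_kern hs) hb]
  refine norm_bil_le Q (by linarith) ?_ A V
  have pn := jb_pos (1 - s) n
  refine ⟨((hb.1.comp measurable_snd).mul (measurable_kern s)), by positivity, fun x y => ?_⟩
  have h1 := jb_pos (1 - s) x
  have h2 := jb_pos (1 - s) y
  have h3 := jb_pos (1 - s) (x + y)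
  have h4 := jb_pos (-s) x
  have h5 := jb_pos (-s) y
  have m1 : jb (-s) y ≤ jb (1 - s) y := jb_mono (by linarith) y
  have m2 : jb (-s) x ≤ jb (1 - s) x := jb_mono (by linarith) x
  rw [norm_mul, Complex.norm_real, neg_sub]
  by_cases hy : |y| ≤ n
  · simp only [ind, hy, if_true, sub_self, norm_zero, zero_mul]
    positivity
  · simp only [ind, hy, if_false, sub_zero, norm_one, one_mul]
    have m3 : jb (1 - s) y ≤ jb (1 - s) n := by
      have h6 : jb 1 n ≤ jb 1 y := jb_one_le_of_abs_le (by
        rw [abs_of_nonneg hn]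
        exact (not_le.1 hy).le)
      rw [jb_eq_rpow (1 - s) y, jb_eq_rpow (1 - s) n]
      exact Real.rpow_le_rpow_of_nonpos (jb_pos _ _) h6 (by linarith)
    calc ‖kern s x y‖ ≤ _ := norm_kern_le s x y
      _ ≤ 2 * Real.pi * (jb (1 - s) x * jb (1 - s) n + jb (1 - s) x * jb (1 - s) n) := by
        gcongr
        exact m1.trans m3
      _ = 4 * Real.pi * jb (1 - s) n * jb (1 - s) x := by ring
      _ ≤ _ := by
        gcongr
        linarith

/-- The low-frequency part of the difference estimate: `∂_x` falls on the coefficient after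
symmetrization. -/
theorem norm_inner_bil_low_le (hQ : IsFullySymmetric Q) (hs : 3 / 2 < s) (n : ℝ) (A : L2 d)
    {V : L2 d} (hV : IsHerm V) :
    2 * ‖inner ℂ (bil Q (kern s) A (mulL (fun ξ => (ind n ξ : ℂ)) V))
      (mulL (fun ξ => (ind n ξ : ℂ) * jb (-s) ξ) V)‖ ≤
      2 * Real.pi * formConst Q (s - 1) * ‖A‖ *
        ‖mulL (fun ξ => (ind n ξ : ℂ) * jb (-s) ξ) V‖ ^ 2 := by
  have hi := bddMeas_ind n
  have hj := bddMeas_ind_jb n (-s)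
  set z := mulL (fun ξ => (ind n ξ : ℂ) * jb (-s) ξ) V with hz
  have hzh : IsHerm z := hV.mulL hj fun ξ => by simp [ind_even, jb_even]
  let k1 : ℝ → ℝ → ℂ := fun x y => (ind n (x + y) * ind n y : ℝ) *
    (2 * Real.pi * Complex.I * (x + y : ℝ) * (jb (-s) x : ℝ))
  have hmeas : Measurable (Function.uncurry k1) := by
    refine Measurable.mul ?_ ?_
    · exact Complex.measurable_ofReal.comp
        (((measurable_ind n).comp (measurable_fst.add measurable_snd)).mul
          ((measurable_ind n).comp measurable_snd))
    · have := continuous_jb (-s)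
      exact Continuous.measurable (by fun_prop)
  have hk1 : IsKer (s - 1) (2 * Real.pi * |n|) k1 := by
    refine ⟨hmeas, by positivity, fun x y => ?_⟩
    have h0 := ind_nonneg n (x + y)
    have h0' := ind_nonneg n y
    have h1 := jb_pos (-s) x
    have h2 := jb_pos (-(s - 1)) x
    have h3 := jb_pos (-(s - 1)) y
    have h4 := jb_pos (-(s - 1)) (x + y)
    have h5 : jb (-s) x ≤ jb (-(s - 1)) x := jb_mono (by linarith) x
    simp only [k1]
    rw [norm_mul, norm_mul, norm_mul, norm_two_pi_I, Complex.norm_real, Complex.norm_real,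
      Complex.norm_real, Real.norm_of_nonneg (by positivity), Real.norm_of_nonneg h1.le,
      Real.norm_eq_abs]
    have h6 : ind n (x + y) * |x + y| ≤ |n| := by
      unfold ind
      split_ifs with h
      · rw [one_mul]
        exact h.trans (le_abs_self n)
      · simp
    calc ind n (x + y) * ind n y * (2 * Real.pi * |x + y| * jb (-s) x)
        = 2 * Real.pi * (ind n (x + y) * |x + y|) * (ind n y * jb (-s) x) := by ring
      _ ≤ 2 * Real.pi * |n| * (1 * jb (-(s - 1)) x) := by
        gcongr
        exact ind_le_one n y
      _ ≤ _ := by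
        gcongr
        linarith
  have hs1 : IsKer (s - 1) (2 * Real.pi) fun x y => k1 x y + k1 x (-(x + y)) := by
    refine ⟨hmeas.add hk1.exch_right.1, by positivity, fun x y => ?_⟩
    have h0 := ind_nonneg n (x + y)
    have h0' := ind_nonneg n y
    have h1 := jb_pos (-s) x
    have h3 := jb_pos (-(s - 1)) y
    have h4 := jb_pos (-(s - 1)) (x + y)
    have e : k1 x y + k1 x (-(x + y)) = 2 * Real.pi * Complex.I *
        ((ind n (x + y) * ind n y * (x * jb (-s) x) : ℝ) : ℂ) := by
      have e1 : x + -(x + y) = -y := by ring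
      simp only [k1, e1, ind_even]
      push_cast
      ring
    beta_reduce
    rw [e, norm_mul, norm_two_pi_I, Complex.norm_real, Real.norm_eq_abs, abs_mul, abs_mul x,
      abs_of_nonneg (mul_nonneg h0 h0'), abs_of_pos h1]
    gcongr
    calc ind n (x + y) * ind n y * (|x| * jb (-s) x) ≤ 1 * 1 * (jb 1 x * jb (-s) x) := by
          gcongr
          · exact ind_le_one _ _
          · exact ind_le_one _ _
          · exact abs_le_jb_one x
      _ = jb (-(s - 1)) x := by rw [jb_mul]; ring_nf
      _ ≤ _ := by linarith
  have hadm1 : Adm k1 := ⟨s - 1, _, by linarith, hk1⟩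
  have e : inner ℂ (bil Q (kern s) A (mulL (fun ξ => (ind n ξ : ℂ)) V)) z =
      form Q k1 A z z := by
    have e1 : z = mulL (fun ξ => (starRingEnd ℂ) (ind n ξ : ℂ)) z := by
      simp only [Complex.conj_ofReal]
      rw [hz, mulL_mulL hi hj]
      refine mulL_congr (fun ξ => ?_) V
      have := ind_mul_self n ξ
      rw [← mul_assoc, ← Complex.ofReal_mul (ind n ξ) (ind n ξ), this]
    conv_lhs => rw [e1]
    rw [← inner_mulL hi, ← inner_bil Q hadm1]
    congr 1
    obtain ⟨C', h'⟩ := (isKer_kern (s := s) (by linarith)).mul_snd hi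
    rw [bil_mulL_right Q (adm_kern hs) hi, mulL_bil Q ⟨s - 1, C', by linarith, h'⟩ hi, hz,
      bil_mulL_right Q hadm1 hj]
    refine bil_congr Q (fun x y => ?_) A V
    have := ind_mul_self n y
    have t : ((ind n y : ℝ) : ℂ) * (ind n y : ℝ) = (ind n y : ℝ) := by
      rw [← Complex.ofReal_mul, this]
    simp only [k1, kern]
    push_cast
    linear_combination -((ind n (x + y) : ℂ) * (2 * Real.pi * Complex.I * (x + y) *
      (jb (-s) x * jb (-s) y))) * t
  rw [e]
  refine (norm_form_le_of_symm_two hQ (by linarith) hk1 hs1 A hzh).trans (le_of_eq (by ring))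

end Estimates

/-! ### Ordinary differential equations and differential inequalities -/

section ODE

variable {E : Type*} [NormedAddCommGroup E] [NormedSpace ℝ E]

/-- The radial retraction onto the ball of radius `R`. -/
def radial (R : ℝ) (x : E) : E := (max 1 (‖x‖ / R))⁻¹ • x

theorem radial_of_norm_le {R : ℝ} (hR : 0 < R) {x : E} (h : ‖x‖ ≤ R) : radial R x = x := by
  have : ‖x‖ / R ≤ 1 := by rwa [div_le_one hR]
  simp [radial, max_eq_left this]

theorem norm_radial_le {R : ℝ} (hR : 0 < R) (x : E) : ‖radial R x‖ ≤ R := by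
  have h1 : 0 < max 1 (‖x‖ / R) := lt_max_of_lt_left one_pos
  rw [radial, norm_smul, norm_inv, Real.norm_of_nonneg h1.le, inv_mul_le_iff₀ h1]
  calc ‖x‖ = ‖x‖ / R * R := by field_simp
    _ ≤ _ := by gcongr; exact le_max_right _ _

theorem lipschitzWith_radial {R : ℝ} (hR : 0 < R) : LipschitzWith 2 (radial R : E → E) := by
  refine LipschitzWith.of_dist_le_mul fun x y => ?_
  rw [dist_eq_norm, dist_eq_norm]
  set m := max 1 (‖x‖ / R) with hm
  set m' := max 1 (‖y‖ / R) with hm'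
  have h1 : 1 ≤ m := le_max_left _ _
  have h1' : 1 ≤ m' := le_max_left _ _
  have h2 : ‖y‖ ≤ m' * R := by
    rw [← div_le_iff₀ hR]
    exact le_max_right _ _
  have h3 : |m' - m| ≤ ‖x - y‖ / R := by
    have h4 : |m' - m| ≤ |‖y‖ / R - ‖x‖ / R| := by
      rw [hm, hm', max_comm 1, max_comm 1]
      exact abs_max_sub_max_le_abs _ _ _
    refine h4.trans ?_
    rw [← sub_div, abs_div, abs_of_pos hR, abs_sub_comm]
    gcongr
    exact abs_norm_sub_norm_le x y
  have e : radial R x - radial R y = m⁻¹ • (x - y) + ((m' - m) * (m⁻¹ * m'⁻¹)) • y := by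
    have : m⁻¹ = m'⁻¹ + (m' - m) * (m⁻¹ * m'⁻¹) := by field_simp; ring
    rw [radial, radial, ← hm, ← hm', smul_sub]
    nth_rewrite 3 [this]
    rw [add_smul]
    abel
  rw [e]
  refine (norm_add_le _ _).trans ?_
  rw [norm_smul, norm_smul, Real.norm_eq_abs, Real.norm_eq_abs, abs_mul,
    abs_of_pos (by positivity : 0 < m⁻¹), abs_of_pos (by positivity : 0 < m⁻¹ * m'⁻¹)]
  have h4 : m⁻¹ ≤ 1 := inv_le_one_of_one_le₀ h1
  have h5 : |m' - m| * (m⁻¹ * m'⁻¹) * ‖y‖ ≤ ‖x - y‖ := by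
    calc |m' - m| * (m⁻¹ * m'⁻¹) * ‖y‖ ≤ ‖x - y‖ / R * (1 * m'⁻¹) * (m' * R) := by gcongr
      _ = ‖x - y‖ := by field_simp
  have h6 : m⁻¹ * ‖x - y‖ ≤ 1 * ‖x - y‖ := by gcongr
  push_cast
  linarith

/-- A bounded Lipschitz vector field has solutions on every interval. -/
theorem exists_solution_of_lipschitz [CompleteSpace E] {G : E → E} {K : NNReal}
    (hK : LipschitzWith K G) {B : ℝ} (hB : ∀ x, ‖G x‖ ≤ B) (x₀ : E) {T : ℝ} (hT : 0 ≤ T) :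
    ∃ u : ℝ → E, u 0 = x₀ ∧ ∀ t ∈ Set.Icc 0 T, HasDerivWithinAt u (G (u t)) (Set.Icc 0 T) t := by
  have hB0 : 0 ≤ B := (norm_nonneg _).trans (hB x₀)
  have h : IsPicardLindelof (fun _ => G) (tmin := 0) (tmax := T) ⟨0, le_rfl, hT⟩ x₀
      ⟨B * T, by positivity⟩ 0 ⟨B, hB0⟩ K :=
    { lipschitzOnWith := fun t _ => hK.lipschitzOnWith
      continuousOn := fun x _ => continuousOn_const
      norm_le := fun t _ x _ => hB x
      mul_max_le := by
        simp only [sub_zero, sub_self, max_eq_left hT, NNReal.coe_zero]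
        exact le_rfl }
  exact h.exists_eq_forall_mem_Icc_hasDerivWithinAt₀

end ODE

theorem antitoneOn_of_hasDerivWithinAt_nonpos {T : ℝ} {g g' : ℝ → ℝ}
    (h : ∀ t ∈ Set.Icc 0 T, HasDerivWithinAt g (g' t) (Set.Icc 0 T) t)
    (hg : ∀ t ∈ Set.Icc 0 T, g' t ≤ 0) : AntitoneOn g (Set.Icc 0 T) := by
  refine _root_.antitoneOn_of_hasDerivWithinAt_nonpos (convex_Icc 0 T)
    (fun t ht => (h t ht).continuousWithinAt) (f' := g') (fun t ht => ?_) fun t ht => ?_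
  · exact (h t (interior_subset ht)).mono interior_subset
  · exact hg t (interior_subset ht)

/-- The quadratic differential inequality `y' ≤ C (1 + y)²` keeps `1 + y` below twice its initial
value up to time `1 / (2 C (1 + y(0)))`. -/
theorem one_add_le_of_deriv_le {T C : ℝ} {y y' : ℝ → ℝ}
    (h : ∀ t ∈ Set.Icc 0 T, HasDerivWithinAt y (y' t) (Set.Icc 0 T) t) (hy : ∀ t, 0 ≤ y t)
    (hC : 0 ≤ C) (hy' : ∀ t ∈ Set.Icc 0 T, y' t ≤ C * (1 + y t) ^ 2) {Y : ℝ} (h0 : y 0 ≤ Y)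
    (hT : 2 * C * (1 + Y) * T ≤ 1) {t : ℝ} (ht : t ∈ Set.Icc 0 T) : 1 + y t ≤ 2 * (1 + Y) := by
  have hpos : ∀ t, 0 < 1 + y t := fun t => by linarith [hy t]
  have hd : ∀ t ∈ Set.Icc 0 T, HasDerivWithinAt (fun t => -(1 + y t)⁻¹ - C * t)
      (-(-(y' t) / (1 + y t) ^ 2) - C) (Set.Icc 0 T) t := fun t ht => by
    have h1 := ((h t ht).const_add 1).fun_inv (hpos t).ne'
    have h2 := h1.fun_neg.fun_sub ((hasDerivWithinAt_id t (Set.Icc 0 T)).const_mul C)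
    rwa [mul_one] at h2
  have hanti := antitoneOn_of_hasDerivWithinAt_nonpos hd fun t ht => by
    have := hy' t ht
    have h2 : y' t / (1 + y t) ^ 2 ≤ C := by
      rw [div_le_iff₀ (pow_pos (hpos t) 2)]
      exact this
    have h3 : -(-(y' t) / (1 + y t) ^ 2) = y' t / (1 + y t) ^ 2 := by ring
    linarith
  have h1 := hanti ⟨le_rfl, ht.1.trans ht.2⟩ ht ht.1
  simp only [mul_zero, sub_zero] at h1
  have hY : 0 < 1 + Y := by linarith [hpos 0]
  have h2 : (1 + Y)⁻¹ ≤ (1 + y 0)⁻¹ := inv_anti₀ (hpos 0) (by linarith)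
  have h3 : C * t ≤ (1 + Y)⁻¹ / 2 := by
    have : C * t ≤ C * T := mul_le_mul_of_nonneg_left ht.2 hC
    have h4 : C * T ≤ (1 + Y)⁻¹ / 2 := by
      rw [le_div_iff₀ (by norm_num), inv_eq_one_div, le_div_iff₀ hY]
      linarith
    linarith
  have h5 : (2 * (1 + Y))⁻¹ ≤ (1 + y t)⁻¹ := by
    rw [mul_inv]
    linarith
  exact (inv_le_inv₀ (by positivity) (hpos t)).1 h5

/-- A version of Grönwall's inequality. -/
theorem le_of_deriv_le_mul_add {T K ε : ℝ} {y y' : ℝ → ℝ}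
    (h : ∀ t ∈ Set.Icc 0 T, HasDerivWithinAt y (y' t) (Set.Icc 0 T) t)
    (hK : 0 ≤ K) (hε : 0 ≤ ε) (h0 : 0 ≤ y 0)
    (hy' : ∀ t ∈ Set.Icc 0 T, y' t ≤ K * y t + ε) {t : ℝ} (ht : t ∈ Set.Icc 0 T) :
    y t ≤ (y 0 + ε * T) * Real.exp (K * T) := by
  have hd : ∀ t ∈ Set.Icc 0 T, HasDerivWithinAt (fun t => y t * Real.exp (-(K * t)) - ε * t)
      (y' t * Real.exp (-(K * t)) + y t * (Real.exp (-(K * t)) * -K) - ε) (Set.Icc 0 T) t :=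
    fun t ht => by
      have h1 := ((hasDerivWithinAt_id t (Set.Icc 0 T)).const_mul K).fun_neg.exp
      have h2 := ((h t ht).fun_mul h1).fun_sub
        ((hasDerivWithinAt_id t (Set.Icc 0 T)).const_mul ε)
      simpa using h2
  have hanti := antitoneOn_of_hasDerivWithinAt_nonpos hd fun t ht => by
    have h1 : Real.exp (-(K * t)) ≤ 1 := Real.exp_le_one_iff.2 (by
      have := mul_nonneg hK ht.1
      linarith)
    have h2 := mul_le_mul_of_nonneg_right (hy' t ht) (Real.exp_pos (-(K * t))).le
    have h3 := mul_le_mul_of_nonneg_left h1 hε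
    linarith
  have h1 := hanti ⟨le_rfl, ht.1.trans ht.2⟩ ht ht.1
  simp only [mul_zero, neg_zero, Real.exp_zero, mul_one, sub_zero] at h1
  have h2 : ε * t ≤ ε * T := mul_le_mul_of_nonneg_left ht.2 hε
  have h3 : y t = y t * Real.exp (-(K * t)) * Real.exp (K * t) := by
    rw [mul_assoc, ← Real.exp_add]
    simp
  rw [h3]
  have hT : 0 ≤ T := ht.1.trans ht.2
  calc y t * Real.exp (-(K * t)) * Real.exp (K * t) ≤ (y 0 + ε * T) * Real.exp (K * t) := by
        gcongr
        linarith
    _ ≤ _ := by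
        gcongr
        exact ht.2

/-! ### Galerkin systems -/

section Galerkin

variable {d : ℕ} {Q : RVec d →ₗ[ℝ] RVec d →ₗ[ℝ] RVec d} {s : ℝ}

theorem hasDerivWithinAt_norm_sq {F : ℝ → L2 d} {F' : L2 d} {S : Set ℝ} {t : ℝ}
    (h : HasDerivWithinAt F F' S t) :
    HasDerivWithinAt (fun t => ‖F t‖ ^ 2) (2 * (inner ℂ (F t) F').re) S t := by
  have h1 := h.inner ℂ h
  have h2 := Complex.reCLM.hasFDerivAt.comp_hasDerivWithinAt t h1
  have e : ∀ G : L2 d, ‖G‖ ^ 2 = (inner ℂ G G).re := fun G => by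
    rw [inner_self_eq_norm_sq_to_K]
    simp [← Complex.ofReal_pow]
  simp only [e]
  refine h2.congr_deriv ?_
  change (inner ℂ (F t) F' + inner ℂ F' (F t)).re = _
  rw [Complex.add_re, ← inner_conj_symm F' (F t), Complex.conj_re]
  ring

theorem hasDerivWithinAt_mulL {F : ℝ → L2 d} {F' : L2 d} {S : Set ℝ} {t : ℝ} (m : ℝ → ℂ)
    (h : HasDerivWithinAt F F' S t) :
    HasDerivWithinAt (fun t => mulL m (F t)) (mulL m F') S t :=
  ((mulL m : L2 d →L[ℂ] L2 d).restrictScalars ℝ).hasFDerivAt.comp_hasDerivWithinAt t h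

theorem mulL_ind_galerkin (δ n : ℝ) (F : L2 d) :
    mulL (fun ξ => (ind n ξ : ℂ)) (galerkin Q δ s n F) = galerkin Q δ s n F := by
  have e : ∀ ξ, (ind n ξ : ℂ) * ind n ξ = ind n ξ := fun ξ => by
    rw [← Complex.ofReal_mul, ind_mul_self]
  rw [galerkin, map_sub, mulL_mulL (bddMeas_ind n) (bddMeas_ind_disp n δ),
    mulL_mulL (bddMeas_ind n) (bddMeas_ind_jb n s)]
  simp only [← mul_assoc, e]

theorem isHerm_galerkin (hs : 3 / 2 < s) (δ n : ℝ) {F : L2 d} (hF : IsHerm F) :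
    IsHerm (galerkin Q δ s n F) := by
  refine IsHerm.sub (hF.mulL (bddMeas_ind_disp n δ) fun ξ => ?_)
    ((hF.bil Q (adm_kern hs) (kern_neg s) hF).mulL (bddMeas_ind_jb n s) fun ξ => ?_)
  · simp [ind_even, disp_neg]
  · simp [ind_even, jb_even]

theorem exists_norm_galerkin_sub_le (Q : RVec d →ₗ[ℝ] RVec d →ₗ[ℝ] RVec d) (δ s n : ℝ) {R : ℝ}
    (hR : 0 ≤ R) : ∃ L : NNReal, ∀ F G : L2 d, ‖F‖ ≤ R → ‖G‖ ≤ R →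
      ‖galerkin Q δ s n F - galerkin Q δ s n G‖ ≤ L * ‖F - G‖ := by
  set A : L2 d →L[ℂ] L2 d := mulL (fun ξ => (ind n ξ : ℂ) * disp δ ξ)
  set A' : L2 d →L[ℂ] L2 d := mulL (fun ξ => (ind n ξ : ℂ) * jb s ξ)
  set B := bil Q (kern s)
  refine ⟨⟨‖A‖ + ‖A'‖ * (2 * ‖B‖ * R), by positivity⟩, fun F G hF hG => ?_⟩
  have e : galerkin Q δ s n F - galerkin Q δ s n G =
      A (F - G) - A' (B F (F - G) + B (F - G) G) := by
    simp only [galerkin, map_sub, map_add, _root_.sub_apply, A, A', B]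
    abel
  rw [e]
  refine (norm_sub_le _ _).trans ?_
  change _ ≤ (‖A‖ + ‖A'‖ * (2 * ‖B‖ * R)) * ‖F - G‖
  have h1 := A.le_opNorm (F - G)
  have h2 := A'.le_opNorm (B F (F - G) + B (F - G) G)
  have h3 : ‖B F (F - G) + B (F - G) G‖ ≤ ‖B‖ * R * ‖F - G‖ + ‖B‖ * ‖F - G‖ * R := by
    refine (norm_add_le _ _).trans (add_le_add ?_ ?_)
    · exact (B.le_opNorm₂ _ _).trans (by gcongr)
    · exact (B.le_opNorm₂ _ _).trans (by gcongr)
  have h4 := mul_le_mul_of_nonneg_left h3 (norm_nonneg A')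
  linarith

/-- Solutions of the Galerkin systems exist on a time interval which depends only on the `H^s`
norm of the data, and satisfy a uniform `H^s` bound there. -/
theorem exists_galerkin_solution (hQ : IsFullySymmetric Q) (hs : 3 / 2 < s) (δ n : ℝ)
    {F₀ : L2 d} (hF₀ : IsHerm F₀) {T : ℝ} (hT0 : 0 ≤ T)
    (hT : 2 * energyConst Q s * (1 + ‖F₀‖ ^ 2) * T ≤ 1) :
    ∃ F : ℝ → L2 d, F 0 = mulL (fun ξ => (ind n ξ : ℂ)) F₀ ∧ ∀ t ∈ Set.Icc 0 T,
      IsHerm (F t) ∧ mulL (fun ξ => (ind n ξ : ℂ)) (F t) = F t ∧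
      1 + ‖F t‖ ^ 2 ≤ 2 * (1 + ‖F₀‖ ^ 2) ∧
      HasDerivWithinAt F (galerkin Q δ s n (F t)) (Set.Icc 0 T) t := by
  have hi := bddMeas_ind n
  set R : ℝ := √(2 * (1 + ‖F₀‖ ^ 2)) with hRdef
  have hR : 0 < R := Real.sqrt_pos.2 (by positivity)
  -- the projection onto real, band-limited functions, which every solution has to respect
  let P : L2 d →L[ℝ] L2 d := hermProj d ∘L (mulL (fun ξ => (ind n ξ : ℂ))).restrictScalars ℝ
  have hP : ∀ F : L2 d, IsHerm F → mulL (fun ξ => (ind n ξ : ℂ)) F = F → P F = F :=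
    fun F h1 h2 => by
      change hermProj d (mulL (fun ξ => (ind n ξ : ℂ)) F) = F
      rw [h2, hermProj_of_isHerm h1]
  have hPh : ∀ F : L2 d, IsHerm (P F) := fun F => isHerm_hermProj _
  have hPi : ∀ F : L2 d, mulL (fun ξ => (ind n ξ : ℂ)) (P F) = P F := fun F => by
    change mulL (fun ξ => (ind n ξ : ℂ)) ((1 / 2 : ℝ) • (mulL _ F + refl d (mulL _ F))) =
      (1 / 2 : ℝ) • (mulL _ F + refl d (mulL _ F))
    have e : ∀ ξ, (ind n ξ : ℂ) * ind n ξ = ind n ξ := fun ξ => by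
      rw [← Complex.ofReal_mul, ind_mul_self]
    rw [refl_mulL hi (fun ξ => by simp [ind_even]), ContinuousLinearMap.map_smul_of_tower, map_add,
      mulL_mulL hi hi, mulL_mulL hi hi]
    simp only [e]
  obtain ⟨L, hL⟩ := exists_norm_galerkin_sub_le Q δ s n hR.le
  -- a bounded, globally Lipschitz vector field, equal to the Galerkin one on the ball of radius `R`
  let G : L2 d → L2 d := fun F => galerkin Q δ s n (radial R (P F))
  have hG : LipschitzWith (L * (2 * ‖P‖₊)) G := by
    have h1 := (lipschitzWith_radial (E := L2 d) hR).comp P.lipschitz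
    refine LipschitzWith.of_dist_le_mul fun x y => ?_
    have h2 := h1.dist_le_mul x y
    rw [dist_eq_norm] at h2 ⊢
    refine (hL _ _ (norm_radial_le hR _) (norm_radial_le hR _)).trans ?_
    rw [NNReal.coe_mul, mul_assoc]
    exact mul_le_mul_of_nonneg_left h2 L.2
  have hGB : ∀ F, ‖G F‖ ≤ L * R := fun F => by
    have h0 : galerkin Q δ s n (0 : L2 d) = 0 := by simp [galerkin]
    have h1 := hL (radial R (P F)) 0 (norm_radial_le hR _) (by simpa using hR.le)
    rw [h0, sub_zero, sub_zero] at h1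
    exact h1.trans (mul_le_mul_of_nonneg_left (norm_radial_le hR _) L.2)
  have hrad : ∀ F : L2 d, ∃ c : ℝ, 0 < c ∧ c ≤ 1 ∧ radial R F = c • F := fun F =>
    ⟨_, inv_pos.2 (lt_max_of_lt_left one_pos), inv_le_one_of_one_le₀ (le_max_left _ _), rfl⟩
  have hradh : ∀ F : L2 d, IsHerm F → IsHerm (radial R F) := fun F h => by
    unfold IsHerm radial
    rw [map_smul, h]
  have hradi : ∀ F : L2 d, mulL (fun ξ => (ind n ξ : ℂ)) F = F →
      mulL (fun ξ => (ind n ξ : ℂ)) (radial R F) = radial R F := fun F h => by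
    unfold radial
    rw [ContinuousLinearMap.map_smul_of_tower, h]
  obtain ⟨F, hF0, hF⟩ := exists_solution_of_lipschitz hG hGB
    (mulL (fun ξ => (ind n ξ : ℂ)) F₀) hT0
  have hPG : ∀ x, P (G x) = G x := fun x =>
    hP _ (isHerm_galerkin hs δ n (hradh _ (hPh x))) (mulL_ind_galerkin δ n _)
  have hPF : ∀ t ∈ Set.Icc 0 T, P (F t) = F t := by
    have hd : ∀ t ∈ Set.Icc 0 T, HasDerivWithinAt (fun t => P (F t) - F t) 0 (Set.Icc 0 T) t :=
      fun t ht => by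
        have h1 := (P.hasFDerivAt.comp_hasDerivWithinAt t (hF t ht)).sub (hF t ht)
        rwa [hPG, sub_self] at h1
    intro t ht
    have h1 := (convex_Icc 0 T).norm_image_sub_le_of_norm_hasDerivWithin_le (C := 0) hd
      (fun x hx => by simp) ⟨le_rfl, hT0⟩ ht
    have h2 : P (F 0) - F 0 = 0 := by
      rw [hF0, sub_eq_zero]
      refine hP _ (hF₀.mulL hi fun ξ => by simp [ind_even]) ?_
      rw [mulL_mulL hi hi]
      refine mulL_congr (fun ξ => ?_) F₀
      rw [← Complex.ofReal_mul, ind_mul_self]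
    rw [h2, sub_zero, zero_mul] at h1
    exact sub_eq_zero.1 (norm_le_zero_iff.1 h1)
  have hherm : ∀ t ∈ Set.Icc 0 T, IsHerm (F t) := fun t ht => by
    rw [← hPF t ht]
    exact hPh _
  have hband : ∀ t ∈ Set.Icc 0 T, mulL (fun ξ => (ind n ξ : ℂ)) (F t) = F t := fun t ht => by
    rw [← hPF t ht]
    exact hPi _
  -- the energy estimate survives the radial truncation of the vector field
  have hen : ∀ t ∈ Set.Icc 0 T, 2 * (inner ℂ (F t) (G (F t))).re ≤
      energyConst Q s * (1 + ‖F t‖ ^ 2) ^ 2 := fun t ht => by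
    have hC := energyConst_nonneg (Q := Q) (s := s) (by linarith)
    obtain ⟨c, hc0, hc1, hc⟩ := hrad (F t)
    have hGt : G (F t) = galerkin Q δ s n (radial R (F t)) := by
      change galerkin Q δ s n (radial R (P (F t))) = _
      rw [hPF t ht]
    -- for this `k` the truncation of the weight is not felt in the band `|ξ| ≤ n`
    set k : ℝ := max 1 (jb 1 n) with hk
    have hone : ∀ X : L2 d, mulL (fun ξ => (ind n ξ : ℂ)) X = X → mulL (rho s k) X = X :=
      fun X hX => by
        have hr := bddMeas_rho (s := s) (by linarith) (le_max_left 1 (jb 1 n))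
        conv_lhs => rw [← hX]
        conv_rhs => rw [← hX]
        rw [mulL_mulL hr hi]
        refine mulL_congr (fun ξ => ?_) X
        by_cases h : |ξ| ≤ n
        · rw [rho_eq_one, one_mul]
          exact (jb_one_le_of_abs_le (h.trans (le_abs_self n))).trans (le_max_right _ _)
        · simp [ind, h]
    have h1 := abs_re_inner_galerkin_le hQ hs δ n (le_max_left 1 (jb 1 n))
      (hradh _ (hherm t ht)) (hradi _ (hband t ht))
    rw [hone _ (hradi _ (hband t ht)), hone _ (mulL_ind_galerkin δ n _)] at h1
    have h2 := (le_abs_self _).trans h1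
    rw [← hGt, hc] at h2
    have h3 : (inner ℂ (c • F t) (G (F t))).re = c * (inner ℂ (F t) (G (F t))).re := by
      rw [inner_smul_left_eq_smul, Complex.smul_re, smul_eq_mul]
    rw [h3, norm_smul, Real.norm_of_nonneg hc0.le] at h2
    have h4 : 2 * (inner ℂ (F t) (G (F t))).re ≤ c ^ 2 * (energyConst Q s * ‖F t‖ ^ 3) := by
      refine le_of_mul_le_mul_left ?_ hc0
      linarith
    have h5 : c ^ 2 * (energyConst Q s * ‖F t‖ ^ 3) ≤ 1 * (energyConst Q s * ‖F t‖ ^ 3) := by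
      gcongr
      exact pow_le_one₀ hc0.le hc1
    have h6 : ‖F t‖ ^ 3 ≤ (1 + ‖F t‖ ^ 2) ^ 2 := by
      have := norm_nonneg (F t)
      nlinarith [sq_nonneg (‖F t‖ - 1), sq_nonneg (‖F t‖ ^ 2 - ‖F t‖)]
    have h7 := mul_le_mul_of_nonneg_left h6 hC
    linarith
  have hbound : ∀ t ∈ Set.Icc 0 T, 1 + ‖F t‖ ^ 2 ≤ 2 * (1 + ‖F₀‖ ^ 2) := fun t ht => by
    refine one_add_le_of_deriv_le (y := fun t => ‖F t‖ ^ 2)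
      (fun t ht => hasDerivWithinAt_norm_sq (hF t ht)) (fun t => by positivity)
      (energyConst_nonneg (Q := Q) (s := s) (by linarith)) hen ?_ hT ht
    simp only [hF0]
    have h1 := norm_mulL_le hi (C := 1) (fun ξ => by
      rw [Complex.norm_real, Real.norm_of_nonneg (ind_nonneg n ξ)]
      exact ind_le_one n ξ) F₀
    rw [one_mul] at h1
    gcongr
  refine ⟨F, hF0, fun t ht => ⟨hherm t ht, hband t ht, hbound t ht, ?_⟩⟩
  have h1 := hF t ht
  have h2 : ‖F t‖ ≤ R := by
    rw [hRdef]
    exact Real.le_sqrt_of_sq_le (by linarith [hbound t ht])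
  have h3 : G (F t) = galerkin Q δ s n (F t) := by
    change galerkin Q δ s n (radial R (P (F t))) = _
    rw [hPF t ht, radial_of_norm_le hR h2]
  rwa [h3] at h1

end Galerkin

/-! ### Approximate solutions and their stability -/

section Approx

variable {d : ℕ} {Q : RVec d →ₗ[ℝ] RVec d →ₗ[ℝ] RVec d} {s : ℝ}

theorem norm_ind_mul_jb_le (n ξ : ℝ) {a : ℝ} (ha : a ≤ 0) : ‖(ind n ξ : ℂ) * jb a ξ‖ ≤ 1 := by
  have h1 := jb_pos a ξ
  have h2 := ind_nonneg n ξ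
  rw [← Complex.ofReal_mul, Complex.norm_real, Real.norm_of_nonneg (by positivity)]
  exact mul_le_one₀ (ind_le_one n ξ) h1.le (jb_le_one ha ξ)

theorem norm_ind_le (n ξ : ℝ) : ‖(ind n ξ : ℂ)‖ ≤ 1 := by
  rw [Complex.norm_real, Real.norm_of_nonneg (ind_nonneg n ξ)]
  exact ind_le_one n ξ

theorem norm_mulL_ind_le (n : ℝ) (F : L2 d) : ‖mulL (fun ξ => (ind n ξ : ℂ)) F‖ ≤ ‖F‖ := by
  simpa using norm_mulL_le (bddMeas_ind n) (norm_ind_le n) F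

/-- The part of `û` in the band `|ξ| ≤ n`, in terms of `F = ⟨ξ⟩^s û`. -/
def low (s n : ℝ) (F : L2 d) : L2 d := mulL (fun ξ => (ind n ξ : ℂ) * jb (-s) ξ) F

/-- The part in the band `|ξ| ≤ n` of the Fourier transform of `δ ∂_x³ u - ∂_x Q(u, u)`, in terms of
`F = ⟨ξ⟩^s û`. -/
def lowRhs (Q : RVec d →ₗ[ℝ] RVec d →ₗ[ℝ] RVec d) (δ s n : ℝ) (F : L2 d) : L2 d :=
  mulL (fun ξ => (ind n ξ : ℂ) * (disp δ ξ * jb (-s) ξ)) F -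
    mulL (fun ξ => (ind n ξ : ℂ)) (bil Q (kern s) F F)

/-- The equation `∂_t u = δ ∂_x³ u - ∂_x Q(u, u)` holds in the frequency band `|ξ| ≤ n`. Exact
solutions satisfy this for all `n`, and Galerkin approximations on the band `|ξ| ≤ N` for all
`n ≤ N`. -/
def ApproxSol (Q : RVec d →ₗ[ℝ] RVec d →ₗ[ℝ] RVec d) (δ s T n : ℝ) (F : ℝ → L2 d) : Prop :=
  ∀ t ∈ Set.Icc 0 T,
    HasDerivWithinAt (fun t => low s n (F t)) (lowRhs Q δ s n (F t)) (Set.Icc 0 T) t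

theorem bddMeas_ind_disp_jb (n δ a : ℝ) :
    BddMeas fun ξ => (ind n ξ : ℂ) * (disp δ ξ * jb a ξ) :=
  bddMeas_ind_mul n ((continuous_disp δ).mul
    (Complex.continuous_ofReal.comp (continuous_jb a)))

theorem low_sub (n : ℝ) (F G : L2 d) : low s n (F - G) = low s n F - low s n G := map_sub _ _ _

theorem norm_low_le (hs : 0 ≤ s) (n : ℝ) (F : L2 d) : ‖low s n F‖ ≤ ‖F‖ := by
  simpa [low] using norm_mulL_le (bddMeas_ind_jb n (-s))
    (fun ξ => norm_ind_mul_jb_le n ξ (by linarith)) F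

theorem approxSol_of_galerkin {δ T n m : ℝ} (h : m ≤ n) {F : ℝ → L2 d}
    (hF : ∀ t ∈ Set.Icc 0 T, HasDerivWithinAt F (galerkin Q δ s n (F t)) (Set.Icc 0 T) t) :
    ApproxSol Q δ s T m F := by
  intro t ht
  have h1 := hasDerivWithinAt_mulL (fun ξ => (ind m ξ : ℂ) * jb (-s) ξ) (hF t ht)
  refine h1.congr_deriv ?_
  rw [galerkin, map_sub, mulL_mulL (bddMeas_ind_jb m (-s)) (bddMeas_ind_disp n δ),
    mulL_mulL (bddMeas_ind_jb m (-s)) (bddMeas_ind_jb n s), lowRhs]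
  have e : ∀ ξ, (ind m ξ : ℂ) * ind n ξ = ind m ξ := fun ξ => by
    rw [← Complex.ofReal_mul, ind_mul_ind h]
  have e' : ∀ ξ, (jb (-s) ξ : ℂ) * jb s ξ = 1 := fun ξ => by
    rw [← Complex.ofReal_mul, jb_neg_mul, Complex.ofReal_one]
  congr 1
  · refine mulL_congr (fun ξ => ?_) _
    linear_combination (jb (-s) ξ * disp δ ξ) * e ξ
  · refine mulL_congr (fun ξ => ?_) _
    linear_combination (jb (-s) ξ * jb s ξ : ℂ) * e ξ + (ind m ξ : ℂ) * e' ξ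

/-- The `L²` estimate for the difference of two approximate solutions. -/
theorem re_inner_low_le (hQ : IsFullySymmetric Q) (hs : 3 / 2 < s) (δ : ℝ) {n M : ℝ} (hn : 0 ≤ n)
    {F G : L2 d} (hF : IsHerm F) (hG : IsHerm G) (hFM : ‖F‖ ≤ M) (hGM : ‖G‖ ≤ M) :
    2 * (inner ℂ (low s n F - low s n G) (lowRhs Q δ s n F - lowRhs Q δ s n G)).re ≤
      4 * Real.pi * formConst Q (s - 1) * M * ‖low s n F - low s n G‖ ^ 2 +
        64 * Real.pi * formConst Q (s - 1) * M ^ 3 * jb (1 - s) n := by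
  have hM : 0 ≤ M := (norm_nonneg _).trans hFM
  have hc := formConst_nonneg Q (s - 1)
  have hj := jb_pos (1 - s) n
  have hi := bddMeas_ind n
  have hl := bddMeas_ind_jb n (-s)
  have hp := bddMeas_ind_disp_jb n δ (-s)
  set V := F - G with hV
  set A := F + G with hA
  have hVh : IsHerm V := hF.sub hG
  have hVM : ‖V‖ ≤ 2 * M := (norm_sub_le _ _).trans (by linarith)
  have hAM : ‖A‖ ≤ 2 * M := (norm_add_le _ _).trans (by linarith)
  rw [← low_sub]
  set z := low s n V with hz
  have hzM : ‖z‖ ≤ 2 * M := (norm_low_le (by linarith) n V).trans hVM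
  have e1 : lowRhs Q δ s n F - lowRhs Q δ s n G =
      mulL (fun ξ => (ind n ξ : ℂ) * (disp δ ξ * jb (-s) ξ)) V -
        mulL (fun ξ => (ind n ξ : ℂ)) (bil Q (kern s) A V) := by
    rw [hV, hA, ← bil_sub_bil hQ (adm_kern hs) (kern_comm s), lowRhs, lowRhs, map_sub, map_sub]
    abel
  have e2 : (inner ℂ z (mulL (fun ξ => (ind n ξ : ℂ) * (disp δ ξ * jb (-s) ξ)) V)).re = 0 := by
    refine re_inner_mulL_eq_zero hl hp (fun ξ => ?_) V
    have : (starRingEnd ℂ) ((ind n ξ : ℂ) * jb (-s) ξ) * (ind n ξ * (disp δ ξ * jb (-s) ξ)) =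
        ((ind n ξ * jb (-s) ξ * (ind n ξ * jb (-s) ξ) : ℝ) : ℂ) * disp δ ξ := by
      rw [map_mul, Complex.conj_ofReal, Complex.conj_ofReal]
      push_cast
      ring
    rw [this, Complex.re_ofReal_mul, disp_re, mul_zero]
  have hzi : mulL (fun ξ => (ind n ξ : ℂ)) z = z := by
    rw [hz, low, mulL_mulL hi hl]
    refine mulL_congr (fun ξ => ?_) V
    rw [← mul_assoc, ← Complex.ofReal_mul (ind n ξ) (ind n ξ), ind_mul_self]
  -- splitting the difference into low and high frequencies
  have hsplit : V = mulL (fun ξ => (ind n ξ : ℂ)) V + mulL (fun ξ => ((1 - ind n ξ : ℝ) : ℂ)) V := by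
    apply Lp.ext
    filter_upwards [coeFn_mulL hi V, coeFn_mulL (bddMeas_one_sub_ind n) V,
      Lp.coeFn_add (mulL (fun ξ => (ind n ξ : ℂ)) V)
        (mulL (fun ξ => ((1 - ind n ξ : ℝ) : ℂ)) V)] with ξ h1 h2 h3
    rw [h3, Pi.add_apply, h1, h2, ← add_smul]
    simp
  have e3 : (inner ℂ z (mulL (fun ξ => (ind n ξ : ℂ)) (bil Q (kern s) A V))).re =
      (inner ℂ (bil Q (kern s) A (mulL (fun ξ => (ind n ξ : ℂ)) V)) z).re +
      (inner ℂ (bil Q (kern s) A (mulL (fun ξ => ((1 - ind n ξ : ℝ) : ℂ)) V)) z).re := by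
    rw [← inner_conj_symm, Complex.conj_re, inner_mulL hi]
    simp only [Complex.conj_ofReal]
    rw [hzi, ← Complex.add_re, ← inner_add_left, ← map_add, ← hsplit]
  have h1 : 2 * ‖inner ℂ (bil Q (kern s) A (mulL (fun ξ => (ind n ξ : ℂ)) V)) z‖ ≤
      2 * Real.pi * formConst Q (s - 1) * ‖A‖ * ‖z‖ ^ 2 :=
    norm_inner_bil_low_le hQ hs n A hVh
  have h2 := norm_bil_high_le (Q := Q) hs hn A V
  have h3 := (abs_le.1 (Complex.abs_re_le_norm
    (inner ℂ (bil Q (kern s) A (mulL (fun ξ => (ind n ξ : ℂ)) V)) z))).1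
  have h4 := (abs_le.1 (Complex.abs_re_le_norm
    (inner ℂ (bil Q (kern s) A (mulL (fun ξ => ((1 - ind n ξ : ℝ) : ℂ)) V)) z))).1
  have h5 : ‖inner ℂ (bil Q (kern s) A (mulL (fun ξ => ((1 - ind n ξ : ℝ) : ℂ)) V)) z‖ ≤
      (4 * Real.pi * jb (1 - s) n * formConst Q (s - 1) * (2 * M) * (2 * M)) * (2 * M) := by
    refine (norm_inner_le_norm _ _).trans ?_
    have h6 : ‖bil Q (kern s) A (mulL (fun ξ => ((1 - ind n ξ : ℝ) : ℂ)) V)‖ ≤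
        4 * Real.pi * jb (1 - s) n * formConst Q (s - 1) * (2 * M) * (2 * M) :=
      h2.trans (by gcongr)
    gcongr
  have h7 : 2 * Real.pi * formConst Q (s - 1) * ‖A‖ * ‖z‖ ^ 2 ≤
      2 * Real.pi * formConst Q (s - 1) * (2 * M) * ‖z‖ ^ 2 := by gcongr
  rw [e1, inner_sub_right, Complex.sub_re, e2, e3]
  linarith

/-- Stability: two approximate solutions on the band `|ξ| ≤ n` stay close in `L²`. -/
theorem norm_low_sub_sq_le (hQ : IsFullySymmetric Q) (hs : 3 / 2 < s) {δ T n M : ℝ} (hn : 0 ≤ n)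
    {F G : ℝ → L2 d} (hF : ∀ t ∈ Set.Icc 0 T, IsHerm (F t) ∧ ‖F t‖ ≤ M)
    (hG : ∀ t ∈ Set.Icc 0 T, IsHerm (G t) ∧ ‖G t‖ ≤ M)
    (hFs : ApproxSol Q δ s T n F) (hGs : ApproxSol Q δ s T n G) {t : ℝ} (ht : t ∈ Set.Icc 0 T) :
    ‖low s n (F t) - low s n (G t)‖ ^ 2 ≤ (‖low s n (F 0) - low s n (G 0)‖ ^ 2 +
      64 * Real.pi * formConst Q (s - 1) * M ^ 3 * jb (1 - s) n * T) *
        Real.exp (4 * Real.pi * formConst Q (s - 1) * M * T) := by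
  have hM : 0 ≤ M := (norm_nonneg _).trans (hF t ht).2
  have hc := formConst_nonneg Q (s - 1)
  have hj := jb_pos (1 - s) n
  exact le_of_deriv_le_mul_add (y := fun t => ‖low s n (F t) - low s n (G t)‖ ^ 2)
    (fun t ht => hasDerivWithinAt_norm_sq ((hFs t ht).fun_sub (hGs t ht)))
    (by positivity) (by positivity) (by positivity)
    (fun t ht => re_inner_low_le hQ hs δ hn (hF t ht).1 (hG t ht).1 (hF t ht).2 (hG t ht).2) ht

theorem tendsto_jb_nat {a : ℝ} (ha : a < 0) : Tendsto (fun n : ℕ => jb a n) atTop (𝓝 0) := by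
  have h1 : Tendsto (fun n : ℕ => jb 1 (n : ℝ)) atTop atTop :=
    tendsto_atTop_mono (fun n => (le_abs_self _).trans (abs_le_jb_one _))
      tendsto_natCast_atTop_atTop
  have h2 := (tendsto_rpow_neg_atTop (y := -a) (by linarith)).comp h1
  refine h2.congr fun n => ?_
  rw [Function.comp_apply, neg_neg, ← jb_eq_rpow]

theorem mulL_jb_injective {a : ℝ} (ha : a ≤ 0) {F G : L2 d}
    (h : mulL (fun ξ => (jb a ξ : ℂ)) F = mulL (fun ξ => (jb a ξ : ℂ)) G) : F = G := by
  apply Lp.ext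
  have h1 := coeFn_mulL (bddMeas_jb ha) F
  rw [h] at h1
  filter_upwards [h1, coeFn_mulL (bddMeas_jb ha) G] with ξ h1 h2
  have h3 : (jb a ξ : ℂ) ≠ 0 := by exact_mod_cast (jb_pos a ξ).ne'
  exact smul_right_injective _ h3 (h1.symm.trans h2)

/-- Uniqueness of exact solutions, in the class of bounded functions with values in `H^s`. -/
theorem eq_of_approxSol (hQ : IsFullySymmetric Q) (hs : 3 / 2 < s) {δ T M : ℝ}
    {F G : ℝ → L2 d} (hF : ∀ t ∈ Set.Icc 0 T, IsHerm (F t) ∧ ‖F t‖ ≤ M)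
    (hG : ∀ t ∈ Set.Icc 0 T, IsHerm (G t) ∧ ‖G t‖ ≤ M)
    (hFs : ∀ n : ℕ, ApproxSol Q δ s T n F) (hGs : ∀ n : ℕ, ApproxSol Q δ s T n G)
    (h0 : F 0 = G 0) {t : ℝ} (ht : t ∈ Set.Icc 0 T) : F t = G t := by
  have hlim : Tendsto (fun n : ℕ => (0 + 64 * Real.pi * formConst Q (s - 1) * M ^ 3 *
      jb (1 - s) n * T) * Real.exp (4 * Real.pi * formConst Q (s - 1) * M * T)) atTop (𝓝 0) := by
    have h1 := (((tendsto_jb_nat (a := 1 - s) (by linarith)).const_mul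
      (64 * Real.pi * formConst Q (s - 1) * M ^ 3)).mul_const T).const_add 0 |>.mul_const
      (Real.exp (4 * Real.pi * formConst Q (s - 1) * M * T))
    simpa using h1
  have hle := fun n : ℕ =>
    norm_low_sub_sq_le hQ hs (Nat.cast_nonneg n) hF hG (hFs n) (hGs n) ht
  refine mulL_jb_injective (a := -s) (by linarith) (eq_of_forall_ind fun n => ?_)
  rw [mulL_mulL (bddMeas_ind _) (bddMeas_jb (by linarith)),
    mulL_mulL (bddMeas_ind _) (bddMeas_jb (by linarith))]
  change low s n (F t) = low s n (G t)
  have h2 : ‖low s n (F t) - low s n (G t)‖ ^ 2 ≤ 0 := by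
    refine ge_of_tendsto hlim ?_
    filter_upwards [eventually_ge_atTop n] with m hm
    have h3 := hle m
    rw [h0, sub_self, norm_zero, zero_pow two_ne_zero] at h3
    refine le_trans ?_ h3
    have hm' : (n : ℝ) ≤ m := by exact_mod_cast hm
    rw [← low_sub, ← low_sub]
    have h4 : ‖low s n (F t - G t)‖ ≤ ‖low s m (F t - G t)‖ := by
      refine norm_mulL_le_of_le (bddMeas_ind_jb _ _) (bddMeas_ind_jb _ _) (fun ξ => ?_) _
      rw [norm_mul, norm_mul]
      gcongr
      rw [Complex.norm_real, Complex.norm_real, Real.norm_of_nonneg (ind_nonneg _ _),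
        Real.norm_of_nonneg (ind_nonneg _ _)]
      exact ind_mono hm' ξ
    gcongr
  have h5 : ‖low s n (F t) - low s n (G t)‖ = 0 := by
    have := norm_nonneg (low s n (F t) - low s n (G t))
    nlinarith
  exact sub_eq_zero.1 (norm_eq_zero.1 h5)

/-! ### Passage to the limit -/

/-- A uniform limit of derivatives is the derivative of the limit, on an interval. -/
theorem hasDerivWithinAt_of_uniform_limit {E : Type*} [NormedAddCommGroup E] [NormedSpace ℝ E]
    {T : ℝ} {y : ℕ → ℝ → E} {y' : ℕ → ℝ → E} {Y Y' : ℝ → E} {b : ℕ → ℝ}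
    (hb : Tendsto b atTop (𝓝 0))
    (hy : ∀ m, ∀ t ∈ Set.Icc 0 T, HasDerivWithinAt (y m) (y' m t) (Set.Icc 0 T) t)
    (hY : ∀ t ∈ Set.Icc 0 T, Tendsto (fun m => y m t) atTop (𝓝 (Y t)))
    (hY' : ∀ m, ∀ t ∈ Set.Icc 0 T, ‖y' m t - Y' t‖ ≤ b m) {t : ℝ} (ht : t ∈ Set.Icc 0 T) :
    HasDerivWithinAt Y (Y' t) (Set.Icc 0 T) t := by
  have h1 : ∀ m, ∀ x ∈ Set.Icc 0 T, ‖(y m x - Y x) - (y m t - Y t)‖ ≤ b m * ‖x - t‖ := by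
    intro m x hx
    have h2 : ∀ l, ‖(y m x - y l x) - (y m t - y l t)‖ ≤ (b m + b l) * ‖x - t‖ := fun l => by
      refine (convex_Icc 0 T).norm_image_sub_le_of_norm_hasDerivWithin_le
        (f := fun x => y m x - y l x) (f' := fun x => y' m x - y' l x)
        (fun z hz => (hy m z hz).fun_sub (hy l z hz)) (fun z hz => ?_) ht hx
      have e : y' m z - y' l z = (y' m z - Y' z) - (y' l z - Y' z) := by abel
      rw [e]
      exact (norm_sub_le _ _).trans (add_le_add (hY' m z hz) (hY' l z hz))
    have h3 : Tendsto (fun l => ‖(y m x - y l x) - (y m t - y l t)‖) atTop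
        (𝓝 ‖(y m x - Y x) - (y m t - Y t)‖) :=
      ((tendsto_const_nhds.sub (hY x hx)).sub (tendsto_const_nhds.sub (hY t ht))).norm
    have h4 : Tendsto (fun l => (b m + b l) * ‖x - t‖) atTop (𝓝 (b m * ‖x - t‖)) := by
      simpa using (hb.const_add (b m)).mul_const ‖x - t‖
    exact le_of_tendsto_of_tendsto' h3 h4 h2
  rw [hasDerivWithinAt_iff_isLittleO, Asymptotics.isLittleO_iff]
  intro c hc
  obtain ⟨m, hm⟩ := (hb.eventually (gt_mem_nhds (show (0 : ℝ) < c / 3 by positivity))).exists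
  have h5 := Asymptotics.isLittleO_iff.1 (hasDerivWithinAt_iff_isLittleO.1 (hy m t ht))
    (show (0 : ℝ) < c / 3 by positivity)
  filter_upwards [h5, self_mem_nhdsWithin] with x hx hxT
  have h6 := h1 m x hxT
  have h7 : ‖(x - t) • (y' m t - Y' t)‖ ≤ b m * ‖x - t‖ := by
    rw [norm_smul, mul_comm]
    gcongr
    exact hY' m t ht
  have e : Y x - Y t - (x - t) • Y' t = (y m x - y m t - (x - t) • y' m t) -
      ((y m x - Y x) - (y m t - Y t)) + (x - t) • (y' m t - Y' t) := by
    rw [smul_sub]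
    abel
  rw [e]
  refine (norm_add_le _ _).trans ((add_le_add_left (norm_sub_le _ _) _).trans ?_)
  have h8 : b m * ‖x - t‖ ≤ c / 3 * ‖x - t‖ := by gcongr
  linarith

theorem norm_sub_mulL_ind_sq (n : ℝ) (F : L2 d) :
    ‖F - mulL (fun ξ => (ind n ξ : ℂ)) F‖ ^ 2 =
      ‖F‖ ^ 2 - ‖mulL (fun ξ => (ind n ξ : ℂ)) F‖ ^ 2 := by
  have hi := bddMeas_ind n
  have e : inner ℂ (mulL (fun ξ => (ind n ξ : ℂ)) F) (mulL (fun ξ => (ind n ξ : ℂ)) F) =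
      inner ℂ F (mulL (fun ξ => (ind n ξ : ℂ)) F) := by
    rw [inner_mulL hi, mulL_mulL hi.conj hi]
    congr 1
    refine mulL_congr (fun ξ => ?_) F
    rw [Complex.conj_ofReal, ← Complex.ofReal_mul, ind_mul_self]
  have h1 := norm_sub_sq (𝕜 := ℂ) F (mulL (fun ξ => (ind n ξ : ℂ)) F)
  have h2 := inner_self_eq_norm_sq (𝕜 := ℂ) (mulL (fun ξ => (ind n ξ : ℂ)) F)
  rw [e] at h2
  rw [h2] at h1
  rw [h1]
  ring

theorem tendsto_norm_mulL_ind_sq (F : L2 d) :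
    Tendsto (fun n : ℕ => ‖mulL (fun ξ => (ind n ξ : ℂ)) F‖ ^ 2) atTop (𝓝 (‖F‖ ^ 2)) := by
  have e : ∀ G : L2 d, ‖G‖ ^ 2 = ∫ ξ, ‖G ξ‖ ^ 2 := fun G => by
    have h1 := inner_self_eq_norm_sq (𝕜 := ℂ) G
    have h2 : ∫ ξ, inner ℂ (G ξ) (G ξ) = ((∫ ξ, ‖G ξ‖ ^ 2 : ℝ) : ℂ) := by
      rw [← integral_complex_ofReal]
      refine integral_congr_ae (.of_forall fun ξ => ?_)
      simp only [inner_self_eq_norm_sq_to_K]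
      push_cast
      rfl
    rw [L2.inner_def, h2] at h1
    exact h1.symm
  have e2 : ∀ n : ℕ, ‖mulL (fun ξ => (ind n ξ : ℂ)) F‖ ^ 2 = ∫ ξ, ind n ξ * ‖F ξ‖ ^ 2 :=
    fun n => by
      rw [e]
      apply integral_congr_ae
      filter_upwards [coeFn_mulL (bddMeas_ind n) F] with ξ h
      rw [h, norm_smul, mul_pow, Complex.norm_real, Real.norm_of_nonneg (ind_nonneg _ _), sq,
        ind_mul_self]
  simp only [e2]
  rw [e]
  have hint : Integrable (fun ξ => ‖F ξ‖ ^ 2) volume := (Lp.memLp F).integrable_norm_pow two_ne_zero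
  refine tendsto_integral_of_dominated_convergence (fun ξ => ‖F ξ‖ ^ 2) (fun n => ?_) hint
    (fun n => .of_forall fun ξ => ?_) (.of_forall fun ξ => ?_)
  · exact (measurable_ind n).aestronglyMeasurable.mul hint.1
  · rw [norm_mul, Real.norm_of_nonneg (ind_nonneg _ _), Real.norm_of_nonneg (by positivity)]
    exact mul_le_of_le_one_left (by positivity) (ind_le_one _ _)
  · refine tendsto_const_nhds.congr' ?_
    obtain ⟨N, hN⟩ := exists_nat_ge |ξ|
    filter_upwards [eventually_ge_atTop N] with n hn
    have : |ξ| ≤ n := hN.trans (by exact_mod_cast hn)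
    simp [ind, this]

/-- A bounded sequence in `H^s` which converges in `L²` has its limit in `H^s`. -/
theorem exists_of_tendsto (hs : 0 ≤ s) {R : ℝ} {F : ℕ → L2 d} (hF : ∀ n, ‖F n‖ ≤ R) {f : L2 d}
    (hf : Tendsto (fun n => mulL (fun ξ => (jb (-s) ξ : ℂ)) (F n)) atTop (𝓝 f)) :
    ∃ G : L2 d, ‖G‖ ≤ R ∧ mulL (fun ξ => (jb (-s) ξ : ℂ)) G = f := by
  have hR : 0 ≤ R := (norm_nonneg _).trans (hF 0)
  let g : ℝ → CVec d := fun ξ => (jb s ξ : ℂ) • f ξ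
  have hgm : AEStronglyMeasurable g volume :=
    (Complex.measurable_ofReal.comp (measurable_jb s)).aestronglyMeasurable.smul
      (Lp.aestronglyMeasurable f)
  have hN : ∀ N : ℕ, ‖mulL (fun ξ => (ind N ξ : ℂ) * jb s ξ) f‖ ≤ R := fun N => by
    have h1 := ((mulL (fun ξ => (ind N ξ : ℂ) * jb s ξ) : L2 d →L[ℂ] L2 d).continuous.tendsto
      f).comp hf
    refine le_of_tendsto h1.norm (.of_forall fun n => ?_)
    have e : mulL (fun ξ => (ind N ξ : ℂ) * jb s ξ) (mulL (fun ξ => (jb (-s) ξ : ℂ)) (F n)) =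
        mulL (fun ξ => (ind N ξ : ℂ)) (F n) := by
      rw [mulL_mulL (bddMeas_ind_jb _ _) (bddMeas_jb (by linarith))]
      refine mulL_congr (fun ξ => ?_) _
      rw [mul_assoc, ← Complex.ofReal_mul (jb s ξ), jb_mul_neg, Complex.ofReal_one, mul_one]
    rw [Function.comp_apply, e]
    exact (norm_mulL_ind_le _ _).trans (hF n)
  have hle : eLpNorm g 2 volume ≤ ENNReal.ofReal R := by
    have h1 := Lp.eLpNorm_lim_le_liminf_eLpNorm (p := 2) (μ := volume)
      (f := fun N : ℕ => (mulL (fun ξ => (ind N ξ : ℂ) * jb s ξ) f : L2 d))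
      (fun N => Lp.aestronglyMeasurable _) g (by
        have h2 : ∀ᵐ ξ, ∀ N : ℕ, mulL (fun ξ => (ind N ξ : ℂ) * jb s ξ) f ξ =
            ((ind N ξ : ℂ) * jb s ξ) • f ξ := by
          rw [ae_all_iff]
          exact fun N => coeFn_mulL (bddMeas_ind_jb _ _) f
        filter_upwards [h2] with ξ h2
        refine tendsto_const_nhds.congr' ?_
        obtain ⟨N, hN⟩ := exists_nat_ge |ξ|
        filter_upwards [eventually_ge_atTop N] with n hn
        have : |ξ| ≤ n := hN.trans (by exact_mod_cast hn)
        rw [h2]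
        simp [ind, this, g])
    refine h1.trans (liminf_le_of_le (by isBoundedDefault) fun b hb => ?_)
    obtain ⟨N, hb⟩ := hb.exists
    refine hb.trans ?_
    have h3 := hN N
    rw [Lp.norm_def] at h3
    exact (ENNReal.le_ofReal_iff_toReal_le (Lp.eLpNorm_ne_top _) hR).2 h3
  have hg : MemLp g 2 volume := ⟨hgm, hle.trans_lt ENNReal.ofReal_lt_top⟩
  refine ⟨hg.toLp g, ?_, ?_⟩
  · rw [Lp.norm_toLp]
    exact ENNReal.toReal_le_of_le_ofReal hR hle
  · apply Lp.ext
    filter_upwards [coeFn_mulL (bddMeas_jb (a := -s) (by linarith)) (hg.toLp g), hg.coeFn_toLp]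
      with ξ h1 h2
    rw [h1, h2, smul_smul, ← Complex.ofReal_mul, jb_neg_mul, Complex.ofReal_one, one_smul]

end Approx

section Limit

variable {d : ℕ} {Q : RVec d →ₗ[ℝ] RVec d →ₗ[ℝ] RVec d} {s : ℝ}

theorem jb_le_of_ind_eq_zero {a n ξ : ℝ} (ha : a ≤ 0) (hn : 0 ≤ n) (h : ¬ |ξ| ≤ n) :
    jb a ξ ≤ jb a n := by
  have h6 : jb 1 n ≤ jb 1 ξ := jb_one_le_of_abs_le (by
    rw [abs_of_nonneg hn]
    exact (not_le.1 h).le)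
  rw [jb_eq_rpow a ξ, jb_eq_rpow a n]
  exact Real.rpow_le_rpow_of_nonpos (jb_pos _ _) h6 ha

/-- The `L²` norm is controlled by that of the part in the band `|ξ| ≤ n`, up to a part which is
small for functions bounded in `H^s`. -/
theorem norm_mulL_jb_le_low_add (hs : 0 ≤ s) {n : ℝ} (hn : 0 ≤ n) (V : L2 d) :
    ‖mulL (fun ξ => (jb (-s) ξ : ℂ)) V‖ ≤ ‖low s n V‖ + jb (-s) n * ‖V‖ := by
  have hj := bddMeas_jb (a := -s) (by linarith)
  have hb := (bddMeas_one_sub_ind n).mul hj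
  have e : mulL (fun ξ => (jb (-s) ξ : ℂ)) V =
      low s n V + mulL (fun ξ => ((1 - ind n ξ : ℝ) : ℂ) * jb (-s) ξ) V := by
    apply Lp.ext
    rw [low]
    filter_upwards [coeFn_mulL hj V, coeFn_mulL hb V, coeFn_mulL (bddMeas_ind_jb n (-s)) V,
      Lp.coeFn_add (mulL (fun ξ => (ind n ξ : ℂ) * jb (-s) ξ) V)
        (mulL (fun ξ => ((1 - ind n ξ : ℝ) : ℂ) * jb (-s) ξ) V)] with ξ h1 h2 h3 h4
    rw [h4, Pi.add_apply, h1, h2, h3, ← add_smul]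
    congr 1
    push_cast
    ring
  rw [e]
  refine (norm_add_le _ _).trans (add_le_add_right (norm_mulL_le hb (fun ξ => ?_) V) _)
  rw [norm_mul, Complex.norm_real, Complex.norm_real, Real.norm_of_nonneg (jb_pos _ _).le]
  by_cases h : |ξ| ≤ n
  · simp [ind, h, (jb_pos (-s) n).le]
  · simpa [ind, h] using jb_le_of_ind_eq_zero (by linarith) hn h

/-- On bounded sets of `H^s` the equation in a frequency band is Lipschitz continuous in `L²`. -/
theorem exists_norm_lowRhs_sub_le (hQ : IsFullySymmetric Q) (hs : 3 / 2 < s) (δ : ℝ) {n : ℝ}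
    (hn : 0 ≤ n) {R : ℝ} (hR : 0 ≤ R) :
    ∃ C : ℝ, 0 ≤ C ∧ ∀ F G : L2 d, ‖F‖ ≤ R → ‖G‖ ≤ R →
      ‖lowRhs Q δ s n F - lowRhs Q δ s n G‖ ≤
        C * ‖mulL (fun ξ => (jb (-s) ξ : ℂ)) F - mulL (fun ξ => (jb (-s) ξ : ℂ)) G‖ := by
  have hj := bddMeas_jb (a := -s) (by linarith)
  have hi := bddMeas_ind n
  have hp := bddMeas_ind_disp n δ
  let k2 : ℝ → ℝ → ℂ := fun x y =>
    (ind n (x + y) : ℂ) * (2 * Real.pi * Complex.I * (x + y : ℝ)) * jb (-s) x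
  have hk2 : IsKer (s - 1) (2 * Real.pi * n) k2 := by
    refine ⟨?_, by positivity, fun x y => ?_⟩
    · unfold Function.uncurry k2
      exact (((Complex.measurable_ofReal.comp (measurable_ind n)).comp
        (measurable_fst.add measurable_snd)).mul (by fun_prop)).mul
        ((Complex.measurable_ofReal.comp (measurable_jb _)).comp measurable_fst)
    · have h1 : ind n (x + y) * |x + y| ≤ n := by
        by_cases h : |x + y| ≤ n
        · simp [ind, h]
        · simp [ind, h, hn]
      have h2 := jb_pos (-(s - 1)) x
      have h3 := jb_pos (-(s - 1)) y
      have h4 := jb_pos (-(s - 1)) (x + y)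
      have h5 := jb_pos (-s) x
      have h6 := ind_nonneg n (x + y)
      have h7 : jb (-s) x ≤ jb (-(s - 1)) x := jb_mono (by linarith) x
      simp only [k2]
      rw [norm_mul, norm_mul, norm_mul, norm_two_pi_I, Complex.norm_real, Complex.norm_real,
        Complex.norm_real, Real.norm_of_nonneg h5.le, Real.norm_of_nonneg h6, Real.norm_eq_abs]
      calc ind n (x + y) * (2 * Real.pi * |x + y|) * jb (-s) x
          = 2 * Real.pi * (ind n (x + y) * |x + y|) * jb (-s) x := by ring
        _ ≤ 2 * Real.pi * n * jb (-(s - 1)) x := by gcongr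
        _ ≤ _ := by
          gcongr
          linarith
  have hadm : Adm k2 := ⟨s - 1, _, by linarith, hk2⟩
  set p : L2 d →L[ℂ] L2 d := mulL (fun ξ => (ind n ξ : ℂ) * disp δ ξ)
  have hc := formConst_nonneg Q (s - 1)
  refine ⟨‖p‖ + 2 * Real.pi * n * formConst Q (s - 1) * (2 * R), by positivity,
    fun F G hF hG => ?_⟩
  rw [← map_sub]
  set V := F - G with hV
  set A := F + G with hA
  have hAM : ‖A‖ ≤ 2 * R := (norm_add_le _ _).trans (by linarith)
  have e1 : lowRhs Q δ s n F - lowRhs Q δ s n G =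
      mulL (fun ξ => (ind n ξ : ℂ) * (disp δ ξ * jb (-s) ξ)) V -
        mulL (fun ξ => (ind n ξ : ℂ)) (bil Q (kern s) A V) := by
    rw [hV, hA, ← bil_sub_bil hQ (adm_kern hs) (kern_comm s), lowRhs, lowRhs, map_sub, map_sub]
    abel
  have e2 : mulL (fun ξ => (ind n ξ : ℂ) * (disp δ ξ * jb (-s) ξ)) V =
      p (mulL (fun ξ => (jb (-s) ξ : ℂ)) V) := by
    rw [mulL_mulL hp hj]
    exact mulL_congr (fun ξ => by ring) V
  have e3 : mulL (fun ξ => (ind n ξ : ℂ)) (bil Q (kern s) A V) =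
      bil Q k2 A (mulL (fun ξ => (jb (-s) ξ : ℂ)) V) := by
    rw [mulL_bil Q (adm_kern hs) hi, bil_mulL_right Q hadm hj]
    refine bil_congr Q (fun x y => ?_) A V
    simp only [k2, kern]
    push_cast
    ring
  rw [e1, e2, e3]
  refine (norm_sub_le _ _).trans ?_
  rw [add_mul]
  refine add_le_add (p.le_opNorm _) ((norm_bil_le Q (by linarith) hk2 _ _).trans ?_)
  have := mul_nonneg (by positivity : 0 ≤ 2 * Real.pi * n) hc
  gcongr

theorem continuousOn_mulL_ind {δ T n : ℝ} {F : ℝ → L2 d}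
    (hF : ApproxSol Q δ s T n F) :
    ContinuousOn (fun t => mulL (fun ξ => (ind n ξ : ℂ)) (F t)) (Set.Icc 0 T) := by
  have h1 : ContinuousOn (fun t => low s n (F t)) (Set.Icc 0 T) :=
    fun t ht => (hF t ht).continuousWithinAt
  refine ((mulL (fun ξ => (ind n ξ : ℂ) * jb s ξ) : L2 d →L[ℂ] L2 d).continuous.comp_continuousOn
    h1).congr fun t _ => ?_
  rw [Function.comp_apply, low, mulL_mulL (bddMeas_ind_jb _ _) (bddMeas_ind_jb _ _)]
  refine mulL_congr (fun ξ => ?_) _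
  have e : ∀ ξ, (ind n ξ : ℂ) * ind n ξ = ind n ξ := fun ξ => by
    rw [← Complex.ofReal_mul, ind_mul_self]
  have e' : (jb s ξ : ℂ) * jb (-s) ξ = 1 := by
    rw [← Complex.ofReal_mul, jb_mul_neg, Complex.ofReal_one]
  linear_combination -(jb s ξ * jb (-s) ξ : ℂ) * e ξ - (ind n ξ : ℂ) * e'

/-- Continuity in every frequency band and continuity of the norm give strong continuity. -/
theorem continuousOn_of_norm_sq {S : Set ℝ} {F : ℝ → L2 d}
    (h : ∀ n : ℕ, ContinuousOn (fun t => mulL (fun ξ => (ind n ξ : ℂ)) (F t)) S)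
    (h' : ContinuousOn (fun t => ‖F t‖ ^ 2) S) : ContinuousOn F S := by
  intro t ht
  rw [ContinuousWithinAt, tendsto_iff_norm_sub_tendsto_zero, Metric.tendsto_nhds]
  intro ε hε
  have h1 := (tendsto_norm_mulL_ind_sq (F t)).const_sub (‖F t‖ ^ 2)
  rw [sub_self] at h1
  obtain ⟨N, hN⟩ := (h1.eventually (gt_mem_nhds (show (0 : ℝ) < (ε / 2) ^ 2 by positivity))).exists
  -- `‖F x - F t‖` is at most `g x`, and `g t < ε`
  let g : ℝ → ℝ := fun x => ‖mulL (fun ξ => (ind N ξ : ℂ)) (F x) -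
      mulL (fun ξ => (ind N ξ : ℂ)) (F t)‖ +
    (√(‖F x‖ ^ 2 - ‖mulL (fun ξ => (ind N ξ : ℂ)) (F x)‖ ^ 2) +
      √(‖F t‖ ^ 2 - ‖mulL (fun ξ => (ind N ξ : ℂ)) (F t)‖ ^ 2))
  have hg : ContinuousWithinAt g S t :=
    ((h N t ht).sub continuousWithinAt_const).norm.add
      ((((h' t ht).sub ((h N t ht).norm.pow 2)).sqrt).add continuousWithinAt_const)
  have hsq : √(‖F t‖ ^ 2 - ‖mulL (fun ξ => (ind N ξ : ℂ)) (F t)‖ ^ 2) < ε / 2 :=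
    (Real.sqrt_lt' (by positivity)).2 hN
  have hgt : g t < ε := by
    simp only [g, sub_self, norm_zero]
    linarith
  filter_upwards [hg.eventually (gt_mem_nhds hgt)] with x hx
  rw [dist_zero_right, norm_norm]
  refine lt_of_le_of_lt ?_ hx
  have e : ∀ G : L2 d, √(‖G‖ ^ 2 - ‖mulL (fun ξ => (ind N ξ : ℂ)) G‖ ^ 2) =
      ‖G - mulL (fun ξ => (ind N ξ : ℂ)) G‖ := fun G => by
    rw [← norm_sub_mulL_ind_sq, Real.sqrt_sq (norm_nonneg _)]
  simp only [g, e]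
  have e2 : F x - F t = (mulL (fun ξ => (ind N ξ : ℂ)) (F x) -
      mulL (fun ξ => (ind N ξ : ℂ)) (F t)) +
      ((F x - mulL (fun ξ => (ind N ξ : ℂ)) (F x)) -
        (F t - mulL (fun ξ => (ind N ξ : ℂ)) (F t))) := by abel
  rw [e2]
  exact (norm_add_le _ _).trans (add_le_add_right (norm_sub_le _ _) _)

theorem tendsto_norm_mulL_rho_sq (hs : 0 ≤ s) (F : L2 d) :
    Tendsto (fun n : ℕ => ‖mulL (rho s (jb 1 n)) F‖ ^ 2) atTop (𝓝 (‖F‖ ^ 2)) := by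
  refine tendsto_of_tendsto_of_tendsto_of_le_of_le (tendsto_norm_mulL_ind_sq F)
    tendsto_const_nhds (fun n => ?_) (fun n => ?_)
  · have h1 := bddMeas_rho (k := jb 1 n) hs (one_le_jb zero_le_one _)
    refine pow_le_pow_left₀ (norm_nonneg _) (norm_mulL_le_of_le (bddMeas_ind _) h1
      (fun ξ => ?_) F) 2
    by_cases h : |ξ| ≤ (n : ℝ)
    · rw [rho_eq_one (jb_one_le_of_abs_le (by simpa using h))]
      simpa using norm_ind_le n ξ
    · simp [ind, h]
  · have h1 := one_le_jb zero_le_one (n : ℝ)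
    refine pow_le_pow_left₀ (norm_nonneg _) ?_ 2
    simpa using norm_mulL_le (bddMeas_rho hs h1) (norm_rho_le hs h1) F

/-- The truncated `H^s` norms of a bounded Galerkin solution are Lipschitz continuous in time,
uniformly in the band `n` and in the truncation `k`. -/
theorem abs_norm_mulL_rho_sq_sub_le (hQ : IsFullySymmetric Q) (hs : 3 / 2 < s) {δ n T R k : ℝ}
    (hk : 1 ≤ k) {F : ℝ → L2 d} (hF : ∀ t ∈ Set.Icc 0 T, IsHerm (F t) ∧
      mulL (fun ξ => (ind n ξ : ℂ)) (F t) = F t ∧ ‖F t‖ ≤ R ∧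
      HasDerivWithinAt F (galerkin Q δ s n (F t)) (Set.Icc 0 T) t) {t t' : ℝ}
    (ht : t ∈ Set.Icc 0 T) (ht' : t' ∈ Set.Icc 0 T) :
    |‖mulL (rho s k) (F t')‖ ^ 2 - ‖mulL (rho s k) (F t)‖ ^ 2| ≤
      energyConst Q s * R ^ 3 * |t' - t| := by
  have hE := energyConst_nonneg (Q := Q) (s := s) (by linarith)
  have h := (convex_Icc 0 T).norm_image_sub_le_of_norm_hasDerivWithin_le
    (f := fun t => ‖mulL (rho s k) (F t)‖ ^ 2)
    (fun x hx => hasDerivWithinAt_norm_sq (hasDerivWithinAt_mulL (rho s k) (hF x hx).2.2.2))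
    (C := energyConst Q s * R ^ 3) (fun x hx => ?_) ht ht'
  · simpa only [Real.norm_eq_abs] using h
  · obtain ⟨h1, h2, h3, -⟩ := hF x hx
    rw [Real.norm_eq_abs]
    refine (abs_re_inner_galerkin_le hQ hs δ n hk h1 h2).trans ?_
    gcongr

/-- Local existence on the Fourier side, in `C([0,T], H^s)`, as a limit of Galerkin
approximations. -/
theorem exists_approxSol (hQ : IsFullySymmetric Q) (hs : 3 / 2 < s) (δ : ℝ)
    {F₀ : L2 d} (hF₀ : IsHerm F₀) {T : ℝ} (hT0 : 0 ≤ T)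
    (hT : 2 * energyConst Q s * (1 + ‖F₀‖ ^ 2) * T ≤ 1) :
    ∃ F : ℝ → L2 d, F 0 = F₀ ∧ (∀ t ∈ Set.Icc 0 T, IsHerm (F t)) ∧
      ContinuousOn F (Set.Icc 0 T) ∧ ∀ n : ℕ, ApproxSol Q δ s T n F := by
  choose Φ hΦ0 hΦ using fun n : ℕ => exists_galerkin_solution hQ hs δ n hF₀ hT0 hT
  set R : ℝ := √(2 * (1 + ‖F₀‖ ^ 2)) with hRdef
  have hR : 0 ≤ R := Real.sqrt_nonneg _
  have hΦR : ∀ n, ∀ t ∈ Set.Icc 0 T, ‖Φ n t‖ ≤ R := fun n t ht =>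
    Real.le_sqrt_of_sq_le (by linarith [(hΦ n t ht).2.2.1])
  have hap : ∀ m n : ℕ, m ≤ n → ApproxSol Q δ s T m (Φ n) := fun m n h =>
    approxSol_of_galerkin (n := n) (by exact_mod_cast h) fun t ht => (hΦ n t ht).2.2.2
  have hj := bddMeas_jb (a := -s) (by linarith)
  have hc := formConst_nonneg Q (s - 1)
  have h0T : (0 : ℝ) ∈ Set.Icc 0 T := ⟨le_rfl, hT0⟩
  -- the sequence is Cauchy in `L²`, uniformly in time
  let b : ℕ → ℝ := fun n => √((64 * Real.pi * formConst Q (s - 1) * R ^ 3 * jb (1 - s) n * T) *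
    Real.exp (4 * Real.pi * formConst Q (s - 1) * R * T)) + jb (-s) n * (2 * R)
  have hb : Tendsto b atTop (𝓝 0) := by
    have h1 := ((((tendsto_jb_nat (a := 1 - s) (by linarith)).const_mul
      (64 * Real.pi * formConst Q (s - 1) * R ^ 3)).mul_const T).mul_const
      (Real.exp (4 * Real.pi * formConst Q (s - 1) * R * T))).sqrt
    have h2 := h1.add ((tendsto_jb_nat (a := -s) (by linarith)).mul_const (2 * R))
    simpa using h2
  have hcauchy : ∀ n m : ℕ, n ≤ m → ∀ t ∈ Set.Icc 0 T,
      ‖mulL (fun ξ => (jb (-s) ξ : ℂ)) (Φ n t) - mulL (fun ξ => (jb (-s) ξ : ℂ)) (Φ m t)‖ ≤ b n := by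
    intro n m h t ht
    have h1 := norm_low_sub_sq_le hQ hs (Nat.cast_nonneg n)
      (fun t ht => ⟨(hΦ n t ht).1, hΦR n t ht⟩) (fun t ht => ⟨(hΦ m t ht).1, hΦR m t ht⟩)
      (hap n n le_rfl) (hap n m h) ht
    have e : low s n (Φ n 0) = low s n (Φ m 0) := by
      rw [hΦ0, hΦ0, low, low, mulL_mulL (bddMeas_ind_jb _ _) (bddMeas_ind _),
        mulL_mulL (bddMeas_ind_jb _ _) (bddMeas_ind _)]
      refine mulL_congr (fun ξ => ?_) _
      have hnm : (n : ℝ) ≤ m := by exact_mod_cast h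
      have e1 : (ind n ξ : ℂ) * ind n ξ = ind n ξ := by rw [← Complex.ofReal_mul, ind_mul_self]
      have e2 : (ind n ξ : ℂ) * ind m ξ = ind n ξ := by rw [← Complex.ofReal_mul, ind_mul_ind hnm]
      linear_combination (jb (-s) ξ : ℂ) * e1 - (jb (-s) ξ : ℂ) * e2
    rw [e, sub_self, norm_zero, zero_pow two_ne_zero, zero_add] at h1
    rw [← map_sub]
    refine (norm_mulL_jb_le_low_add (by linarith) (Nat.cast_nonneg n) _).trans (add_le_add ?_ ?_)
    · rw [low_sub]
      exact Real.le_sqrt_of_sq_le h1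
    · have := (jb_pos (-s) n).le
      gcongr
      exact (norm_sub_le _ _).trans (by linarith [hΦR n t ht, hΦR m t ht])
  have hlim : ∀ t, ∃ G : L2 d, t ∈ Set.Icc 0 T → ‖G‖ ≤ R ∧
      Tendsto (fun n => mulL (fun ξ => (jb (-s) ξ : ℂ)) (Φ n t)) atTop
        (𝓝 (mulL (fun ξ => (jb (-s) ξ : ℂ)) G)) := by
    intro t
    by_cases ht : t ∈ Set.Icc 0 T
    · have h1 : CauchySeq fun n => mulL (fun ξ => (jb (-s) ξ : ℂ)) (Φ n t) :=
        cauchySeq_of_le_tendsto_0' b (fun n m h => by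
          rw [dist_eq_norm]
          exact hcauchy n m h t ht) hb
      obtain ⟨f, hf⟩ := cauchySeq_tendsto_of_complete h1
      obtain ⟨G, hG, hG'⟩ := exists_of_tendsto (by linarith) (fun n => hΦR n t ht) hf
      exact ⟨G, fun _ => ⟨hG, hG' ▸ hf⟩⟩
    · exact ⟨0, fun h => absurd h ht⟩
  choose F hF using hlim
  have hlow : ∀ n : ℝ, ∀ G : L2 d,
      mulL (fun ξ => (ind n ξ : ℂ)) (mulL (fun ξ => (jb (-s) ξ : ℂ)) G) = low s n G :=
    fun n G => mulL_mulL (bddMeas_ind n) hj G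
  have hdist : ∀ n, ∀ t ∈ Set.Icc 0 T,
      ‖mulL (fun ξ => (jb (-s) ξ : ℂ)) (Φ n t) - mulL (fun ξ => (jb (-s) ξ : ℂ)) (F t)‖ ≤ b n :=
    fun n t ht => le_of_tendsto (tendsto_const_nhds.sub (hF t ht).2).norm
      ((eventually_ge_atTop n).mono fun m hm => hcauchy n m hm t ht)
  have hherm : ∀ t ∈ Set.Icc 0 T, IsHerm (F t) := by
    intro t ht
    have hr : ∀ G : L2 d, refl d (mulL (fun ξ => (jb (-s) ξ : ℂ)) G) =
        mulL (fun ξ => (jb (-s) ξ : ℂ)) (refl d G) :=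
      refl_mulL hj fun ξ => by rw [jb_even, Complex.conj_ofReal]
    refine mulL_jb_injective (a := -s) (by linarith) ?_
    rw [← hr]
    refine tendsto_nhds_unique (((refl d).continuous.tendsto _).comp (hF t ht).2)
      ((hF t ht).2.congr fun n => ?_)
    rw [Function.comp_apply, hr, (hΦ n t ht).1]
  have hsol : ∀ n : ℕ, ApproxSol Q δ s T n F := by
    intro n t ht
    obtain ⟨C, hC, hlip⟩ := exists_norm_lowRhs_sub_le hQ hs δ (Nat.cast_nonneg n) hR
    refine hasDerivWithinAt_of_uniform_limit (b := fun m => C * b (m + n))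
      (y := fun m t => low s n (Φ (m + n) t)) (y' := fun m t => lowRhs Q δ s n (Φ (m + n) t))
      (Y' := fun t => lowRhs Q δ s n (F t))
      (by simpa using (hb.comp (tendsto_add_atTop_nat n)).const_mul C)
      (fun m t ht => hap n (m + n) (Nat.le_add_left _ _) t ht) (fun t ht => ?_)
      (fun m t ht => ?_) ht
    · have h1 := ((mulL (fun ξ => (ind n ξ : ℂ)) : L2 d →L[ℂ] L2 d).continuous.tendsto _).comp
        ((hF t ht).2.comp (tendsto_add_atTop_nat n))
      rw [hlow] at h1
      exact h1.congr fun m => hlow _ _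
    · exact (hlip _ _ (hΦR _ t ht) (hF t ht).1).trans
        (mul_le_mul_of_nonneg_left (hdist _ t ht) hC)
  refine ⟨F, ?_, hherm, ?_, hsol⟩
  · refine mulL_jb_injective (a := -s) (by linarith) (eq_of_forall_ind fun n => ?_)
    rw [hlow, hlow]
    have h1 := ((mulL (fun ξ => (ind n ξ : ℂ)) : L2 d →L[ℂ] L2 d).continuous.tendsto _).comp
      (hF 0 h0T).2
    rw [hlow] at h1
    refine tendsto_nhds_unique h1 (tendsto_const_nhds.congr' ?_)
    filter_upwards [eventually_ge_atTop n] with m hm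
    have hnm : (n : ℝ) ≤ m := by exact_mod_cast hm
    rw [Function.comp_apply, hlow, hΦ0, low, low, mulL_mulL (bddMeas_ind_jb _ _) (bddMeas_ind _)]
    refine mulL_congr (fun ξ => ?_) _
    have e2 : (ind n ξ : ℂ) * ind m ξ = ind n ξ := by rw [← Complex.ofReal_mul, ind_mul_ind hnm]
    linear_combination -(jb (-s) ξ : ℂ) * e2
  · -- the `H^s` norm of the limit is Lipschitz continuous in time
    refine continuousOn_of_norm_sq (fun n => continuousOn_mulL_ind (hsol n)) ?_
    have hE := energyConst_nonneg (Q := Q) (s := s) (by linarith)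
    have hL : LipschitzOnWith (energyConst Q s * R ^ 3).toNNReal (fun t => ‖F t‖ ^ 2)
        (Set.Icc 0 T) := by
      refine LipschitzOnWith.of_dist_le_mul fun t ht t' ht' => ?_
      rw [Real.dist_eq, Real.dist_eq, Real.coe_toNNReal _ (by positivity)]
      refine le_of_tendsto ((tendsto_norm_mulL_rho_sq (s := s) (by linarith) (F t)).sub
        (tendsto_norm_mulL_rho_sq (s := s) (by linarith) (F t'))).abs (.of_forall fun N => ?_)
      have hk := one_le_jb zero_le_one (N : ℝ)
      have hrho : ∀ G : L2 d, mulL (fun ξ => ((lam (jb 1 N) ξ ^ s * jb (-0) ξ : ℝ) : ℂ))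
          (mulL (fun ξ => (jb (-s) ξ : ℂ)) G) = mulL (rho s (jb 1 N)) G := fun G => by
        rw [mulL_mulL (bddMeas_lam le_rfl hk s (by linarith)) hj]
        refine mulL_congr (fun ξ => ?_) G
        rw [neg_zero, jb_zero, mul_one, rho, Complex.ofReal_mul]
      have h1 : ∀ t ∈ Set.Icc 0 T, Tendsto (fun n => ‖mulL (rho s (jb 1 N)) (Φ n t)‖ ^ 2) atTop
          (𝓝 (‖mulL (rho s (jb 1 N)) (F t)‖ ^ 2)) := fun t ht => by
        have h2 := ((mulL (fun ξ => ((lam (jb 1 N) ξ ^ s * jb (-0) ξ : ℝ) : ℂ)) :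
          L2 d →L[ℂ] L2 d).continuous.tendsto _).comp (hF t ht).2
        rw [hrho] at h2
        refine (h2.norm.pow 2).congr fun n => ?_
        rw [Function.comp_apply, hrho]
      refine le_of_tendsto ((h1 t ht).sub (h1 t' ht')).abs (.of_forall fun n => ?_)
      exact abs_norm_mulL_rho_sq_sub_le hQ hs hk (n := n) (δ := δ) (fun x hx =>
        ⟨(hΦ n x hx).1, (hΦ n x hx).2.1, hΦR n x hx, (hΦ n x hx).2.2.2⟩) ht' ht
    exact hL.continuousOn

end Limit

/-! ### The equation in `H^r` -/

section Strong

variable {d : ℕ} {Q : RVec d →ₗ[ℝ] RVec d →ₗ[ℝ] RVec d} {s r : ℝ}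

/-- The kernel of `⟨D⟩^r ∂_x Q(u, u)`, where `u` is represented by `⟨ξ⟩^s û(ξ)`. -/
def kernR (s r : ℝ) (x y : ℝ) : ℂ := (jb r (x + y) : ℂ) * kern s x y

/-- The nonlinearity loses a single derivative: it maps `H^s` to `H^r` for `r ≤ s - 1`. -/
theorem adm_kernR (hs : 3 / 2 < s) (hr : r ≤ s - 1) : Adm (kernR s r) := by
  refine ⟨s, 2 * Real.pi * 2 ^ s, by linarith, ?_, by positivity, fun x y => ?_⟩
  · exact ((Complex.measurable_ofReal.comp (measurable_jb r)).comp
      (measurable_fst.add measurable_snd)).mul (measurable_kern s)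
  · have h1 := jb_pos (-s) x
    have h2 := jb_pos (-s) y
    have h3 := jb_pos (-s) (x + y)
    have h4 := jb_pos r (x + y)
    have h5 : jb r (x + y) * |x + y| ≤ 2 ^ s * (jb s x + jb s y) := by
      calc jb r (x + y) * |x + y| ≤ jb r (x + y) * jb 1 (x + y) := by
            gcongr
            exact abs_le_jb_one _
        _ = jb (r + 1) (x + y) := jb_mul _ _ _
        _ ≤ jb s (x + y) := jb_mono (by linarith) _
        _ ≤ _ := jb_add_le (by linarith) x y
    rw [kernR, kern, norm_mul, norm_mul, norm_mul, norm_two_pi_I, Complex.norm_real,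
      Complex.norm_real, Complex.norm_real, Real.norm_of_nonneg h4.le, Real.norm_eq_abs,
      Real.norm_of_nonneg (by positivity)]
    calc jb r (x + y) * (2 * Real.pi * |x + y| * (jb (-s) x * jb (-s) y))
        = 2 * Real.pi * (jb r (x + y) * |x + y|) * (jb (-s) x * jb (-s) y) := by ring
      _ ≤ 2 * Real.pi * (2 ^ s * (jb s x + jb s y)) * (jb (-s) x * jb (-s) y) := by gcongr
      _ = 2 * Real.pi * 2 ^ s * ((jb s x * jb (-s) x) * jb (-s) y +
            (jb s y * jb (-s) y) * jb (-s) x) := by ring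
      _ = 2 * Real.pi * 2 ^ s * (jb (-s) y + jb (-s) x) := by
        rw [jb_mul_neg, jb_mul_neg, one_mul, one_mul]
      _ ≤ _ := mul_le_mul_of_nonneg_left (by linarith) (by positivity)

/-- The dispersion maps `H^s` to `H^r`. -/
theorem bddMeas_disp_jb {δ : ℝ} (h : r ≤ s - 3 ∨ δ = 0) :
    BddMeas fun ξ => disp δ ξ * jb (r - s) ξ := by
  refine ⟨((continuous_disp δ).mul
    (Complex.continuous_ofReal.comp (continuous_jb _))).measurable, |δ| * (2 * Real.pi) ^ 3,
    fun ξ => ?_⟩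
  rcases h with h | h
  · have h1 := jb_pos (r - s) ξ
    have h2 := jb_pos 1 ξ
    have h3 := abs_le_jb_one ξ
    rw [norm_mul, disp, norm_mul, norm_pow, norm_mul, norm_two_pi_I, Complex.norm_real,
      Complex.norm_real, Complex.norm_real, Real.norm_of_nonneg h1.le, Real.norm_eq_abs,
      Real.norm_eq_abs]
    calc |δ| * (2 * Real.pi * |ξ|) ^ 3 * jb (r - s) ξ
        ≤ |δ| * (2 * Real.pi * jb 1 ξ) ^ 3 * jb (r - s) ξ := by gcongr
      _ = |δ| * (2 * Real.pi) ^ 3 * (jb 1 ξ * jb 1 ξ * jb 1 ξ * jb (r - s) ξ) := by ring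
      _ ≤ |δ| * (2 * Real.pi) ^ 3 * 1 := by
        gcongr
        rw [jb_mul, jb_mul, jb_mul]
        exact jb_le_one (by linarith) ξ
      _ = _ := mul_one _
  · subst h
    simp [disp]

/-- The right-hand side `⟨D⟩^r (δ ∂_x³ u - ∂_x Q(u, u))` on the Fourier side, in terms of
`F = ⟨ξ⟩^s û`. -/
def rhs (Q : RVec d →ₗ[ℝ] RVec d →ₗ[ℝ] RVec d) (δ s r : ℝ) (F : L2 d) : L2 d :=
  mulL (fun ξ => disp δ ξ * jb (r - s) ξ) F - bil Q (kernR s r) F F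

theorem continuous_rhs (δ : ℝ) : Continuous (rhs Q δ s r) :=
  (mulL _).continuous.sub ((bil Q (kernR s r)).continuous.clm_apply continuous_id)

theorem isHerm_rhs (hs : 3 / 2 < s) (hr : r ≤ s - 1) {δ : ℝ} (h : r ≤ s - 3 ∨ δ = 0) {F : L2 d}
    (hF : IsHerm F) : IsHerm (rhs Q δ s r F) := by
  refine (hF.mulL (bddMeas_disp_jb h) fun ξ => ?_).sub
    (hF.bil Q (adm_kernR hs hr) (fun x y => ?_) hF)
  · rw [disp_neg, jb_even, map_mul, Complex.conj_ofReal]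
  · rw [kernR, kernR, kern_neg, ← neg_add, jb_even, map_mul, Complex.conj_ofReal]

theorem mulL_ind_jb_lowRhs (hs : 3 / 2 < s) (hr : r ≤ s - 1) {δ : ℝ} (h : r ≤ s - 3 ∨ δ = 0)
    (n : ℝ) (F : L2 d) :
    mulL (fun ξ => (ind n ξ : ℂ) * jb r ξ) (lowRhs Q δ s n F) =
      mulL (fun ξ => (ind n ξ : ℂ)) (rhs Q δ s r F) := by
  have hj := bddMeas_ind_jb n r
  have hi := bddMeas_ind n
  have e : ∀ ξ, (ind n ξ : ℂ) * ind n ξ = ind n ξ := fun ξ => by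
    rw [← Complex.ofReal_mul, ind_mul_self]
  rw [lowRhs, rhs, map_sub, map_sub, mulL_mulL hj (bddMeas_ind_disp_jb n δ (-s)), mulL_mulL hj hi,
    mulL_mulL hi (bddMeas_disp_jb h), mulL_bil Q (adm_kern hs) (hj.mul hi),
    mulL_bil Q (adm_kernR hs hr) hi]
  congr 1
  · refine mulL_congr (fun ξ => ?_) F
    rw [sub_eq_add_neg, ← jb_mul]
    push_cast
    linear_combination (jb r ξ * disp δ ξ * jb (-s) ξ) * e ξ
  · refine bil_congr Q (fun x y => ?_) F F
    rw [kernR]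
    linear_combination (jb r (x + y) * kern s x y) * e (x + y)

theorem mulL_ind_jb_rhs (hs : 3 / 2 < s) (hr : r ≤ s - 1) {δ : ℝ} (h : r ≤ s - 3 ∨ δ = 0)
    (n : ℝ) (F : L2 d) :
    mulL (fun ξ => (ind n ξ : ℂ) * jb (-r) ξ) (rhs Q δ s r F) = lowRhs Q δ s n F := by
  have hj := bddMeas_ind_jb n (-r)
  have hi := bddMeas_ind n
  have e : ∀ ξ, (jb (-r) ξ : ℂ) * jb r ξ = 1 := fun ξ => by
    rw [← Complex.ofReal_mul, jb_neg_mul, Complex.ofReal_one]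
  rw [lowRhs, rhs, map_sub, mulL_mulL hj (bddMeas_disp_jb h), mulL_bil Q (adm_kernR hs hr) hj,
    mulL_bil Q (adm_kern hs) hi]
  congr 1
  · refine mulL_congr (fun ξ => ?_) F
    rw [sub_eq_add_neg, ← jb_mul]
    push_cast
    linear_combination (ind n ξ * disp δ ξ * jb (-s) ξ) * e ξ
  · refine bil_congr Q (fun x y => ?_) F F
    rw [kernR]
    linear_combination (ind n (x + y) * kern s x y) * e (x + y)

/-- A function whose band-limited parts have the band-limited parts of a continuous function as
derivatives is continuously differentiable. -/
theorem hasDerivWithinAt_of_forall_ind {T : ℝ} {W Ψ : ℝ → L2 d}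
    (hΨ : ContinuousOn Ψ (Set.Icc 0 T))
    (h : ∀ n : ℕ, ∀ t ∈ Set.Icc 0 T, HasDerivWithinAt (fun t => mulL (fun ξ => (ind n ξ : ℂ)) (W t))
      (mulL (fun ξ => (ind n ξ : ℂ)) (Ψ t)) (Set.Icc 0 T) t) {t : ℝ} (ht : t ∈ Set.Icc 0 T) :
    HasDerivWithinAt W (Ψ t) (Set.Icc 0 T) t := by
  have hT : (0 : ℝ) ≤ T := ht.1.trans ht.2
  let Ψ' : ℝ → L2 d := Set.IccExtend hT (Set.domRestrict (Set.Icc 0 T) Ψ)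
  have hc : Continuous Ψ' := continuous_IccExtend_iff.2 hΨ.domRestrict
  have hΨ' : ∀ t ∈ Set.Icc 0 T, Ψ' t = Ψ t := fun t ht => by
    simp only [Ψ', Set.IccExtend_of_mem hT _ ht, Set.domRestrict]
  let V : ℝ → L2 d := fun t => W 0 + ∫ τ in (0 : ℝ)..t, Ψ' τ
  have hV : ∀ t, HasDerivAt V (Ψ' t) t := fun t =>
    (intervalIntegral.integral_hasDerivAt_right (hc.intervalIntegrable _ _)
      hc.stronglyMeasurable.stronglyMeasurableAtFilter hc.continuousAt).const_add _
  have hVW : ∀ t ∈ Set.Icc 0 T, W t = V t := fun t ht => by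
    refine eq_of_forall_ind fun n => ?_
    have h1 : ∀ x ∈ Set.Icc 0 T, HasDerivWithinAt (fun t => mulL (fun ξ => (ind n ξ : ℂ)) (W t) -
        mulL (fun ξ => (ind n ξ : ℂ)) (V t)) 0 (Set.Icc 0 T) x := fun x hx => by
      have h2 := (h n x hx).fun_sub
        (hasDerivWithinAt_mulL (fun ξ => (ind n ξ : ℂ)) (hV x).hasDerivWithinAt)
      rwa [hΨ' x hx, sub_self] at h2
    have h3 := (convex_Icc 0 T).norm_image_sub_le_of_norm_hasDerivWithin_le h1 (C := 0)
      (fun x _ => by simp) (Set.left_mem_Icc.2 hT) ht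
    have h4 : V 0 = W 0 := by simp [V]
    rw [h4, sub_self, sub_zero, zero_mul] at h3
    exact sub_eq_zero.1 (norm_le_zero_iff.1 h3)
  rw [← hΨ' t ht]
  exact (hV t).hasDerivWithinAt.congr hVW (hVW t ht)

/-- A continuous function which solves the equation in every frequency band is a solution in
`C¹([0,T], H^r)`. -/
theorem hasDerivWithinAt_of_approxSol (hs : 3 / 2 < s) (hr : r ≤ s - 1) {δ T : ℝ}
    (h : r ≤ s - 3 ∨ δ = 0) {F : ℝ → L2 d} (hc : ContinuousOn F (Set.Icc 0 T))
    (hF : ∀ n : ℕ, ApproxSol Q δ s T n F) {t : ℝ} (ht : t ∈ Set.Icc 0 T) :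
    HasDerivWithinAt (fun t => mulL (fun ξ => (jb (r - s) ξ : ℂ)) (F t)) (rhs Q δ s r (F t))
      (Set.Icc 0 T) t := by
  refine hasDerivWithinAt_of_forall_ind (Ψ := fun t => rhs Q δ s r (F t))
    ((continuous_rhs δ).comp_continuousOn hc) (fun n t ht => ?_) ht
  rw [← mulL_ind_jb_lowRhs hs hr h]
  refine (hasDerivWithinAt_mulL (fun ξ => (ind n ξ : ℂ) * jb r ξ) (hF n t ht)).congr_of_mem
    (fun x _ => ?_) ht
  rw [low, mulL_mulL (bddMeas_ind _) (bddMeas_jb (by linarith)),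
    mulL_mulL (bddMeas_ind_jb _ _) (bddMeas_ind_jb _ _)]
  refine mulL_congr (fun ξ => ?_) _
  have e : (ind n ξ : ℂ) * ind n ξ = ind n ξ := by rw [← Complex.ofReal_mul, ind_mul_self]
  rw [sub_eq_add_neg, ← jb_mul]
  push_cast
  linear_combination -(jb r ξ * jb (-s) ξ : ℂ) * e

theorem approxSol_of_hasDerivWithinAt (hs : 3 / 2 < s) (hr : r ≤ s - 1) {δ T : ℝ}
    (h : r ≤ s - 3 ∨ δ = 0) {F : ℝ → L2 d}
    (hF : ∀ t ∈ Set.Icc 0 T, HasDerivWithinAt (fun t => mulL (fun ξ => (jb (r - s) ξ : ℂ)) (F t))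
      (rhs Q δ s r (F t)) (Set.Icc 0 T) t) (n : ℝ) : ApproxSol Q δ s T n F := by
  intro t ht
  rw [← mulL_ind_jb_rhs hs hr h]
  refine (hasDerivWithinAt_mulL (fun ξ => (ind n ξ : ℂ) * jb (-r) ξ) (hF t ht)).congr_of_mem
    (fun x _ => ?_) ht
  rw [low, mulL_mulL (bddMeas_ind_jb _ _) (bddMeas_jb (by linarith))]
  refine mulL_congr (fun ξ => ?_) _
  have e : (jb (-r) ξ : ℂ) * jb r ξ = 1 := by
    rw [← Complex.ofReal_mul, jb_neg_mul, Complex.ofReal_one]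
  rw [sub_eq_add_neg, ← jb_mul]
  push_cast
  linear_combination -(ind n ξ * jb (-s) ξ : ℂ) * e

end Strong

/-! ### Sobolev spaces on the Fourier side -/

section Transfer

open FourierTransform

variable {d : ℕ} {s : ℝ}

theorem hasTemperateGrowth_jb (a : ℝ) :
    (fun ξ : ℝ => (jb a ξ : ℂ)).HasTemperateGrowth := by
  unfold jb
  fun_prop

/-- The tempered distribution `⟨ξ⟩^a F(ξ)`, for `F ∈ L²`. -/
def freq (d : ℕ) (a : ℝ) : L2 d →L[ℂ] 𝓢'(ℝ, CVec d) :=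
  TemperedDistribution.smulLeftCLM (CVec d) (fun ξ => (jb a ξ : ℂ)) ∘L
    Lp.toTemperedDistributionCLM (CVec d) volume 2

theorem freq_apply (a : ℝ) (F : L2 d) (φ : 𝓢(ℝ, ℂ)) :
    freq d a F φ = ∫ ξ, ((jb a ξ : ℂ) * φ ξ) • F ξ := by
  change Lp.toTemperedDistribution F (SchwartzMap.smulLeftCLM ℂ _ φ) = _
  rw [Lp.toTemperedDistribution_apply]
  simp only [SchwartzMap.smulLeftCLM_apply_apply (hasTemperateGrowth_jb a), smul_eq_mul]

theorem smulLeftCLM_jb_jb {a b : ℝ} (h : a + b = 0) (f : 𝓢'(ℝ, CVec d)) :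
    TemperedDistribution.smulLeftCLM (CVec d) (fun ξ => (jb b ξ : ℂ))
      (TemperedDistribution.smulLeftCLM (CVec d) (fun ξ => (jb a ξ : ℂ)) f) = f := by
  rw [TemperedDistribution.smulLeftCLM_smulLeftCLM_apply (hasTemperateGrowth_jb a)
    (hasTemperateGrowth_jb b)]
  have e : (fun ξ => (jb a ξ : ℂ)) * (fun ξ => (jb b ξ : ℂ)) = fun _ => 1 := by
    funext ξ
    rw [Pi.mul_apply, ← Complex.ofReal_mul, jb_mul, h, jb_zero, Complex.ofReal_one]
  rw [e, TemperedDistribution.smulLeftCLM_const, one_smul]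

theorem freq_injective (a : ℝ) : Function.Injective (freq d a) := by
  intro F G h
  apply toTemperedDistribution_injective d
  have h1 := congrArg (TemperedDistribution.smulLeftCLM (CVec d) (fun ξ => (jb (-a) ξ : ℂ))) h
  change TemperedDistribution.smulLeftCLM (CVec d) _ (TemperedDistribution.smulLeftCLM _ _ _) =
    TemperedDistribution.smulLeftCLM (CVec d) _ (TemperedDistribution.smulLeftCLM _ _ _) at h1
  rwa [smulLeftCLM_jb_jb (add_neg_cancel a), smulLeftCLM_jb_jb (add_neg_cancel a)] at h1

/-- The function `⟨ξ⟩^s û(ξ)` of `u ∈ H^s`. -/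
def hat : Sob d s →ₗᵢ[ℝ] L2 d where
  toLinearMap := ((Lp.fourierTransformₗᵢ ℝ (CVec d)).toLinearEquiv.toLinearMap.restrictScalars ℝ) ∘ₗ
    besselL2 d s
  norm_map' f := (Lp.fourierTransformₗᵢ ℝ (CVec d)).norm_map (besselFun f)

theorem fourier_dist (u : Sob d s) : 𝓕 u.dist = freq d (-s) (hat u) := by
  have h1 := congrArg (fun f : 𝓢'(ℝ, CVec d) => 𝓕 f) (besselFun_spec u)
  simp only [TemperedDistribution.fourier_besselPotential_eq_smulLeftCLM_fourier_apply] at h1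
  rw [Lp.toTemperedDistributionCLM_apply, Lp.fourier_toTemperedDistribution_eq] at h1
  have h2 := congrArg (TemperedDistribution.smulLeftCLM (CVec d) (fun ξ => (jb (-s) ξ : ℂ))) h1
  rw [show (fun x : ℝ => (((1 + ‖x‖ ^ 2) ^ (s / 2) : ℝ) : ℂ)) = fun ξ => (jb s ξ : ℂ) from rfl,
    smulLeftCLM_jb_jb (add_neg_cancel s)] at h2
  exact h2

/-- Elements of `H^s` and `H^r` with the same underlying distribution, for `r ≤ s`. -/
theorem hat_eq_iff {r : ℝ} (hr : r ≤ s) (u : Sob d s) (w : Sob d r) :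
    w.dist = u.dist ↔ hat w = mulL (fun ξ => (jb (r - s) ξ : ℂ)) (hat u) := by
  have h1 : freq d (-r) (mulL (fun ξ => (jb (r - s) ξ : ℂ)) (hat u)) = freq d (-s) (hat u) := by
    ext φ : 1
    rw [freq_apply, freq_apply]
    apply integral_congr_ae
    filter_upwards [coeFn_mulL (bddMeas_jb (a := r - s) (by linarith)) (hat u)] with ξ h
    rw [h, smul_smul]
    congr 1
    have e : jb (-s) ξ = jb (-r) ξ * jb (r - s) ξ := by
      rw [jb_mul]
      congr 1
      ring
    rw [e]
    push_cast
    ring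
  rw [← (freq_injective (-r)).eq_iff, h1, ← fourier_dist, ← fourier_dist]
  exact ((fourierEquiv ℂ 𝓢'(ℝ, CVec d)).injective.eq_iff (a := w.dist) (b := u.dist)).symm

/-- Pointwise conjugation of test functions. -/
def conjS (φ : 𝓢(ℝ, ℂ)) : 𝓢(ℝ, ℂ) :=
  SchwartzMap.postcompCLM (𝕜 := ℝ) (Complex.conjCLE : ℂ →L[ℝ] ℂ) φ

theorem conjS_apply (φ : 𝓢(ℝ, ℂ)) (x : ℝ) : conjS φ x = (starRingEnd ℂ) (φ x) := rfl

theorem isReal_iff {f : 𝓢'(ℝ, CVec d)} : IsReal f ↔ ∀ φ, f (conjS φ) = conjV (f φ) := by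
  constructor
  · intro h φ
    have h1 := h (φ + conjS φ) fun x => by simp [conjS_apply]
    have h2 := h (Complex.I • (φ - conjS φ)) fun x => by simp [conjS_apply]
    ext i
    have h1 := h1 i
    have h2 := h2 i
    rw [map_add] at h1
    rw [map_smul, map_sub] at h2
    simp at h1 h2
    apply Complex.ext
    · simp
      linarith
    · simp
      linarith
  · intro h φ hφ i
    have e : conjS φ = φ := by
      ext x
      rw [conjS_apply]
      exact Complex.conj_eq_iff_im.2 (hφ x)
    have h1 := congrArg (fun v : CVec d => v i) (h φ)
    simp only [e, conjV_apply] at h1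
    exact Complex.conj_eq_iff_im.1 h1.symm

theorem fourierInv_conjS (φ : 𝓢(ℝ, ℂ)) (ξ : ℝ) :
    (𝓕⁻ (conjS φ) : 𝓢(ℝ, ℂ)) ξ = (starRingEnd ℂ) ((𝓕⁻ φ : 𝓢(ℝ, ℂ)) (-ξ)) := by
  rw [SchwartzMap.fourierInv_coe, SchwartzMap.fourierInv_coe, Real.fourierInv_eq',
    Real.fourierInv_eq', ← integral_conj]
  refine integral_congr_ae (.of_forall fun x => ?_)
  simp only [conjS_apply, smul_eq_mul, map_mul, ← Complex.exp_conj]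
  congr 2
  simp [map_ofNat (starRingEnd ℂ) 2]

theorem freq_refl (a : ℝ) (F : L2 d) (φ : 𝓢(ℝ, ℂ)) :
    freq d a (refl d F) (𝓕⁻ φ : 𝓢(ℝ, ℂ)) = conjV (freq d a F (𝓕⁻ (conjS φ) : 𝓢(ℝ, ℂ))) := by
  rw [freq_apply, freq_apply, ← conjL_apply, ← (conjL d).integral_comp_comm'
    (AddMonoidHomClass.isometry_of_norm (conjL d) norm_conjV).antilipschitz,
    ← integral_neg_eq_self (μ := volume) (fun ξ => conjL d _)]
  apply integral_congr_ae
  filter_upwards [coeFn_refl F] with ξ h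
  rw [h, conjL_apply, conjV_smul, fourierInv_conjS, jb_even, neg_neg, map_mul, Complex.conj_ofReal,
    Complex.conj_conj]

theorem isReal_iff_isHerm {a : ℝ} {f : 𝓢'(ℝ, CVec d)} {F : L2 d} (h : 𝓕 f = freq d a F) :
    IsReal f ↔ IsHerm F := by
  have h1 : ∀ φ, f φ = freq d a F (𝓕⁻ φ : 𝓢(ℝ, ℂ)) := fun φ => by
    rw [← h, TemperedDistribution.fourier_apply, fourier_fourierInv_eq]
  rw [isReal_iff, IsHerm, ← (freq_injective a).eq_iff]
  constructor
  · intro h2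
    ext φ : 1
    have h3 := freq_refl a F (𝓕 φ)
    rw [← h1, h2, conjV_conjV, h1, fourierInv_fourier_eq] at h3
    exact h3
  · intro h2 φ
    have h3 := freq_refl a F φ
    rw [h2, ← h1, ← h1] at h3
    rw [h3, conjV_conjV]

theorem isHerm_hat (u : Sob d s) : IsHerm (hat u) :=
  (isReal_iff_isHerm (fourier_dist u)).1 u.2.2

/-- Every function of `L²` with the reality condition comes from an element of `H^s`. -/
theorem exists_hat_eq (s : ℝ) {F : L2 d} (hF : IsHerm F) : ∃ u : Sob d s, hat u = F := by
  have h1 : 𝓕 (𝓕⁻ (freq d (-s) F) : 𝓢'(ℝ, CVec d)) = freq d (-s) F := fourier_fourierInv_eq _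
  refine ⟨⟨𝓕⁻ (freq d (-s) F), ?_, (isReal_iff_isHerm h1).2 hF⟩, freq_injective (-s) ?_⟩
  · rw [TemperedDistribution.memSobolev_iff_exists_smulLeftCLM_fourier, h1]
    exact ⟨F, smulLeftCLM_jb_jb (neg_add_cancel s) _⟩
  · exact (fourier_dist _).symm.trans h1

theorem hasDerivWithinAt_iff_hat {w : ℝ → Sob d s} {w' : Sob d s} {S : Set ℝ} {t : ℝ} :
    HasDerivWithinAt w w' S t ↔ HasDerivWithinAt (fun t => hat (w t)) (hat w') S t := by
  rw [hasDerivWithinAt_iff_isLittleO, hasDerivWithinAt_iff_isLittleO, ← Asymptotics.isLittleO_norm_left,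
    ← Asymptotics.isLittleO_norm_left (f' := fun x => hat (w x) - _ - _)]
  simp only [← map_sub, ← map_smul, LinearIsometry.norm_map]

end Transfer

/-! ### The quadratic term on the Fourier side -/

section Quadratic

open FourierTransform

variable {d : ℕ} {s : ℝ}

theorem hasTemperateGrowth_dxSymbol :
    (fun ξ : ℝ => (2 * Real.pi * Complex.I * ξ : ℂ)).HasTemperateGrowth := by
  fun_prop

/-- Multiplication of test functions by `2πiξ`. -/
def mulDx (φ : 𝓢(ℝ, ℂ)) : 𝓢(ℝ, ℂ) :=
  SchwartzMap.smulLeftCLM ℂ (fun ξ : ℝ => (2 * Real.pi * Complex.I * ξ : ℂ)) φ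

theorem mulDx_apply (φ : 𝓢(ℝ, ℂ)) (ξ : ℝ) : mulDx φ ξ = 2 * Real.pi * Complex.I * ξ * φ ξ := by
  rw [mulDx, SchwartzMap.smulLeftCLM_apply_apply hasTemperateGrowth_dxSymbol, smul_eq_mul]

theorem fourier_dx_apply (f : 𝓢'(ℝ, CVec d)) (φ : 𝓢(ℝ, ℂ)) :
    (𝓕 (dx f) : 𝓢'(ℝ, CVec d)) φ = (𝓕 f : 𝓢'(ℝ, CVec d)) (mulDx φ) := by
  rw [TemperedDistribution.fourier_apply, TemperedDistribution.fourier_apply,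
    TemperedDistribution.derivCLM_apply_apply]
  congr 1
  have h1 : SchwartzMap.derivCLM ℂ ℂ (𝓕 φ : 𝓢(ℝ, ℂ)) = LineDeriv.lineDerivOp (1 : ℝ) (𝓕 φ) := by
    ext x
    rw [SchwartzMap.derivCLM_apply, SchwartzMap.lineDerivOp_apply_eq_fderiv]
    rfl
  have h2 : -(2 * Real.pi * Complex.I) • SchwartzMap.smulLeftCLM ℂ (inner ℝ · (1 : ℝ)) φ =
      -mulDx φ := by
    ext x
    have h3 : (inner ℝ · (1 : ℝ)).HasTemperateGrowth := by fun_prop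
    rw [neg_apply, smul_apply, SchwartzMap.smulLeftCLM_apply_apply h3,
      mulDx_apply]
    simp
    ring
  rw [h1, SchwartzMap.lineDerivOp_fourier_eq, h2, FourierTransform.fourier_neg, neg_neg]

/-- The function `ξ ↦ û(ξ)`, in terms of `F = ⟨ξ⟩^s û`. -/
def amp (s : ℝ) (F : L2 d) (ξ : ℝ) : CVec d := (jb (-s) ξ : ℂ) • F ξ

theorem integrable_amp (hs : 1 / 2 < s) (F : L2 d) : Integrable (amp s F) volume := by
  have h1 : MemLp (fun ξ => (jb (-s) ξ : ℂ)) 2 (volume : Measure ℝ) := (memLp_jb hs).ofReal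
  exact memLp_one_iff_integrable.1 ((Lp.memLp F).smul h1)

theorem continuous_fourierInv_amp (hs : 1 / 2 < s) (F : L2 d) : Continuous (𝓕⁻ (amp s F)) := by
  have h := VectorFourier.fourierIntegral_continuous (L := -innerₗ ℝ) (μ := (volume : Measure ℝ))
    Real.continuous_fourierChar (by
      change Continuous fun p : ℝ × ℝ => -(inner ℝ p.1 p.2)
      fun_prop) (integrable_amp hs F)
  exact h

theorem integral_fourierInv_smul {f : ℝ → CVec d} (hf : Integrable f volume) (φ : 𝓢(ℝ, ℂ)) :
    ∫ ξ, (𝓕⁻ φ : 𝓢(ℝ, ℂ)) ξ • f ξ = ∫ x, φ x • 𝓕⁻ f x := by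
  have h := VectorFourier.integral_fourierIntegral_smul_eq_flip (L := -innerₗ ℝ)
    (μ := (volume : Measure ℝ)) (ν := (volume : Measure ℝ)) Real.continuous_fourierChar (by
      change Continuous fun p : ℝ × ℝ => -(inner ℝ p.1 p.2)
      fun_prop) φ.integrable hf
  rw [SchwartzMap.fourierInv_coe]
  refine h.trans (integral_congr_ae (.of_forall fun x => ?_))
  simp only [Real.fourierInv_eq, VectorFourier.fourierIntegral]
  congr 2
  funext v
  congr 2
  simp [mul_comm]

/-- The continuous function represented by `u ∈ H^s`, `s > 1/2`. -/
theorem exists_Lp_eq (hs : 1 / 2 < s) (u : Sob d s) :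
    ∃ G : L2 d, u.dist = Lp.toTemperedDistributionCLM (CVec d) volume 2 G ∧
      G =ᵐ[volume] 𝓕⁻ (amp s (hat u)) := by
  have hj := bddMeas_jb (a := -s) (by linarith)
  set G : L2 d := 𝓕⁻ (mulL (fun ξ => (jb (-s) ξ : ℂ)) (hat u)) with hG
  have h1 : u.dist = Lp.toTemperedDistributionCLM (CVec d) volume 2 G := by
    apply (fourierEquiv ℂ 𝓢'(ℝ, CVec d)).injective
    change 𝓕 u.dist = 𝓕 (Lp.toTemperedDistribution G)
    rw [Lp.fourier_toTemperedDistribution_eq, hG, fourier_fourierInv_eq, fourier_dist]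
    ext φ : 1
    rw [freq_apply, Lp.toTemperedDistribution_apply]
    apply integral_congr_ae
    filter_upwards [coeFn_mulL hj (hat u)] with ξ h
    rw [h, smul_smul, mul_comm]
  refine ⟨G, h1, ae_eq_of_integral_contDiff_smul_eq
    ((Lp.memLp G).locallyIntegrable (by norm_num))
    (continuous_fourierInv_amp hs _).locallyIntegrable fun g hg hgc => ?_⟩
  have hg1 : HasCompactSupport (Complex.ofRealCLM ∘ g) := hgc.comp_left rfl
  have hg2 : ContDiff ℝ (⊤ : ℕ∞) (Complex.ofRealCLM ∘ g) := by fun_prop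
  set φ : 𝓢(ℝ, ℂ) := hg1.toSchwartzMap hg2 with hφ
  have hφg : ∀ x, φ x = (g x : ℂ) := fun x => rfl
  have e1 : ∫ x, g x • G x = u.dist φ := by
    rw [h1, Lp.toTemperedDistributionCLM_apply, Lp.toTemperedDistribution_apply]
    refine integral_congr_ae (.of_forall fun x => ?_)
    simp only [hφg]
    exact (Complex.coe_smul (g x) (G x)).symm
  have e2 : u.dist φ = freq d (-s) (hat u) (𝓕⁻ φ : 𝓢(ℝ, ℂ)) := by
    rw [← fourier_dist, TemperedDistribution.fourier_apply, fourier_fourierInv_eq]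
  have e3 : freq d (-s) (hat u) (𝓕⁻ φ : 𝓢(ℝ, ℂ)) =
      ∫ ξ, (𝓕⁻ φ : 𝓢(ℝ, ℂ)) ξ • amp s (hat u) ξ := by
    rw [freq_apply]
    refine integral_congr_ae (.of_forall fun ξ => ?_)
    simp only [amp, smul_smul, mul_comm]
  rw [e1, e2, e3, integral_fourierInv_smul (integrable_amp hs _)]
  refine integral_congr_ae (.of_forall fun x => ?_)
  simp only [hφg]
  exact Complex.coe_smul _ _

theorem conjV_fourierInv_amp (F : L2 d) (hF : IsHerm F) (x : ℝ) :
    conjV (𝓕⁻ (amp s F) x) = 𝓕⁻ (amp s F) x := by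
  rw [Real.fourierInv_eq', ← conjL_apply, ← (conjL d).integral_comp_comm'
    (AddMonoidHomClass.isometry_of_norm (conjL d) norm_conjV).antilipschitz,
    ← integral_neg_eq_self (μ := volume) (fun ξ => conjL d _)]
  apply integral_congr_ae
  filter_upwards [isHerm_iff.1 hF] with ξ h
  rw [conjL_apply, conjV_smul, amp, conjV_smul, h, jb_even, Complex.conj_ofReal, amp,
    ← Complex.exp_conj]
  congr 2
  simp [map_ofNat (starRingEnd ℂ) 2]

variable (Q : RVec d →ₗ[ℝ] RVec d →ₗ[ℝ] RVec d)

theorem exists_isQuadratic (hs : 1 / 2 < s) (u : Sob d s) :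
    ∃ q : 𝓢'(ℝ, CVec d), IsQuadratic Q u.dist q := by
  obtain ⟨G, hG, hGa⟩ := exists_Lp_eq hs u
  have hc := continuous_fourierInv_amp hs (hat u)
  set h := 𝓕⁻ (amp s (hat u)) with hh
  let g : ℝ → RVec d := fun x => WithLp.toLp 2 fun i => (h x i).re
  have hg : ∀ x, complexify d (g x) = h x := fun x => by
    ext i
    have h1 := congrArg (fun v : CVec d => v i)
      (conjV_fourierInv_amp (s := s) (hat u) (isHerm_hat u) x)
    exact Complex.conj_eq_iff_re.1 h1
  have hgm : MemLp g 2 volume := by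
    have h1 : MemLp h 2 volume := (memLp_congr_ae hGa).1 (Lp.memLp G)
    refine h1.of_le (Continuous.aestronglyMeasurable ?_) (.of_forall fun x => ?_)
    · simp only [g]
      fun_prop
    · rw [← norm_complexify, hg]
  refine ⟨_, g, hgm, ?_, rfl⟩
  rw [hG, Lp.toTemperedDistributionCLM_apply, distOf]
  congr 1
  apply Lp.ext
  filter_upwards [hGa, (memLp_complexify hgm).coeFn_toLp] with x h1 h2
  rw [h1, h2, hg]

/-- The distribution `Q(u, u)`, in terms of the continuous representative of `u`. -/
theorem isQuadratic_apply (hs : 1 / 2 < s) {u : Sob d s} {q : 𝓢'(ℝ, CVec d)}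
    (h : IsQuadratic Q u.dist q) (φ : 𝓢(ℝ, ℂ)) :
    q φ = ∫ x, φ x • QC Q (𝓕⁻ (amp s (hat u)) x) (𝓕⁻ (amp s (hat u)) x) := by
  obtain ⟨G, hG, hGa⟩ := exists_Lp_eq hs u
  obtain ⟨g, hg, h1, h2⟩ := h
  have e : G = (memLp_complexify hg).toLp _ := by
    apply toTemperedDistribution_injective d
    rw [← hG, h1]
    rfl
  have e1 := (memLp_complexify hg).coeFn_toLp
  rw [← e] at e1
  rw [h2, distOf, Lp.toTemperedDistribution_apply]
  apply integral_congr_ae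
  filter_upwards [hGa, e1, (memLp_complexify (memLp_quadratic Q hg)).coeFn_toLp] with x h3 h4 h5
  rw [h5, ← h3, h4, QC_complexify]

/-- The density on the frequency plane whose push-forward under addition is the Fourier transform of
`Q(u, u)`. -/
def plane (s : ℝ) (F : L2 d) (p : ℝ × ℝ) : CVec d := QC Q (amp s F p.1) (amp s F p.2)

theorem integrable_plane (hs : 1 / 2 < s) (F : L2 d) : Integrable (plane Q s F) volume := by
  have h := integrable_amp hs F
  exact Integrable.op_fst_snd (op := fun u v => QC Q u v) (by fun_prop)
    ⟨‖QC Q‖, fun u v => (QC Q).le_opNorm₂ u v⟩ h h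

theorem QC_fourierInv_amp (hs : 1 / 2 < s) (F : L2 d) (x : ℝ) :
    QC Q (𝓕⁻ (amp s F) x) (𝓕⁻ (amp s F) x) =
      ∫ p : ℝ × ℝ, Real.fourierChar ((p.1 + p.2) * x) • plane Q s F p := by
  have h1 : Integrable (fun ξ => Real.fourierChar (inner ℝ ξ x) • amp s F ξ) volume := by
    simpa using (Real.fourierIntegral_convergent_iff (-x)).2 (integrable_amp hs F)
  rw [Real.fourierInv_eq, ← integral_prod_bilin (QC Q) h1 h1]
  refine integral_congr_ae (.of_forall fun p => ?_)
  simp only [plane, Circle.smul_def, map_smul, smul_apply, smul_smul, add_mul,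
    AddChar.map_add_eq_mul, Circle.coe_mul]
  simp [mul_comm]

theorem integral_smul_QC_fourierInv (hs : 1 / 2 < s) (F : L2 d) (χ : 𝓢(ℝ, ℂ)) :
    ∫ x, (𝓕 χ : 𝓢(ℝ, ℂ)) x • QC Q (𝓕⁻ (amp s F) x) (𝓕⁻ (amp s F) x) =
      ∫ p : ℝ × ℝ, χ (p.1 + p.2) • plane Q s F p := by
  -- the Fourier transform on the line, evaluated on the sums `p.1 + p.2`
  let L : ℝ →ₗ[ℝ] (ℝ × ℝ) →ₗ[ℝ] ℝ :=
    -(LinearMap.mul ℝ ℝ).compl₂ (LinearMap.fst ℝ ℝ ℝ + LinearMap.snd ℝ ℝ ℝ)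
  have hL : ∀ x p, L x p = -(x * (p.1 + p.2)) := fun x p => rfl
  have h := VectorFourier.integral_fourierIntegral_smul_eq_flip (L := L)
    (μ := (volume : Measure ℝ)) (ν := (volume : Measure (ℝ × ℝ))) Real.continuous_fourierChar (by
      simp only [hL]
      fun_prop) (𝓕 χ : 𝓢(ℝ, ℂ)).integrable (integrable_plane Q hs F)
  have e1 : ∀ p : ℝ × ℝ, VectorFourier.fourierIntegral Real.fourierChar volume L
      (𝓕 χ : 𝓢(ℝ, ℂ)) p = χ (p.1 + p.2) := fun p => by
    have h2 : (𝓕⁻ (𝓕 χ : 𝓢(ℝ, ℂ)) : 𝓢(ℝ, ℂ)) (p.1 + p.2) = χ (p.1 + p.2) := by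
      rw [fourierInv_fourier_eq]
    rw [← h2, SchwartzMap.fourierInv_coe, Real.fourierInv_eq, VectorFourier.fourierIntegral]
    simp only [hL, neg_neg]
    refine integral_congr_ae (.of_forall fun x => ?_)
    simp [mul_comm]
  simp only [e1] at h
  rw [h]
  refine integral_congr_ae (.of_forall fun x => ?_)
  simp only [QC_fourierInv_amp Q hs, VectorFourier.fourierIntegral, LinearMap.flip_apply, hL,
    neg_neg, mul_comm]

end Quadratic

/-! ### The Cauchy problem -/

section Equation

open FourierTransform

variable {d : ℕ} {s r : ℝ} {Q : RVec d →ₗ[ℝ] RVec d →ₗ[ℝ] RVec d}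

theorem smul_kern_eq (F : L2 d) (φ : 𝓢(ℝ, ℂ)) (p : ℝ × ℝ) :
    mulDx φ (p.1 + p.2) • plane Q s F p =
      (φ (p.1 + p.2) * kern s p.1 p.2) • QC Q (F p.1) (F p.2) := by
  rw [mulDx_apply, plane, amp, amp, map_smul, map_smul, smul_apply, smul_smul, smul_smul, kern]
  congr 1
  push_cast
  ring

/-- The Fourier transform of `∂_x Q(u, u)`, tested against `φ`. With `freq_bil` it identifies the
pointwise nonlinearity with the bilinear operator given by its frequency kernel. -/
theorem fourier_dx_quadratic (hs : 1 / 2 < s) {u : Sob d s} {q : 𝓢'(ℝ, CVec d)}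
    (h : IsQuadratic Q u.dist q) (φ : 𝓢(ℝ, ℂ)) : (𝓕 (dx q) : 𝓢'(ℝ, CVec d)) φ =
      ∫ p : ℝ × ℝ, (φ (p.1 + p.2) * kern s p.1 p.2) • QC Q (hat u p.1) (hat u p.2) := by
  rw [fourier_dx_apply, TemperedDistribution.fourier_apply, isQuadratic_apply Q hs h,
    integral_smul_QC_fourierInv Q hs]
  exact integral_congr_ae (.of_forall fun p => smul_kern_eq (hat u) φ p)

theorem freq_bil (hs : 3 / 2 < s) (hr : r ≤ s - 1) (F : L2 d) (φ : 𝓢(ℝ, ℂ)) :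
    freq d (-r) (bil Q (kernR s r) F F) φ =
      ∫ p : ℝ × ℝ, (φ (p.1 + p.2) * kern s p.1 p.2) • QC Q (F p.1) (F p.2) := by
  set B := bil Q (kernR s r) F F with hB
  set χ : 𝓢(ℝ, ℂ) := SchwartzMap.smulLeftCLM ℂ (fun ξ => (jb (-r) ξ : ℂ)) φ with hχ
  have hχ' : ∀ ξ, χ ξ = (jb (-r) ξ : ℂ) * φ ξ := fun ξ => by
    rw [hχ, SchwartzMap.smulLeftCLM_apply_apply (hasTemperateGrowth_jb _), smul_eq_mul]
  have hi1 : Integrable (fun ξ => ((jb (-r) ξ : ℂ) * φ ξ) • B ξ) volume := by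
    simp only [← hχ']
    exact memLp_one_iff_integrable.1 ((Lp.memLp B).smul (χ.memLp 2))
  have hi2 : Integrable (fun p : ℝ × ℝ => (φ (p.1 + p.2) * kern s p.1 p.2) •
      QC Q (F p.1) (F p.2)) volume := by
    simp only [← smul_kern_eq]
    refine (integrable_plane Q (by linarith) F).bdd_smul (SchwartzMap.seminorm ℝ 0 0 (mulDx φ))
      (((mulDx φ).continuous.comp (by fun_prop)).aestronglyMeasurable) (.of_forall fun p => ?_)
    exact (mulDx φ).norm_le_seminorm ℝ _
  rw [freq_apply]
  refine ext_inner_left ℂ fun v => ?_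
  rw [← integral_inner hi1, ← integral_inner hi2]
  -- the test function against which the bilinear operator is evaluated
  let h : ℝ → CVec d := fun ξ => (starRingEnd ℂ) (χ ξ) • v
  have hh : MemLp h 2 volume := by
    have h1 : MemLp (conjS χ) 2 (volume : Measure ℝ) := (conjS χ).memLp 2
    refine h1.of_le_mul (c := ‖v‖)
      (((conjS χ).continuous.smul continuous_const).aestronglyMeasurable) (.of_forall fun ξ => ?_)
    rw [norm_smul, mul_comm]
    rfl
  have e := inner_bil Q (adm_kernR hs hr) F F (hh.toLp h)
  rw [form_congr_ae Q .rfl .rfl hh.coeFn_toLp, L2.inner_def, form] at e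
  have e1 := congrArg (starRingEnd ℂ) e
  rw [← integral_conj, ← integral_conj] at e1
  refine Eq.trans ?_ (e1.trans ?_)
  · apply integral_congr_ae
    filter_upwards [hh.coeFn_toLp] with ξ h1
    rw [h1, inner_conj_symm, ← hχ', inner_smul_left, Complex.conj_conj, inner_smul_right]
  · refine integral_congr_ae (.of_forall fun p => ?_)
    simp only [integrand, map_mul, inner_conj_symm, h, inner_smul_left, inner_smul_right,
      Complex.conj_conj, hχ', kernR]
    have e2 : (jb (-r) (p.1 + p.2) : ℂ) * jb r (p.1 + p.2) = 1 := by
      rw [← Complex.ofReal_mul, jb_neg_mul, Complex.ofReal_one]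
    linear_combination (φ (p.1 + p.2) * kern s p.1 p.2 *
      inner ℂ v (QC Q (F p.1) (F p.2))) * e2

/-- The equation at a fixed time, on the Fourier side. -/
theorem equation_iff (hs : 3 / 2 < s) (hr : r ≤ s - 1) {δ : ℝ} (h : r ≤ s - 3 ∨ δ = 0)
    {u : Sob d s} (w' : Sob d r) {q : 𝓢'(ℝ, CVec d)} (hq : IsQuadratic Q u.dist q) :
    w'.dist - δ • dx (dx (dx u.dist)) + dx q = 0 ↔ hat w' = rhs Q δ s r (hat u) := by
  have key : 𝓕 (w'.dist - δ • dx (dx (dx u.dist)) + dx q) =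
      freq d (-r) (hat w' - rhs Q δ s r (hat u)) := by
    ext φ : 1
    have e0 : (𝓕 (w'.dist - δ • dx (dx (dx u.dist)) + dx q) : 𝓢'(ℝ, CVec d)) φ =
        (𝓕 w'.dist : 𝓢'(ℝ, CVec d)) φ - δ • (𝓕 (dx (dx (dx u.dist))) : 𝓢'(ℝ, CVec d)) φ +
          (𝓕 (dx q) : 𝓢'(ℝ, CVec d)) φ := rfl
    have e1 : freq d (-r) (hat w' - rhs Q δ s r (hat u)) φ = freq d (-r) (hat w') φ -
        freq d (-r) (mulL (fun ξ => disp δ ξ * jb (r - s) ξ) (hat u)) φ +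
        freq d (-r) (bil Q (kernR s r) (hat u) (hat u)) φ := by
      rw [rhs, map_sub, map_sub, sub_sub_eq_add_sub, sub_add_eq_add_sub]
      rfl
    have e2 : δ • (𝓕 (dx (dx (dx u.dist))) : 𝓢'(ℝ, CVec d)) φ =
        freq d (-r) (mulL (fun ξ => disp δ ξ * jb (r - s) ξ) (hat u)) φ := by
      rw [fourier_dx_apply, fourier_dx_apply, fourier_dx_apply, fourier_dist, freq_apply,
        freq_apply, ← integral_smul]
      apply integral_congr_ae
      filter_upwards [coeFn_mulL (bddMeas_disp_jb h) (hat u)] with ξ h1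
      rw [h1, ← Complex.coe_smul, smul_smul, smul_smul, mulDx_apply, mulDx_apply, mulDx_apply, disp]
      have e : jb (-s) ξ = jb (-r) ξ * jb (r - s) ξ := by
        rw [jb_mul]
        congr 1
        ring
      rw [e]
      congr 1
      push_cast
      ring
    rw [e0, e1, e2, fourier_dist, fourier_dx_quadratic (by linarith) hq, freq_bil hs hr]
  rw [← sub_eq_zero (a := hat w'), ← (freq_injective (-r)).eq_iff, ← key, map_zero]
  refine ((fourierEquiv ℂ 𝓢'(ℝ, CVec d)).map_eq_zero_iff).symm

variable {T : ℝ}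

/-- Solutions of the Cauchy problem, in terms of `⟨ξ⟩^s û(t, ξ)`. -/
theorem isSolution_iff (hs : 3 / 2 < s) (hr : r ≤ s - 1) {δ : ℝ} (h : r ≤ s - 3 ∨ δ = 0)
    (hT : 0 < T) {A₀ : Sob d s} {u : C(Set.Icc (0 : ℝ) T, Sob d s)} {F : ℝ → L2 d}
    (hF : ∀ t : Set.Icc (0 : ℝ) T, hat (u t) = F t) :
    IsSolution Q δ s r T A₀ u ↔ F 0 = hat A₀ ∧ ∀ t ∈ Set.Icc 0 T,
      HasDerivWithinAt (fun t => mulL (fun ξ => (jb (r - s) ξ : ℂ)) (F t)) (rhs Q δ s r (F t))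
        (Set.Icc 0 T) t := by
  have hj := bddMeas_jb (a := r - s) (by linarith)
  have hFh : ∀ t ∈ Set.Icc 0 T, IsHerm (F t) := fun t ht => hF ⟨t, ht⟩ ▸ isHerm_hat _
  constructor
  · rintro ⟨h0, w, hw, hwd, heq⟩
    refine ⟨by rw [← hF ⟨0, le_rfl, hT.le⟩, h0 _ rfl], fun t ht => ?_⟩
    obtain ⟨q, hq, hE⟩ := heq ⟨t, ht⟩
    have h1 := ((hwd.differentiableOn one_ne_zero) t ht).hasDerivWithinAt
    rw [hasDerivWithinAt_iff_hat, (equation_iff hs hr h _ hq).1 hE, hF] at h1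
    refine h1.congr_of_mem (fun x hx => ?_) ht
    rw [← hF ⟨x, hx⟩]
    exact ((hat_eq_iff (by linarith) _ _).1 (hw ⟨x, hx⟩)).symm
  · rintro ⟨h0, hd⟩
    have hex : ∀ t, ∃ w w' : Sob d r, t ∈ Set.Icc 0 T →
        hat w = mulL (fun ξ => (jb (r - s) ξ : ℂ)) (F t) ∧ hat w' = rhs Q δ s r (F t) := by
      intro t
      by_cases ht : t ∈ Set.Icc 0 T
      · obtain ⟨w, hw⟩ := exists_hat_eq r ((hFh t ht).mulL hj fun ξ => by
          rw [jb_even, Complex.conj_ofReal])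
        obtain ⟨w', hw'⟩ := exists_hat_eq r (isHerm_rhs (Q := Q) hs hr h (hFh t ht))
        exact ⟨w, w', fun _ => ⟨hw, hw'⟩⟩
      · exact ⟨0, 0, fun h => absurd h ht⟩
    choose w w' hw using hex
    have hwd : ∀ t ∈ Set.Icc 0 T, HasDerivWithinAt w (w' t) (Set.Icc 0 T) t := fun t ht => by
      rw [hasDerivWithinAt_iff_hat, (hw t ht).2]
      exact (hd t ht).congr_of_mem (fun x hx => (hw x hx).1) ht
    have hud : UniqueDiffOn ℝ (Set.Icc (0 : ℝ) T) := uniqueDiffOn_Icc hT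
    have hder : ∀ t ∈ Set.Icc 0 T, derivWithin w (Set.Icc 0 T) t = w' t := fun t ht =>
      (hwd t ht).derivWithin (hud t ht)
    refine ⟨fun t ht => hat.injective ?_, w, fun t => ?_, ?_, fun t => ?_⟩
    · rw [hF, ht, h0]
    · rw [hat_eq_iff (by linarith : r ≤ s), hF]
      exact (hw t t.2).1
    · refine (contDiffOn_one_iff_derivWithin hud).2
        ⟨fun t ht => (hwd t ht).differentiableWithinAt, ?_⟩
      have hFc : ContinuousOn F (Set.Icc 0 T) := by
        rw [continuousOn_iff_continuous_domRestrict]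
        exact (hat.continuous.comp u.continuous).congr hF
      refine (hat (d := d) (s := r)).isometry.comp_continuousOn_iff.1
        (((continuous_rhs (Q := Q) (s := s) (r := r) δ).comp_continuousOn hFc).congr
          fun t ht => ?_)
      rw [Function.comp_apply, hder t ht, (hw t ht).2]
      rfl
    · obtain ⟨q, hq⟩ := exists_isQuadratic Q (by linarith) (u t)
      refine ⟨q, hq, (equation_iff hs hr h _ hq).2 ?_⟩
      rw [hder t t.2, (hw t t.2).2, hF]

/-- Well-posedness in `C([0,T], H^s) ∩ C¹([0,T], H^r)`, on a time interval depending only on the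
norm of the data. -/
theorem existsUnique_isSolution (hQ : IsFullySymmetric Q) (hs : 3 / 2 < s) (hr : r ≤ s - 1)
    {δ : ℝ} (h : r ≤ s - 3 ∨ δ = 0) (A₀ : Sob d s) (hT : 0 < T)
    (hTA : 2 * energyConst Q s * (1 + ‖A₀‖ ^ 2) * T ≤ 1) :
    ∃! u : C(Set.Icc (0 : ℝ) T, Sob d s), IsSolution Q δ s r T A₀ u := by
  refine existsUnique_of_exists_of_unique ?_ fun u v hu hv => ?_
  · obtain ⟨F, h0, hFh, hFc, hFs⟩ := exists_approxSol hQ hs δ (isHerm_hat A₀) hT.le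
      (by rwa [LinearIsometry.norm_map])
    have hex : ∀ t : Set.Icc (0 : ℝ) T, ∃ a : Sob d s, hat a = F t :=
      fun t => exists_hat_eq s (hFh t t.2)
    choose u hu using hex
    have huc : Continuous u := by
      refine (hat (d := d) (s := s)).isometry.isEmbedding.continuous_iff.2 ?_
      exact (continuousOn_iff_continuous_domRestrict.1 hFc).congr fun t => (hu t).symm
    exact ⟨⟨u, huc⟩, (isSolution_iff (u := ⟨u, huc⟩) (F := F) hs hr h hT hu).2
      ⟨h0, fun t ht => hasDerivWithinAt_of_approxSol hs hr h hFc hFs ht⟩⟩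
  · have hext : ∀ u : C(Set.Icc (0 : ℝ) T, Sob d s), ∀ t : Set.Icc (0 : ℝ) T,
        hat (u t) = hat (Set.IccExtend hT.le u t) := fun u t => by
      rw [Set.IccExtend_val]
    obtain ⟨hu0, hud⟩ := (isSolution_iff hs hr h hT
      (F := fun t => hat (Set.IccExtend hT.le u t)) (hext u)).1 hu
    obtain ⟨hv0, hvd⟩ := (isSolution_iff hs hr h hT
      (F := fun t => hat (Set.IccExtend hT.le v t)) (hext v)).1 hv
    ext1 t
    apply (hat (d := d) (s := s)).injective
    rw [hext u, hext v]
    refine eq_of_approxSol (M := max ‖u‖ ‖v‖) (F := fun t => hat (Set.IccExtend hT.le u t))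
      (G := fun t => hat (Set.IccExtend hT.le v t)) hQ hs (fun t ht => ?_) (fun t ht => ?_)
      (fun n => approxSol_of_hasDerivWithinAt hs hr h hud n)
      (fun n => approxSol_of_hasDerivWithinAt hs hr h hvd n) (hu0.trans hv0.symm) t.2
    · refine ⟨isHerm_hat _, ?_⟩
      rw [LinearIsometry.norm_map]
      exact (u.norm_coe_le_norm _).trans (le_max_left _ _)
    · refine ⟨isHerm_hat _, ?_⟩
      rw [LinearIsometry.norm_map]
      exact (v.norm_coe_le_norm _).trans (le_max_right _ _)

end Equation

end VectorKdV

end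

theorem mainTheorem3 (d : ℕ)
    (Q : VectorKdV.RVec d →ₗ[ℝ] VectorKdV.RVec d →ₗ[ℝ] VectorKdV.RVec d)
    (hQ : VectorKdV.IsFullySymmetric Q) (s : ℝ) (hs : 3 / 2 < s) (A₀ : VectorKdV.Sob d s) :
    ∃ T : ℝ, 0 < T ∧ ∀ δ : ℝ,
      (∃! u : C(Set.Icc (0 : ℝ) T, VectorKdV.Sob d s),
        VectorKdV.IsSolution Q δ s (s - 3) T A₀ u) ∧
      (δ = 0 → ∃! u : C(Set.Icc (0 : ℝ) T, VectorKdV.Sob d s),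
        VectorKdV.IsSolution Q δ s (s - 1) T A₀ u) := by
  have hE : 0 ≤ VectorKdV.energyConst Q s := VectorKdV.energyConst_nonneg (by linarith)
  -- the time of existence given by the `δ`-independent energy estimate
  set T : ℝ := 1 / (2 * (VectorKdV.energyConst Q s + 1) * (1 + ‖A₀‖ ^ 2)) with hT
  have hT0 : 0 < T := by positivity
  have hTA : 2 * VectorKdV.energyConst Q s * (1 + ‖A₀‖ ^ 2) * T ≤ 1 := by
    rw [hT, mul_one_div, div_le_one (by positivity)]
    gcongr
    linarith
  exact ⟨T, hT0, fun δ =>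
    ⟨VectorKdV.existsUnique_isSolution hQ hs (by linarith) (Or.inl le_rfl) A₀ hT0 hTA,
      fun hδ => VectorKdV.existsUnique_isSolution hQ hs le_rfl (Or.inr hδ) A₀ hT0 hTA⟩⟩
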